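/- **Setting.** Let $\mathcal S,\mathcal O,\mathcal A$ be finite sets with $\mathcal A\neq\emptyset$, let $H\ge 1$ be the horizon and $r_h:\mathcal O\times\mathcal A\to[-1,1]$ ($h\in[H]$) known rewards. A POMDP is given by transition kernels $\mathbb T_h(s'|s,a)$, emission kernels $\mathbb O_h(o|s)$, $h\in[H]$, and an initial distribution $\mu_1$; it is low-rank with dimension $d_{\mathrm{trans}}$ if $\mathbb T_h(s'|s,a)=\psi_h(s')^\top\phi_h(s,a)$ with $\psi_h(s'),\phi_h(s,a)\in\mathbb R^{d_{\mathrm{trans}}}$ for all $h\in[H]$. For $0\le h\le H-1$, the system dynamics matrix $D_h$ has the entry $\mathbb P(t\,|\,\tau_h)$ at the test $t=(o_{h+1},a_{h+1},\dots,a_{h+W-1},o_{h+W})$, $1\le W\le H-h$, and the history $\tau_h=(o_1,a_1,\dots,o_h,a_h)$; this is the probability of the observations of $t$ after $\tau_h$ if the actions of $t$ are executed, and $0$ for unreachable $\tau_h$. Put $d_{\mathrm{PSR}}=\max_{0\le h\le H-1}\operatorname{rank}D_h$. Policies are history-dependent and randomized, $\mathbb P^\pi(\tau_H)$ is the law of the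 trajectory under $\pi$, $V^\pi$ the expected total reward, and $V^*=\sup_\pi V^\pi$. Let $1\le m\le H$ and $\mathcal U=(\mathcal O\times\mathcal A)^{m-1}\times\mathcal O$ (the $m$-step futures). A POMDP is $m$-step weakly revealing if for every $h\in[H-m+1]$ the matrix with entries $\mathbb P(o_{h:h+m-1}\,|\,s_h=s,\mathrm{do}(a_{h:h+m-2}))$, with rows indexed by $\mathcal U$ and columns by $\mathcal S$, has rank $|\mathcal S|$. The set $\mathcal U$ is a core test set after histories of length $h$ if the submatrix $\overline D_h$ of $D_h$ with rows in $\mathcal U$ has the rank of $D_h$. A core matrix $K_h$ is a submatrix of $\overline D_h$ made of $\operatorname{rank}D_h$ linearly independent columns, chosen such that $\|K_h^\dagger\|_{1\mapsto1}$ is smallest ($\dagger$: Moore–Penrose inverse). **Model class.** $\mathcal F$ is a set of models $f=(\Phi_f,\Psi_f,\mathbb O_f,\mu_f)$, where $\Phi_f:\mathcal S\times\mathcal A\times[H]\to\mathbb R^{d_{\mathrm{trans}}}$ and $\Psi_f:\mathcal S\times[H]\to\mathbb R^{d_{\mathrm{trans}}}$ give the transitions $\Psi_f(s',h)^\top\Phi_f(s,a,h)$.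 Assume, for some $\alpha>0$: the true model $f^*$ belongs to $\mathcal F$; every $f\in\mathcal F$ is a POMDP; and for every $f\in\mathcal F$ and $0\le h\le H-m$, $\mathcal U$ is a core test set after histories of length $h$ and $\|K_{h;f}^\dagger\|_{1\mapsto 1}\le 1/\alpha$. Assume also that the entries of all $\Phi_f,\Psi_f$ are bounded by a constant $B>0$ in absolute value. Let $\mathcal Y_\Phi,\mathcal Y_\Psi,\mathcal Y_{\mathbb O},\mathcal Y_\mu$ be the $\ell_\infty$-covering numbers of the classes $\{\Phi_f\},\{\Psi_f\},\{\mathbb O_f\},\{\mu_f\}$, by arbitrary (not necessarily model) functions. Let $\mathcal N_{\mathcal F}(\epsilon)$ be the $\epsilon$-bracket number: the least $n$ such that there are pairs $(g_1^i,g_2^i)_{i\le n}$ of real functions of $(\pi,\tau_H)$ with $\|g_1^i(\pi,\cdot)-g_2^i(\pi,\cdot)\|_1\le\epsilon$ for all $i,\pi$, and such that each $f\in\mathcal F$ satisfies $g_1^i\le\mathbb P_f\le g_2^i$ for some $i$. **Algorithm (CRANE up to step $H-m$).** Start with an empty data set $\mathcal D$. In round $k=1,\dots,K$, let $\mathcal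 B^k$ be the set of $f\in\mathcal F$ with $\sum_{(\pi,\tau_H)\in\mathcal D}\log\mathbb P_f^\pi(\tau_H)\ge\sup_{f'\in\mathcal F}\sum_{(\pi,\tau_H)\in\mathcal D}\log\mathbb P_{f'}^\pi(\tau_H)-\beta$; choose $(f^k,\pi^k)\in\arg\max_{f\in\mathcal B^k,\pi}V_f^\pi$ (assumed to exist); for each $h\in\{0,\dots,H-m\}$ and $u\in\mathcal A^{m-1}$ run one episode, following $\pi^k$ in steps $1,\dots,h-1$, a uniform action at step $h$, the actions $u$ from step $h+1$ on and uniform actions afterwards (for $h=0$, $u$ starts at step $1$), and add the policy and the trajectory to $\mathcal D$. The output $\widehat\pi$ is the uniform mixture of $\pi^1,\dots,\pi^K$, so $V^{\widehat\pi}=\frac1K\sum_kV^{\pi^k}$. **Statement.** 1. Every low-rank POMDP satisfies $d_{\mathrm{PSR}}\le d_{\mathrm{trans}}$. 2. There are an absolute constant $c>0$ and an absolute polynomial $P$ in eleven variables, and for every $B>0$ a constant $c_0>0$ depending only on $B$, such that the following holds for all data as above with $f^*$ $m$-step weakly revealing, all $\delta\in(0,1]$, $\epsilon>0$ and $K\ge1$.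 Put $\epsilon_{\mathrm b}=\frac{1}{KH|\mathcal A|^{m-1}}$ and $\epsilon_{\mathrm{LR}}=c_0\,\epsilon_{\mathrm b}/(|\mathcal O|^{H+2}|\mathcal A|^H)$, and $$\overline{\mathcal N}=\mathcal Y_\Phi(\epsilon_{\mathrm{LR}}/d_{\mathrm{trans}})\,\mathcal Y_\Psi(\epsilon_{\mathrm{LR}}/d_{\mathrm{trans}})\,\mathcal Y_{\mathbb O}(\epsilon_{\mathrm{LR}})\,\mathcal Y_\mu(\epsilon_{\mathrm{LR}}).$$ Let $N=\overline{\mathcal N}$ or, more generally, let $N$ be any integer with $\mathcal N_{\mathcal F}(\epsilon_{\mathrm b})\le N\le\overline{\mathcal N}$. Run CRANE up to step $H-m$ with $\beta=c\log(NKH|\mathcal A|^{m-1}/\delta)$. If $$K\ \ge\ \frac1{\epsilon^2}\,P\Big(d_{\mathrm{trans}},|\mathcal A|^m,\tfrac1\alpha,\log\mathcal Y_\Phi(\tfrac{\epsilon_{\mathrm{LR}}}{d_{\mathrm{trans}}}),\log\mathcal Y_\Psi(\tfrac{\epsilon_{\mathrm{LR}}}{d_{\mathrm{trans}}}),\log\mathcal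 Y_{\mathbb O}(\epsilon_{\mathrm{LR}}),\log\mathcal Y_\mu(\epsilon_{\mathrm{LR}}),H,\log|\mathcal O|,\log\tfrac1\delta,\log(1+\tfrac1\epsilon)\Big),$$ then $V^{\widehat\pi}\ge V^*-\epsilon$ with probability at least $1-\delta$. -/

import Mathlib

noncomputable section

namespace LowRankPSR

/-! ### Finite-horizon POMDPs

Steps are indexed from `0`: the index `h : Fin H` stands for step `h + 1`. -/

/-- The numerical data of an episodic POMDP: transition kernels `trans h s a s'`,
emission kernels `emit h s o` and initial state distribution `init s`. -/
structure POMDP (S O A : Type*) (H : ℕ) where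
  trans : Fin H → S → A → S → ℝ
  emit : Fin H → S → O → ℝ
  init : S → ℝ

/-- A trajectory of a whole episode. -/
abbrev Traj (O A : Type*) (H : ℕ) := Fin H → O × A

/-- A history-dependent randomized policy: given the past pairs `(o_1, a_1), …, (o_{h-1}, a_{h-1})`
and the current observation `o_h`, a distribution over actions. -/
abbrev Policy (O A : Type*) := List (O × A) → O → PMF A

/-- Tests consisting of `w` observation-action pairs followed by one observation. -/
abbrev Test (O A : Type*) (w : ℕ) := (Fin w → O × A) × O

section Dynamics

variable {S O A : Type*} [Fintype S] [Fintype O] [Fintype A] {H : ℕ}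

/-- All kernels are families of probability distributions. -/
structure POMDP.IsValid (M : POMDP S O A H) : Prop where
  trans_nonneg : ∀ h s a s', 0 ≤ M.trans h s a s'
  trans_sum : ∀ h s a, ∑ s', M.trans h s a s' = 1
  emit_nonneg : ∀ h s o, 0 ≤ M.emit h s o
  emit_sum : ∀ h s, ∑ o, M.emit h s o = 1
  init_nonneg : ∀ s, 0 ≤ M.init s
  init_sum : ∑ s, M.init s = 1

/-- The transition kernels factor through `ℝ^d`: `T_h(s' | s, a) = ψ_h(s')ᵀ φ_h(s, a)`. -/
def POMDP.IsLowRank (M : POMDP S O A H) (d : ℕ) : Prop :=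
  ∃ (φ : Fin H → S → A → Fin d → ℝ) (ψ : Fin H → S → Fin d → ℝ),
    ∀ h s a s', M.trans h s a s' = ψ h s' ⬝ᵥ φ h s a

/-- Transition kernel indexed by natural numbers (`0` beyond the horizon, never used). -/
def POMDP.transAt (M : POMDP S O A H) (h : ℕ) (s : S) (a : A) (s' : S) : ℝ :=
  if hh : h < H then M.trans ⟨h, hh⟩ s a s' else 0

/-- Emission kernel indexed by natural numbers (`0` beyond the horizon: no observation in `O` is
generated after the end of the episode). -/
def POMDP.emitAt (M : POMDP S O A H) (h : ℕ) (s : S) (o : O) : ℝ :=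
  if hh : h < H then M.emit ⟨h, hh⟩ s o else 0

/-- One step of the unnormalized filter: from weights `b` on the state at index `h`, emit `x.1`,
execute `x.2` and move to the next state. -/
def POMDP.step (M : POMDP S O A H) (h : ℕ) (b : S → ℝ) (x : O × A) : S → ℝ :=
  fun s' => ∑ s, b s * M.emitAt h s x.1 * M.transAt h s x.2 s'

/-- Unnormalized filter along a list of observation-action pairs, starting at index `h`. -/
def POMDP.filter (M : POMDP S O A H) : ℕ → (S → ℝ) → List (O × A) → S → ℝ
  | _, b, [] => b
  | h, b, x :: l => M.filter (h + 1) (M.step h b x) l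

/-- Weight of seeing the observations of a test when its actions are executed, starting at
index `h` from the weights `b` on the state. -/
def POMDP.testWeight (M : POMDP S O A H) (h : ℕ) (b : S → ℝ) {w : ℕ} (t : Test O A w) : ℝ :=
  ∑ s, M.filter h b (List.ofFn t.1) s * M.emitAt (h + w) s t.2

/-- Probability of the observations of a history when its actions are executed. -/
def POMDP.histProb (M : POMDP S O A H) {n : ℕ} (τ : Fin n → O × A) : ℝ :=
  ∑ s, M.filter 0 M.init (List.ofFn τ) s

/-- `P(t | τ)`, the probability that the test `t` succeeds after the history `τ` of length `n`
(`0`, by `x / 0 = 0`, if `τ` is unreachable). -/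
def POMDP.testProb (M : POMDP S O A H) {n w : ℕ} (t : Test O A w) (τ : Fin n → O × A) : ℝ :=
  M.testWeight n (M.filter 0 M.init (List.ofFn τ)) t / M.histProb τ

/-! ### System dynamics matrices, core tests, core matrices -/

/-- The system dynamics matrix `D_h`: rows are all the tests that fit in the remaining steps,
columns are all the histories of length `h`. -/
def POMDP.dynMatrix (M : POMDP S O A H) (h : ℕ) :
    Matrix (Σ w : Fin (H - h), Test O A w) (Fin h → O × A) ℝ :=
  Matrix.of fun t τ => M.testProb t.2 τ

/-- The PSR rank `d_PSR = max_h rank D_h` over `h = 0, …, H - 1`. -/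
def POMDP.psrRank (M : POMDP S O A H) : ℕ :=
  Finset.univ.sup fun h : Fin H => (M.dynMatrix h).rank

/-- The submatrix of `D_h` whose rows are the `m`-step futures `(O × A)^{m-1} × O`. -/
def POMDP.futureMatrix (M : POMDP S O A H) (m h : ℕ) :
    Matrix (Test O A (m - 1)) (Fin h → O × A) ℝ :=
  Matrix.of fun t τ => M.testProb t τ

/-- The `m`-step futures form a core test set after histories of length `h`. -/
def POMDP.IsCoreTestSet (M : POMDP S O A H) (m h : ℕ) : Prop :=
  (M.futureMatrix m h).rank = (M.dynMatrix h).rank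

/-- `X` is the Moore-Penrose inverse of `K`. -/
structure IsPinv {p q : Type*} [Fintype p] [Fintype q] (K : Matrix p q ℝ) (X : Matrix q p ℝ) :
    Prop where
  mul₁ : K * X * K = K
  mul₂ : X * K * X = X
  symm₁ : (K * X).transpose = K * X
  symm₂ : (X * K).transpose = X * K

/-- The operator norm of `X` from `ℓ¹` to `ℓ¹` is at most `C`. -/
def OneNormLE {p q : Type*} [Fintype p] [Fintype q] (X : Matrix q p ℝ) (C : ℝ) : Prop :=
  ∀ v : p → ℝ, ∑ i, |(X.mulVec v) i| ≤ C * ∑ j, |v j|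

/-- Regularity after histories of length `h` for the `m`-step futures: for some choice of
`rank D_h` core histories, the matrix `K` of their predictive states has full column rank and
its pseudo-inverse has `ℓ¹ → ℓ¹` norm at most `1 / α`. As there are finitely many choices, this
says that the core matrix for which this norm is smallest satisfies the bound. -/
def POMDP.IsRegularAt (M : POMDP S O A H) (m h : ℕ) (α : ℝ) : Prop :=
  ∃ core : Fin (M.dynMatrix h).rank → (Fin h → O × A),
    ((M.futureMatrix m h).submatrix id core).rank = (M.dynMatrix h).rank ∧
    ∃ X, IsPinv ((M.futureMatrix m h).submatrix id core) X ∧ OneNormLE X (1 / α)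

open scoped Classical in
/-- The `m`-step emission matrix at index `h`: the entry at `((o, a), s)` is the probability of
the observations `o_h, …, o_{h+m-1}` given `s_h = s` when `a_h, …, a_{h+m-2}` are executed. -/
def POMDP.emissionMatrix (M : POMDP S O A H) (m h : ℕ) : Matrix (Test O A (m - 1)) S ℝ :=
  Matrix.of fun t s => M.testWeight h (fun s' => if s' = s then 1 else 0) t

/-- `m`-step weakly revealing: all `m`-step emission matrices have rank `|S|`. -/
def POMDP.IsWeaklyRevealing (M : POMDP S O A H) (m : ℕ) : Prop :=
  ∀ h, h + m ≤ H → (M.emissionMatrix m h).rank = Fintype.card S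

/-! ### Policies and values -/

/-- The product of the probabilities of the actions along a trajectory. -/
def policyProb (π : Policy O A) (τ : Traj O A H) : ℝ :=
  ∏ h : Fin H, (π ((List.ofFn τ).take h) (τ h).1 (τ h).2).toReal

/-- `P^π(τ)`: probability of the trajectory `τ` under the policy `π`. -/
def POMDP.trajProb (M : POMDP S O A H) (π : Policy O A) (τ : Traj O A H) : ℝ :=
  M.histProb τ * policyProb π τ

/-- `V^π`: expected total reward, for the rewards `r h o a`. -/
def POMDP.value (M : POMDP S O A H) (r : Fin H → O → A → ℝ) (π : Policy O A) : ℝ :=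
  ∑ τ : Traj O A H, M.trajProb π τ * ∑ h, r h (τ h).1 (τ h).2

/-- `V^* = sup_π V^π`. -/
def POMDP.optValue (M : POMDP S O A H) (r : Fin H → O → A → ℝ) : ℝ :=
  ⨆ π : Policy O A, M.value r π

end Dynamics

/-! ### Low-rank model classes -/

/-- A low-rank model: feature maps `φ_h(s, a)`, `ψ_h(s')` in `ℝ^d`, emissions and initial
distribution. -/
structure LowRankModel (S O A : Type*) (H d : ℕ) where
  feat : Fin H → S → A → Fin d → ℝ
  cofeat : Fin H → S → Fin d → ℝ
  emit : Fin H → S → O → ℝ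
  init : S → ℝ

/-- The POMDP of a low-rank model: `T_h(s' | s, a) = ψ_h(s')ᵀ φ_h(s, a)`. -/
def LowRankModel.toPOMDP {S O A : Type*} {H d : ℕ} (f : LowRankModel S O A H d) :
    POMDP S O A H where
  trans h s a s' := f.cofeat h s' ⬝ᵥ f.feat h s a
  emit := f.emit
  init := f.init

/-- The features are bounded entrywise by `B`. -/
def LowRankModel.FeaturesBounded {S O A : Type*} {H d : ℕ} (f : LowRankModel S O A H d)
    (B : ℝ) : Prop :=
  (∀ h s a i, |f.feat h s a i| ≤ B) ∧ ∀ h s i, |f.cofeat h s i| ≤ B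

section Classes

variable {S O A : Type*} [Fintype S] [Fintype O] [Fintype A] {H d : ℕ}

/-- The assumptions on the model class: realizability, validity (every model is a
POMDP for which the `m`-step futures are core tests up to step `H - m + 1`) and regularity. -/
structure IsWellSpecified (F : Set (LowRankModel S O A H d)) (fstar : LowRankModel S O A H d)
    (m : ℕ) (α : ℝ) : Prop where
  realizable : fstar ∈ F
  valid : ∀ f ∈ F, f.toPOMDP.IsValid
  core : ∀ f ∈ F, ∀ h, h + m ≤ H → f.toPOMDP.IsCoreTestSet m h
  regular : ∀ f ∈ F, ∀ h, h + m ≤ H → f.toPOMDP.IsRegularAt m h α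

/-- The `ε`-covering number, in the metric of the type `X`, by arbitrary points of `X`. -/
def coverNum {X : Type*} [PseudoEMetricSpace X] (C : Set X) (ε : ℝ) : ℕ :=
  (Metric.externalCoveringNumber ε.toNNReal C).toNat

/-- `ℓ^∞` covering number of the class of maps `Φ_f`. -/
def coverFeat (F : Set (LowRankModel S O A H d)) (ε : ℝ) : ℕ :=
  coverNum ((fun f : LowRankModel S O A H d => f.feat) '' F) ε

/-- `ℓ^∞` covering number of the class of maps `Ψ_f`. -/
def coverCofeat (F : Set (LowRankModel S O A H d)) (ε : ℝ) : ℕ :=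
  coverNum ((fun f : LowRankModel S O A H d => f.cofeat) '' F) ε

/-- `ℓ^∞` covering number of the class of emissions. -/
def coverEmit (F : Set (LowRankModel S O A H d)) (ε : ℝ) : ℕ :=
  coverNum ((fun f : LowRankModel S O A H d => f.emit) '' F) ε

/-- `ℓ^∞` covering number of the class of initial distributions. -/
def coverInit (F : Set (LowRankModel S O A H d)) (ε : ℝ) : ℕ :=
  coverNum ((fun f : LowRankModel S O A H d => f.init) '' F) ε

/-- There is an `ε`-bracket of size `n` for the class `F`. -/
def HasBracket (F : Set (LowRankModel S O A H d)) (ε : ℝ) (n : ℕ) : Prop :=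
  ∃ g₁ g₂ : Fin n → Policy O A → Traj O A H → ℝ,
    (∀ i π, ∑ τ, |g₁ i π τ - g₂ i π τ| ≤ ε) ∧
    ∀ f ∈ F, ∃ i, ∀ π τ,
      g₁ i π τ ≤ f.toPOMDP.trajProb π τ ∧ f.toPOMDP.trajProb π τ ≤ g₂ i π τ

/-- The `ε`-bracket number of `F`. -/
def bracketNum (F : Set (LowRankModel S O A H d)) (ε : ℝ) : ℕ∞ :=
  ⨅ (n : ℕ) (_ : HasBracket F ε n), (n : ℕ∞)

end Classes

/-! ### The algorithm -/

/-- The trajectories collected in one round: one for each `h ∈ {0, …, H - m}` and each action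
sequence of length `m - 1`. -/
abbrev RoundData (O A : Type*) (H m : ℕ) :=
  Fin (H - m + 1) × (Fin (m - 1) → A) → Traj O A H

section Crane

variable {S O A : Type*} [Fintype S] [Fintype O] [Fintype A] [Nonempty A] {H m d : ℕ}

/-- The policy `π_{1:h-1} ∘ Unif(A) ∘ u`: follow `π` in the steps `1, …, h - 1`, act uniformly
at step `h`, execute `u` from step `h + 1` on, then act uniformly. For `h = 0` the execution of
`u` starts at step `1`. -/
def explore (π : Policy O A) (h : ℕ) {n : ℕ} (u : Fin n → A) : Policy O A := fun l o =>
  if l.length + 1 < h then π l o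
  else if hl : h ≤ l.length ∧ l.length - h < n then PMF.pure (u ⟨l.length - h, hl.2⟩)
  else PMF.uniformOfFintype A

/-- A planner returns, from the rounds collected so far, a model and a policy. -/
abbrev Planner (S O A : Type*) (H m d : ℕ) :=
  List (RoundData O A H m) → LowRankModel S O A H d × Policy O A

/-- The policy executed in the round that follows the rounds `D`, for `x = (h, u)`. -/
def roundPolicy (plan : Planner S O A H m d) (D : List (RoundData O A H m))
    (x : Fin (H - m + 1) × (Fin (m - 1) → A)) : Policy O A :=
  explore (plan D).2 x.1 x.2

/-- Log-likelihood of a model on the data set of all pairs (executed policy, trajectory), with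
`log 0 = -∞`. -/
def logLik (plan : Planner S O A H m d) (f : LowRankModel S O A H d)
    (D : List (RoundData O A H m)) : EReal :=
  ∑ i : Fin D.length, ∑ x : Fin (H - m + 1) × (Fin (m - 1) → A),
    ENNReal.log (ENNReal.ofReal
      (f.toPOMDP.trajProb (roundPolicy plan (D.take i) x) (D.get i x)))

/-- The confidence set: models whose log-likelihood is within `β` of the maximum. -/
def confSet (plan : Planner S O A H m d) (F : Set (LowRankModel S O A H d)) (β : ℝ)
    (D : List (RoundData O A H m)) : Set (LowRankModel S O A H d) :=
  {f | f ∈ F ∧ (⨆ f' ∈ F, logLik plan f' D) - (β : EReal) ≤ logLik plan f D}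

/-- The planner is that of `K` rounds of CRANE with confidence parameter `β` up to step `H - m`:
in each round it maximizes the value over the models of the confidence set and all policies. -/
def IsCrane (plan : Planner S O A H m d) (F : Set (LowRankModel S O A H d))
    (r : Fin H → O → A → ℝ) (β : ℝ) (K : ℕ) : Prop :=
  ∀ D : List (RoundData O A H m), D.length < K →
    (plan D).1 ∈ confSet plan F β D ∧
    ∀ f ∈ confSet plan F β D, ∀ π : Policy O A,
      f.toPOMDP.value r π ≤ (plan D).1.toPOMDP.value r (plan D).2

/-- The first `k` of the rounds `ω`. -/
def prefixRounds {K : ℕ} (ω : Fin K → RoundData O A H m) (k : ℕ) : List (RoundData O A H m) :=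
  (List.ofFn ω).take k

/-- Probability that the rounds are `ω` when the planner interacts with the POMDP `M`: each
trajectory is drawn from `M` under the policy chosen from the previous rounds. -/
def runProb (M : POMDP S O A H) (plan : Planner S O A H m d) {K : ℕ}
    (ω : Fin K → RoundData O A H m) : ℝ :=
  ∏ k : Fin K, ∏ x : Fin (H - m + 1) × (Fin (m - 1) → A),
    M.trajProb (roundPolicy plan (prefixRounds ω k) x) (ω k x)

/-- The value in `M` of `Unif({π^1, …, π^K})`, the policy that draws one of the chosen policies
uniformly at random and follows it through the episode. -/
def outputValue (M : POMDP S O A H) (r : Fin H → O → A → ℝ) (plan : Planner S O A H m d) {K : ℕ}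
    (ω : Fin K → RoundData O A H m) : ℝ :=
  (∑ k : Fin K, M.value r (plan (prefixRounds ω k)).2) / K

open scoped Classical in
/-- The probability that the output of `K` rounds is an `ε`-optimal policy of `M`. -/
def successProb (M : POMDP S O A H) (r : Fin H → O → A → ℝ) (plan : Planner S O A H m d)
    (K : ℕ) (ε : ℝ) : ℝ :=
  ∑ ω : Fin K → RoundData O A H m,
    if M.optValue r - ε ≤ outputValue M r plan ω then runProb M plan ω else 0

end Crane

section Parameters

variable {S O A : Type*} [Fintype O] [Fintype A] {H d : ℕ}

/-- `ε_b = 1 / (K H |U_A|)` with `|U_A| = |A|^{m-1}`. -/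
def epsB (A : Type*) [Fintype A] (H m K : ℕ) : ℝ :=
  1 / (K * H * (Fintype.card A : ℝ) ^ (m - 1))

/-- `ε_LR = c₀ ε_b / (|O|^{H+2} |A|^H)`. -/
def epsLR (O A : Type*) [Fintype O] [Fintype A] (c₀ : ℝ) (H m K : ℕ) : ℝ :=
  c₀ * epsB A H m K / ((Fintype.card O : ℝ) ^ (H + 2) * (Fintype.card A : ℝ) ^ H)

/-- The product of the covering numbers at scale `η`; its logarithm is
`log Y_Φ(η/d) + log Y_Ψ(η/d) + log Y_O(η) + log Y_μ(η)`. -/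
def coverProd [Fintype S] (F : Set (LowRankModel S O A H d)) (η : ℝ) : ℕ :=
  coverFeat F (η / d) * coverCofeat F (η / d) * coverEmit F η * coverInit F η

/-- `β = c log(N K H |U_A| / δ)`. -/
def craneBeta (A : Type*) [Fintype A] (c : ℝ) (N H m K : ℕ) (δ : ℝ) : ℝ :=
  c * Real.log (N * K * H * (Fintype.card A : ℝ) ^ (m - 1) / δ)

/-- The quantities in which the number of rounds is polynomial, besides the factor `1 / ε²`. -/
def complexityParams [Fintype S] (F : Set (LowRankModel S O A H d)) (m : ℕ) (α δ ε η : ℝ) :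
    Fin 11 → ℝ :=
  ![(d : ℝ), (Fintype.card A : ℝ) ^ m, 1 / α,
    Real.log (coverFeat F (η / d)), Real.log (coverCofeat F (η / d)),
    Real.log (coverEmit F η), Real.log (coverInit F η),
    (H : ℝ), Real.log (Fintype.card O), Real.log (1 / δ), Real.log (1 + 1 / ε)]

end Parameters

end LowRankPSR

end

/-!
**The rank bound.** After a history of length `h + 1` the predictive states factor through the
features of the last transition, so the system dynamics matrix has rank at most `d`.

**The regret bound** is an argument from optimism in which a POMDP enters only through the weights
`P l` of lists of observation-action pairs (`IsObsProcess`).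

*Maximum likelihood.* Products over the episodes of the weights `g / P` and `√(g / P)`, suitably
normalized, have expectation at most one for every upper bracket `g`, although the policies depend
on the data (`sum_runProb_mul_dataProd_le`). Markov's inequality shows that with probability `1 - δ`
the true model stays in the confidence sets, and every model of a confidence set is close to it in
total variation, in square mean over the executed exploration policies
(`one_sub_le_sum_isTypical`).

*Prediction from core histories.* Regularity yields at most `d` core histories and a pseudo-inverse
of `ℓ¹` norm at most `1 / α` such that the weights of all continuations are linear in the weights of
the `m`-step futures (`POMDP.exists_isPredictor`). These predictions are stable, so a telescoping
sum over hybrids of two models bounds the distance of the laws of the whole trajectory by one-step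
prediction errors along the histories generated by the true model
(`listSum_abs_sub_le_predErr`). The exploration policies control these errors at the price of powers
of `|A|^m` (`listSum_predErr_le_tvSum`).

*From past to current policies.* In the coordinates of the true predictive states with respect to
its own core histories, the prediction errors are linear functionals on vectors in `ℝ^r`, `r ≤ d`,
whose `ℓ¹` norms are bounded by `|A|^m / α`. An `ℓ¹` version of the elliptical potential argument
(`sum_dotProduct_le_log`) transfers smallness from the earlier vectors to the current ones. Its
potential is the sum of the absolute determinants of tuples of vectors, that is, the volume of a
zonotope up to a factor: by Cramer's rule a new vector increases it by at least the factor by which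
it increases any of the seminorms `∑ |⟨w, y⟩|`. In these coordinates the bound `B` on the features
plays no role.

*Brackets.* Raising the kernels of the members of a product cover gives upper brackets
(`hasUpperBracket_coverProd`); `|S| ≤ |O|^m |A|^(m - 1)`, a consequence of weak revealing, makes
their excess independent of the number of states. What is needed is that the excesses of all the
`K (H - m + 1) |A|^(m - 1)` episodes sum up to at most `1`. For brackets of width `ε_b` this is
clear, and for the covers at scale `ε_LR` it uses `|A| ≥ 2`. With a single action there is a single
policy, and for `ε ≥ 2 H` every policy is `ε`-optimal.
-/

set_option linter.unusedSectionVars false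

namespace LowRankPSR

/-! ### A determinantal potential for families of seminorms -/

section Potential

open Matrix

/-- The sum of `|det|` over all `r`-tuples of members of the list `ys` of vectors in `ℝ^r`. Up to
the factor `2 ^ r / r!` this is the volume of the zonotope `∑ [-y, y]`. -/
def absDetSum {r : ℕ} (ys : List (Fin r → ℝ)) : ℝ :=
  ∑ g : Fin r → Fin ys.length, |(Matrix.of fun a => ys.get (g a)).det|

/-- The seminorm `w ↦ ∑ |⟨w, y⟩|`, the support function of the zonotope `∑ [-y, y]`. -/
def absDotSum {r : ℕ} (w : Fin r → ℝ) (ys : List (Fin r → ℝ)) : ℝ :=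
  (ys.map fun y => |w ⬝ᵥ y|).sum

lemma absDotSum_nonneg {r : ℕ} (w : Fin r → ℝ) (ys : List (Fin r → ℝ)) : 0 ≤ absDotSum w ys :=
  List.sum_nonneg fun x hx => by
    obtain ⟨y, -, rfl⟩ := List.mem_map.1 hx
    exact abs_nonneg _

lemma absDotSum_cons {r : ℕ} (w y : Fin r → ℝ) (ys : List (Fin r → ℝ)) :
    absDotSum w (y :: ys) = |w ⬝ᵥ y| + absDotSum w ys := by
  simp [absDotSum]

lemma absDotSum_append {r : ℕ} (w : Fin r → ℝ) (zs ys : List (Fin r → ℝ)) :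
    absDotSum w (zs ++ ys) = absDotSum w zs + absDotSum w ys := by
  simp [absDotSum]

lemma absDotSum_eq_sum {r : ℕ} (w : Fin r → ℝ) (ys : List (Fin r → ℝ)) :
    absDotSum w ys = ∑ i : Fin ys.length, |w ⬝ᵥ ys.get i| := by
  rw [absDotSum, ← List.sum_ofFn]
  congr 1
  apply List.ext_getElem <;> simp

/-- Cramer's rule, paired with a vector `w`. -/
lemma abs_dotProduct_mul_abs_det_le {n : Type*} [Fintype n] [DecidableEq n] (w y : n → ℝ)
    (Y : Matrix n n ℝ) :
    |w ⬝ᵥ y| * |Y.det| ≤ ∑ i, |w ⬝ᵥ Y i| * |(Y.updateRow i y).det| := by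
  have h1 : (w ⬝ᵥ y) * Y.det = ∑ i, (w ⬝ᵥ Y i) * (Y.updateRow i y).det := by
    have h := congrArg (fun v => w ⬝ᵥ v) (mulVec_cramer Yᵀ y)
    simp only [dotProduct_smul, det_transpose, smul_eq_mul, dotProduct_mulVec,
      vecMul_transpose] at h
    rw [mul_comm, ← h]
    simp only [dotProduct, cramer_transpose_apply, mulVec]
    refine Finset.sum_congr rfl fun i _ => ?_
    congr 1
    exact Finset.sum_congr rfl fun _ _ => mul_comm _ _
  rw [← abs_mul, h1]
  refine (Finset.abs_sum_le_sum_abs _ _).trans (le_of_eq ?_)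
  exact Finset.sum_congr rfl fun i _ => abs_mul _ _

/-- The sum of `|det|` over the tuples of members of `y :: ys` in which `y` occurs exactly once. -/
def absDetSumOnce {n : ℕ} (y : Fin (n + 1) → ℝ) (ys : List (Fin (n + 1) → ℝ)) : ℝ :=
  ∑ i : Fin (n + 1), ∑ g : Fin n → Fin ys.length,
    |(Matrix.of (i.insertNth y fun a => ys.get (g a) : Fin (n + 1) → Fin (n + 1) → ℝ)).det|

/-- Cramer's rule summed over all tuples: replacing a member `v` of a tuple by `y` costs `|⟨w, v⟩|`
and produces a tuple that contains `y` once. -/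
lemma abs_dot_mul_absDetSum_le {n : ℕ} (w y : Fin (n + 1) → ℝ) (ys : List (Fin (n + 1) → ℝ)) :
    |w ⬝ᵥ y| * absDetSum ys ≤ absDotSum w ys * absDetSumOnce y ys := by
  have h1 : |w ⬝ᵥ y| * absDetSum ys ≤ ∑ g : Fin (n + 1) → Fin ys.length, ∑ i,
      |w ⬝ᵥ ys.get (g i)| * |((Matrix.of fun a => ys.get (g a)).updateRow i y).det| := by
    rw [absDetSum, Finset.mul_sum]
    exact Finset.sum_le_sum fun g _ => abs_dotProduct_mul_abs_det_le w y _
  refine h1.trans (le_of_eq ?_)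
  rw [Finset.sum_comm, absDetSumOnce, Finset.mul_sum]
  refine Finset.sum_congr rfl fun i _ => ?_
  rw [← (Fin.insertNthEquiv (fun _ => Fin ys.length) i).sum_comp, Fintype.sum_prod_type,
    absDotSum_eq_sum, Finset.sum_mul]
  refine Finset.sum_congr rfl fun a _ => ?_
  rw [Finset.mul_sum]
  refine Finset.sum_congr rfl fun g _ => ?_
  simp only [Fin.insertNthEquiv_apply, Fin.insertNth_apply_same]
  congr 3
  ext b c
  simp only [updateRow_apply, Matrix.of_apply]
  refine Fin.succAboveCases i ?_ (fun b => ?_) b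
  · simp
  · simp [Fin.succAbove_ne]

/-- The tuples of members of `y :: ys` in which `y` occurs at most once are part of all tuples. In
fact equality holds, because a repeated row makes the determinant vanish. -/
lemma absDetSum_add_once_le {n : ℕ} (y : Fin (n + 1) → ℝ) (ys : List (Fin (n + 1) → ℝ)) :
    absDetSum ys + absDetSumOnce y ys ≤ absDetSum (y :: ys) := by
  let F : (Fin (n + 1) → Fin (y :: ys).length) → ℝ :=
    fun g => |(Matrix.of fun a => (y :: ys).get (g a)).det|
  let e : (Fin (n + 1) → Fin ys.length) ⊕ (Fin (n + 1) × (Fin n → Fin ys.length)) →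
      (Fin (n + 1) → Fin (y :: ys).length) :=
    Sum.elim (fun g a => (g a).succ)
      (fun p => p.1.insertNth (0 : Fin (ys.length + 1)) fun a => (p.2 a).succ)
  have he : Function.Injective e := by
    refine Function.Injective.sumElim ?_ ?_ ?_
    · intro g g' h
      funext a
      exact Fin.succ_injective _ (congrFun h a)
    · rintro ⟨i, g⟩ ⟨i', g'⟩ h
      have hi : i = i' := by
        by_contra hne
        obtain ⟨b, hb⟩ := Fin.exists_succAbove_eq hne
        have := congrFun h i
        simp only [Fin.insertNth_apply_same] at this
        rw [← hb, Fin.insertNth_apply_succAbove] at this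
        exact (Fin.succ_ne_zero _ this.symm).elim
      subst hi
      have : g = g' := by
        funext a
        have := congrFun h (i.succAbove a)
        simp only [Fin.insertNth_apply_succAbove] at this
        exact Fin.succ_injective _ this
      rw [this]
    · rintro g ⟨i, g'⟩ h
      have := congrFun h i
      simp only [Fin.insertNth_apply_same] at this
      exact Fin.succ_ne_zero _ this
  have h1 : ∑ p, F (e p) ≤ ∑ g, F g := by
    rw [← Finset.sum_image (f := F) (s := Finset.univ) (g := e) fun a _ b _ h => he h]
    exact Finset.sum_le_sum_of_subset_of_nonneg (Finset.subset_univ _)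
      fun _ _ _ => abs_nonneg _
  refine le_trans (le_of_eq ?_) h1
  rw [Fintype.sum_sum_type, Fintype.sum_prod_type]
  congr 1
  refine Finset.sum_congr rfl fun i _ => Finset.sum_congr rfl fun g _ => ?_
  simp only [F, e, Sum.elim_inr]
  congr 3
  funext b
  refine Fin.succAboveCases i ?_ (fun b => ?_) b
  · simp
  · simp

/-- Adding a generator multiplies the potential by at least the factor by which it multiplies the
seminorm of any vector. -/
lemma absDetSum_cons_mul_le {n : ℕ} (w y : Fin (n + 1) → ℝ) (ys : List (Fin (n + 1) → ℝ)) :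
    absDetSum ys * absDotSum w (y :: ys) ≤ absDetSum (y :: ys) * absDotSum w ys := by
  have h1 := abs_dot_mul_absDetSum_le w y ys
  have h2 := mul_le_mul_of_nonneg_right (absDetSum_add_once_le y ys) (absDotSum_nonneg w ys)
  rw [absDotSum_cons]
  nlinarith

lemma absDetSum_append_mul_le {n : ℕ} (w : Fin (n + 1) → ℝ) (zs ys : List (Fin (n + 1) → ℝ))
    (h0 : 0 < absDotSum w ys) :
    absDetSum ys * absDotSum w (zs ++ ys) ≤ absDetSum (zs ++ ys) * absDotSum w ys := by
  induction zs with
  | nil => exact le_rfl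
  | cons z zs ih =>
    have h1 := absDetSum_cons_mul_le w z (zs ++ ys)
    rw [List.cons_append]
    have hpos : 0 < absDotSum w (zs ++ ys) := by
      rw [absDotSum_append]
      linarith [absDotSum_nonneg w zs]
    have h2 := mul_le_mul_of_nonneg_right ih (absDotSum_nonneg w (z :: (zs ++ ys)))
    have h3 := mul_le_mul_of_nonneg_right h1 h0.le
    refine le_of_mul_le_mul_right ?_ hpos
    nlinarith

lemma absDetSum_le_append {r : ℕ} (zs ys : List (Fin r → ℝ)) :
    absDetSum ys ≤ absDetSum (zs ++ ys) := by
  induction zs with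
  | nil => exact le_rfl
  | cons z zs ih =>
    refine ih.trans ?_
    rw [List.cons_append]
    cases r with
    | zero => simp [absDetSum]
    | succ n =>
      have := absDetSum_add_once_le z (zs ++ ys)
      have h0 : 0 ≤ absDetSumOnce z (zs ++ ys) :=
        Finset.sum_nonneg fun _ _ => Finset.sum_nonneg fun _ _ => abs_nonneg _
      linarith

/-- The sum of the `ℓ¹` norms of the members of a list. -/
def oneNormSum {r : ℕ} (ys : List (Fin r → ℝ)) : ℝ := (ys.map fun y => ∑ i, |y i|).sum

lemma abs_det_le_prod_sum {r : ℕ} (Y : Matrix (Fin r) (Fin r) ℝ) :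
    |Y.det| ≤ ∏ a, ∑ i, |Y a i| := by
  have h1 : |Y.det| ≤ ∑ σ : Equiv.Perm (Fin r), ∏ a, |Y a (σ a)| := by
    rw [← det_transpose, det_apply]
    refine (Finset.abs_sum_le_sum_abs _ _).trans (Finset.sum_le_sum fun σ _ => ?_)
    rw [Units.smul_def, zsmul_eq_mul, abs_mul, Finset.abs_prod]
    have : |((Equiv.Perm.sign σ : ℤ) : ℝ)| = 1 := by
      rcases Int.units_eq_one_or (Equiv.Perm.sign σ) with h | h <;> simp [h]
    rw [this, one_mul]
    rfl
  refine h1.trans ?_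
  rw [Finset.prod_univ_sum, Fintype.piFinset_univ]
  have h2 : Function.Injective fun σ : Equiv.Perm (Fin r) => (σ : Fin r → Fin r) :=
    fun σ τ h => Equiv.ext (congrFun h)
  rw [← Finset.sum_image (f := fun p : Fin r → Fin r => ∏ a, |Y a (p a)|)
    (s := Finset.univ) (g := fun σ : Equiv.Perm (Fin r) => (σ : Fin r → Fin r))
    fun a _ b _ h => h2 h]
  exact Finset.sum_le_sum_of_subset_of_nonneg (Finset.subset_univ _)
    fun _ _ _ => Finset.prod_nonneg fun _ _ => abs_nonneg _

lemma absDetSum_le_pow {r : ℕ} (ys : List (Fin r → ℝ)) :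
    absDetSum ys ≤ oneNormSum ys ^ r := by
  have h1 : oneNormSum ys = ∑ i : Fin ys.length, ∑ c, |ys.get i c| := by
    rw [oneNormSum, ← List.sum_ofFn]
    congr 1
    apply List.ext_getElem <;> simp
  have h2 : oneNormSum ys ^ r = ∏ _a : Fin r, ∑ i : Fin ys.length, ∑ c, |ys.get i c| := by
    rw [h1]; simp
  rw [h2, Finset.prod_univ_sum, Fintype.piFinset_univ]
  exact Finset.sum_le_sum fun g _ => abs_det_le_prod_sum _

/-- The standard basis of `ℝ^r`, as a list. -/
def basisList (r : ℕ) : List (Fin r → ℝ) := List.ofFn fun i => Pi.single i 1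

lemma one_le_absDetSum_basisList (r : ℕ) : 1 ≤ absDetSum (basisList r) := by
  have hl : (basisList r).length = r := by simp [basisList]
  refine le_trans ?_ (Finset.single_le_sum
    (f := fun g : Fin r → Fin (basisList r).length =>
      |(Matrix.of fun a => (basisList r).get (g a)).det|)
    (fun _ _ => abs_nonneg _) (Finset.mem_univ (Fin.cast hl.symm)))
  have : (Matrix.of fun a => (basisList r).get (Fin.cast hl.symm a)) =
      (1 : Matrix (Fin r) (Fin r) ℝ) := by
    ext a b
    simp only [basisList, Matrix.of_apply, List.get_ofFn, Pi.single_apply, Matrix.one_apply,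
      Fin.ext_iff]
    exact if_congr ⟨fun h => h.symm, fun h => h.symm⟩ rfl rfl
  simp only [this]
  simp

lemma absDotSum_basisList {r : ℕ} (w : Fin r → ℝ) : absDotSum w (basisList r) = ∑ i, |w i| := by
  simp [absDotSum, basisList, List.map_ofFn, List.sum_ofFn, Function.comp_def]

lemma oneNormSum_basisList (r : ℕ) : oneNormSum (basisList r) = r := by
  simp only [oneNormSum, basisList, List.map_ofFn, List.sum_ofFn, Function.comp_def]
  simp [Pi.single_apply, apply_ite abs]

variable {T : Type*} [Fintype T]

/-- The standard basis together with the vectors `x j t` for `j < k`. -/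
noncomputable def generators {r : ℕ} (x : ℕ → T → Fin r → ℝ) : ℕ → List (Fin r → ℝ)
  | 0 => basisList r
  | k + 1 => (Finset.univ.toList.map (x k)) ++ generators x k

lemma absDotSum_generators {r : ℕ} (x : ℕ → T → Fin r → ℝ) (w : Fin r → ℝ) (k : ℕ) :
    absDotSum w (generators x k) =
      ∑ i, |w i| + ∑ j ∈ Finset.range k, ∑ t, |w ⬝ᵥ x j t| := by
  induction k with
  | zero => simp [generators, absDotSum_basisList]
  | succ k ih =>
    rw [generators, absDotSum_append, ih, Finset.sum_range_succ]
    have : absDotSum w (Finset.univ.toList.map (x k)) = ∑ t, |w ⬝ᵥ x k t| := by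
      rw [absDotSum, List.map_map, ← Finset.sum_map_toList]
      rfl
    rw [this]; ring

lemma oneNormSum_generators_le {r : ℕ} (x : ℕ → T → Fin r → ℝ) {R : ℝ} (K : ℕ)
    (hx : ∀ k < K, ∑ t, ∑ i, |x k t i| ≤ R) (k : ℕ) (hk : k ≤ K) :
    oneNormSum (generators x k) ≤ r + k * R := by
  induction k with
  | zero => simp [generators, oneNormSum_basisList]
  | succ k ih =>
    have h1 : oneNormSum (generators x (k + 1)) =
        ∑ t, ∑ i, |x k t i| + oneNormSum (generators x k) := by
      rw [generators, oneNormSum, List.map_append, List.sum_append, List.map_map,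
        ← Finset.sum_map_toList]
      rfl
    have h2 := ih (by omega)
    have h3 := hx k (by omega)
    rw [h1]; push_cast; linarith

lemma oneNormSum_nonneg {r : ℕ} (ys : List (Fin r → ℝ)) : 0 ≤ oneNormSum ys :=
  List.sum_nonneg fun x hx => by
    obtain ⟨y, -, rfl⟩ := List.mem_map.1 hx
    exact Finset.sum_nonneg fun _ _ => abs_nonneg _

/-- The `ℓ¹` elliptical potential argument: if the functionals `w k l` are small on average on
the earlier vectors `x j t`, `j < k`, then their values on the vectors `x k t` sum up to a
quantity that is logarithmic in the number of rounds. -/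
theorem sum_dotProduct_le_log {Λ : Type*} [Fintype Λ] {r K : ℕ} (hK : 0 < K)
    (x : ℕ → T → Fin r → ℝ)
    (w : ℕ → Λ → Fin r → ℝ) {G R : ℝ}
    (hG : ∀ k < K, ∑ l, ∑ i, |w k l i| + ∑ j ∈ Finset.range k, ∑ l, ∑ t, |w k l ⬝ᵥ x j t| ≤ G)
    (hG' : ∀ k < K, ∑ l, ∑ t, |w k l ⬝ᵥ x k t| ≤ G)
    (hR : ∀ k < K, ∑ t, ∑ i, |x k t i| ≤ R) :
    ∑ k ∈ Finset.range K, ∑ l, ∑ t, |w k l ⬝ᵥ x k t| ≤ 2 * G * (r * Real.log (r + K * R)) := by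
  have hG0 : 0 ≤ G := le_trans (Finset.sum_nonneg fun _ _ => Finset.sum_nonneg
    fun _ _ => abs_nonneg _) (hG' 0 hK)
  -- The potential starts at `1` or more, never decreases, and each round pays for its sum with the
  -- logarithm of the factor by which the potential grows.
  let V : ℕ → ℝ := fun k => absDetSum (generators x k)
  have hV0 : 1 ≤ V 0 := one_le_absDetSum_basisList r
  have hVmono : ∀ k, V k ≤ V (k + 1) := fun k => absDetSum_le_append _ _
  have hV1 : ∀ k, 1 ≤ V k := by
    intro k
    induction k with
    | zero => exact hV0
    | succ k ih => exact ih.trans (hVmono k)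
  -- The potential grows by at least the same factor as every seminorm, hence as their sum over `l`.
  have key : ∀ k < K, ∑ l, ∑ t, |w k l ⬝ᵥ x k t| ≤
      2 * G * (Real.log (V (k + 1)) - Real.log (V k)) := by
    intro k hk
    have hVk : 0 < V k := lt_of_lt_of_le one_pos (hV1 k)
    have h1 : ∀ l, V k * ∑ t, |w k l ⬝ᵥ x k t| ≤
        (V (k + 1) - V k) * (∑ i, |w k l i| + ∑ j ∈ Finset.range k, ∑ t, |w k l ⬝ᵥ x j t|) := by
      intro l
      rcases (absDotSum_nonneg (w k l) (basisList r)).eq_or_lt with h0 | h0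
      · have hw : w k l = 0 := by
          rw [absDotSum_basisList] at h0
          funext i
          exact abs_eq_zero.1 ((Finset.sum_eq_zero_iff_of_nonneg fun _ _ => abs_nonneg _).1
            h0.symm i (Finset.mem_univ i))
        simp [hw]
      · have h0' : 0 < absDotSum (w k l) (generators x k) := by
          rw [absDotSum_generators]
          rw [absDotSum_basisList] at h0
          have : 0 ≤ ∑ j ∈ Finset.range k, ∑ t, |w k l ⬝ᵥ x j t| :=
            Finset.sum_nonneg fun _ _ => Finset.sum_nonneg fun _ _ => abs_nonneg _
          linarith
        have h2 : V k * absDotSum (w k l) (generators x (k + 1)) ≤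
            V (k + 1) * absDotSum (w k l) (generators x k) := by
          cases r with
          | zero => simp [absDotSum_basisList] at h0
          | succ n => exact absDetSum_append_mul_le _ _ _ h0'
        rw [absDotSum_generators, absDotSum_generators, Finset.sum_range_succ] at h2
        linarith
    have h2 : V k * ∑ l, ∑ t, |w k l ⬝ᵥ x k t| ≤ (V (k + 1) - V k) * G := by
      rw [Finset.mul_sum]
      refine (Finset.sum_le_sum fun l _ => h1 l).trans ?_
      rw [← Finset.mul_sum, Finset.sum_add_distrib]
      refine mul_le_mul_of_nonneg_left ?_ (sub_nonneg.2 (hVmono k))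
      have := hG k hk
      rwa [Finset.sum_comm (s := Finset.range k)] at this
    have hV' : 0 < V (k + 1) := lt_of_lt_of_le one_pos (hV1 _)
    rw [← Real.log_div hV'.ne' hVk.ne']
    -- either the ratio is at most `2`, and `u ≤ 2 log (1 + u)`, or the trivial bound suffices
    set s := ∑ l, ∑ t, |w k l ⬝ᵥ x k t| with hs
    have hs' : s ≤ G := hG' k hk
    have hratio : s ≤ (V (k + 1) / V k - 1) * G := by
      rw [div_sub_one hVk.ne', div_mul_eq_mul_div, le_div_iff₀ hVk]
      linarith
    have hone : 1 ≤ V (k + 1) / V k := (one_le_div hVk).2 (hVmono k)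
    set q := V (k + 1) / V k with hq
    have hlog : 1 - q⁻¹ ≤ Real.log q := Real.one_sub_inv_le_log_of_pos (by linarith)
    have hsq : s ≤ 2 * G * (1 - q⁻¹) := by
      have hqi : 0 < q⁻¹ := by positivity
      have hqq : q * q⁻¹ = 1 := mul_inv_cancel₀ (by linarith)
      rcases le_total q 2 with h | h
      · have : q - 1 ≤ 2 * (1 - q⁻¹) := by nlinarith
        nlinarith
      · have : (1 : ℝ) ≤ 2 * (1 - q⁻¹) := by nlinarith
        nlinarith
    nlinarith
  have hsum : ∑ k ∈ Finset.range K, ∑ l, ∑ t, |w k l ⬝ᵥ x k t| ≤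
      2 * G * (Real.log (V K) - Real.log (V 0)) := by
    refine (Finset.sum_le_sum fun k hk => key k (Finset.mem_range.1 hk)).trans ?_
    rw [← Finset.mul_sum, Finset.sum_range_sub (fun k => Real.log (V k))]
  refine hsum.trans (mul_le_mul_of_nonneg_left ?_ (by positivity))
  have hle : Real.log (V K) ≤ r * Real.log (r + K * R) := by
    rw [← Real.log_pow]
    refine Real.log_le_log (lt_of_lt_of_le one_pos (hV1 _)) ((absDetSum_le_pow _).trans ?_)
    exact pow_le_pow_left₀ (oneNormSum_nonneg _) (oneNormSum_generators_le x K hR K le_rfl) _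
  linarith [Real.log_nonneg hV0]

end Potential

/-! ### Sums over lists of a given length -/

section ListSum

variable {X : Type*} [Fintype X]

/-- The sum of `F` over all lists of length `n`. -/
def listSum : ℕ → (List X → ℝ) → ℝ
  | 0, F => F []
  | n + 1, F => ∑ x, listSum n fun l => F (x :: l)

lemma sum_ofFn_eq_listSum (n : ℕ) (F : List X → ℝ) :
    ∑ τ : Fin n → X, F (List.ofFn τ) = listSum n F := by
  induction n generalizing F with
  | zero => simp [listSum]
  | succ n ih =>
    rw [listSum, ← (Fin.consEquiv fun _ => X).sum_comp, Fintype.sum_prod_type]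
    refine Finset.sum_congr rfl fun x _ => ?_
    rw [← ih]
    refine Finset.sum_congr rfl fun τ _ => ?_
    simp [Fin.consEquiv, List.ofFn_succ]

lemma listSum_congr {n : ℕ} {F G : List X → ℝ} (h : ∀ l, l.length = n → F l = G l) :
    listSum n F = listSum n G := by
  rw [← sum_ofFn_eq_listSum, ← sum_ofFn_eq_listSum]
  exact Finset.sum_congr rfl fun τ _ => h _ (List.length_ofFn)

lemma listSum_mono {n : ℕ} {F G : List X → ℝ} (h : ∀ l, l.length = n → F l ≤ G l) :
    listSum n F ≤ listSum n G := by
  rw [← sum_ofFn_eq_listSum, ← sum_ofFn_eq_listSum]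
  exact Finset.sum_le_sum fun τ _ => h _ (List.length_ofFn)

lemma listSum_nonneg {n : ℕ} {F : List X → ℝ} (h : ∀ l, l.length = n → 0 ≤ F l) :
    0 ≤ listSum n F := by
  rw [← sum_ofFn_eq_listSum]
  exact Finset.sum_nonneg fun τ _ => h _ (List.length_ofFn)

lemma abs_listSum_le (n : ℕ) (F : List X → ℝ) : |listSum n F| ≤ listSum n fun l => |F l| := by
  rw [← sum_ofFn_eq_listSum, ← sum_ofFn_eq_listSum]
  exact Finset.abs_sum_le_sum_abs _ _

lemma listSum_mul_left (n : ℕ) (c : ℝ) (F : List X → ℝ) :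
    (listSum n fun l => c * F l) = c * listSum n F := by
  rw [← sum_ofFn_eq_listSum, ← sum_ofFn_eq_listSum, Finset.mul_sum]

lemma listSum_add (n : ℕ) (F G : List X → ℝ) :
    (listSum n fun l => F l + G l) = listSum n F + listSum n G := by
  simp only [← sum_ofFn_eq_listSum, Finset.sum_add_distrib]

lemma listSum_sum {ι : Type*} (s : Finset ι) (n : ℕ) (F : ι → List X → ℝ) :
    (listSum n fun l => ∑ i ∈ s, F i l) = ∑ i ∈ s, listSum n (F i) := by
  simp only [← sum_ofFn_eq_listSum]
  exact Finset.sum_comm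

lemma listSum_append (n k : ℕ) (F : List X → ℝ) :
    listSum (n + k) F = listSum n fun l => listSum k fun l' => F (l ++ l') := by
  induction n generalizing F with
  | zero => simp [listSum]
  | succ n ih =>
    rw [show n + 1 + k = n + k + 1 by omega]
    simp only [listSum, ih, List.cons_append]

lemma listSum_succ_last (n : ℕ) (F : List X → ℝ) :
    listSum (n + 1) F = listSum n fun l => ∑ x, F (l ++ [x]) := by
  rw [listSum_append]
  rfl

end ListSum

/-! ### Observation processes -/

section ObsProcess

variable {S O A : Type*} [Fintype S] [Fintype O] [Fintype A] {H : ℕ}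

/-- The probability weight of the actions of `l`, chosen by `π` after the past `pre`. -/
def actWeight (π : Policy O A) : List (O × A) → List (O × A) → ℝ
  | _, [] => 1
  | pre, x :: l => (π pre x.1 x.2).toReal * actWeight π (pre ++ [x]) l

lemma actWeight_nonneg (π : Policy O A) (pre l : List (O × A)) : 0 ≤ actWeight π pre l := by
  induction l generalizing pre with
  | nil => exact zero_le_one
  | cons x l ih => exact mul_nonneg ENNReal.toReal_nonneg (ih _)

lemma actWeight_append (π : Policy O A) (pre l l' : List (O × A)) :
    actWeight π pre (l ++ l') = actWeight π pre l * actWeight π (pre ++ l) l' := by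
  induction l generalizing pre with
  | nil => simp [actWeight]
  | cons x l ih => simp [actWeight, ih, mul_assoc]

lemma actWeight_ofFn (π : Policy O A) {n : ℕ} (pre : List (O × A)) (τ : Fin n → O × A) :
    actWeight π pre (List.ofFn τ) =
      ∏ h : Fin n, (π (pre ++ (List.ofFn τ).take h) (τ h).1 (τ h).2).toReal := by
  induction n generalizing pre with
  | zero => simp [actWeight]
  | succ n ih =>
    rw [List.ofFn_succ, actWeight, ih, Fin.prod_univ_succ]
    simp

lemma policyProb_eq (π : Policy O A) (τ : Traj O A H) :
    policyProb π τ = actWeight π [] (List.ofFn τ) := by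
  simp [policyProb, actWeight_ofFn]

lemma sum_toReal_pmf (p : PMF A) : ∑ a, (p a).toReal = 1 := by
  rw [← ENNReal.toReal_sum fun a _ => p.apply_ne_top a,
    ← tsum_fintype (L := .unconditional _), p.tsum_coe, ENNReal.toReal_one]

/-- A family of weights on lists of observation-action pairs of length at most `H` that
satisfies the linear relations of the probabilities of the observations when the actions are
executed: the weight does not depend on the last action, and summing over the last observation
gives the weight of the shorter list. -/
structure IsConsistent (H : ℕ) (P : List (O × A) → ℝ) : Prop where
  sum_obs : ∀ l, l.length < H → ∀ a, ∑ o, P (l ++ [(o, a)]) = P l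
  last_action : ∀ l, l.length < H → ∀ o a a', P (l ++ [(o, a)]) = P (l ++ [(o, a')])

/-- Consistent weights that are probabilities. -/
structure IsObsProcess (H : ℕ) (P : List (O × A) → ℝ) : Prop extends IsConsistent H P where
  nonneg : ∀ l, 0 ≤ P l
  nil : P [] = 1

lemma IsConsistent.sub {P Q : List (O × A) → ℝ} (hP : IsConsistent H P) (hQ : IsConsistent H Q) :
    IsConsistent H fun l => P l - Q l where
  sum_obs l hl a := by rw [Finset.sum_sub_distrib, hP.sum_obs l hl, hQ.sum_obs l hl]
  last_action l hl o a a' := by rw [hP.last_action l hl o a a', hQ.last_action l hl o a a']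

variable [Nonempty A]

lemma IsConsistent.sum_policy_step {P : List (O × A) → ℝ} (hP : IsConsistent H P)
    (c : List (O × A)) (hc : c.length < H) (q : O → PMF A) :
    ∑ x : O × A, (q x.1 x.2).toReal * P (c ++ [x]) = P c := by
  obtain ⟨a₀⟩ := ‹Nonempty A›
  rw [Fintype.sum_prod_type, ← hP.sum_obs c hc a₀]
  refine Finset.sum_congr rfl fun o _ => ?_
  simp only [fun a => hP.last_action c hc o a a₀]
  rw [← Finset.sum_mul, sum_toReal_pmf, one_mul]

/-- Integrating out the last `k` steps, when the actions are drawn from any policy. -/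
lemma IsConsistent.listSum_actWeight {P : List (O × A) → ℝ} (hP : IsConsistent H P)
    (π : Policy O A) (n : ℕ) (pre c : List (O × A)) (hc : c.length + n ≤ H) :
    (listSum n fun l => actWeight π pre l * P (c ++ l)) = P c := by
  induction n generalizing pre c with
  | zero => simp [listSum, actWeight]
  | succ n ih =>
    rw [listSum, ← hP.sum_policy_step c (by omega) (π pre)]
    refine Finset.sum_congr rfl fun x _ => ?_
    have h := ih (pre ++ [x]) (c ++ [x]) (by simp; omega)
    rw [← h, ← listSum_mul_left]
    refine listSum_congr fun l _ => ?_
    simp [actWeight, mul_assoc]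

lemma IsConsistent.listSum_eq {P : List (O × A) → ℝ} (hP : IsConsistent H P)
    (n : ℕ) (c : List (O × A)) (hc : c.length + n ≤ H) :
    (listSum n fun l => P (c ++ l)) = (Fintype.card A : ℝ) ^ n * P c := by
  induction n generalizing c with
  | zero => simp [listSum]
  | succ n ih =>
    have h1 : ∀ x : O × A, (listSum n fun l => P (c ++ x :: l)) =
        (Fintype.card A : ℝ) ^ n * P (c ++ [x]) := by
      intro x
      rw [← ih (c ++ [x]) (by simp; omega)]
      exact listSum_congr fun l _ => by simp
    rw [listSum]
    simp only [h1]
    rw [← Finset.mul_sum, Fintype.sum_prod_type, Finset.sum_comm]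
    simp only [hP.sum_obs c (by omega)]
    simp [pow_succ]
    ring

/-- The total variation distance of the laws of the first `n` steps is at most that of the laws
of the first `n + k` steps. -/
lemma IsConsistent.listSum_abs_prefix_le {D : List (O × A) → ℝ} (hD : IsConsistent H D)
    (π : Policy O A) (n k : ℕ) (hn : n + k ≤ H) :
    (listSum n fun l => actWeight π [] l * |D l|) ≤
      listSum (n + k) fun l => actWeight π [] l * |D l| := by
  rw [listSum_append]
  refine listSum_mono fun l hl => ?_
  have h1 := hD.listSum_actWeight π k l l (by omega)
  calc actWeight π [] l * |D l|
      = actWeight π [] l * |listSum k fun l' => actWeight π l l' * D (l ++ l')| := by rw [h1]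
    _ ≤ actWeight π [] l * listSum k fun l' => actWeight π l l' * |D (l ++ l')| := by
        refine mul_le_mul_of_nonneg_left ((abs_listSum_le _ _).trans (le_of_eq ?_))
          (actWeight_nonneg _ _ _)
        exact listSum_congr fun l' _ => by rw [abs_mul, abs_of_nonneg (actWeight_nonneg _ _ _)]
    _ = _ := by
        rw [← listSum_mul_left]
        refine listSum_congr fun l' _ => ?_
        rw [actWeight_append, List.nil_append, mul_assoc]

/-! ### Tests as lists -/

/-- A test as a list of observation-action pairs, completed by an arbitrary last action. -/
noncomputable def testList {w : ℕ} (t : Test O A w) : List (O × A) :=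
  List.ofFn t.1 ++ [(t.2, Classical.arbitrary A)]

@[simp] lemma length_testList {w : ℕ} (t : Test O A w) : (testList t).length = w + 1 := by
  simp [testList]

lemma sum_testList (w : ℕ) (F : List (O × A) → ℝ) :
    ∑ t : Test O A w, F (testList t) =
      listSum w fun l => ∑ o, F (l ++ [(o, Classical.arbitrary A)]) := by
  rw [Fintype.sum_prod_type, ← sum_ofFn_eq_listSum]
  rfl

lemma sum_testList_succ (w : ℕ) (F : List (O × A) → ℝ) :
    ∑ t : Test O A (w + 1), F (testList t) =
      ∑ x, ∑ t : Test O A w, F (x :: testList t) := by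
  rw [sum_testList, listSum]
  refine Finset.sum_congr rfl fun x _ => ?_
  rw [sum_testList w fun l => F (x :: l)]
  rfl

lemma IsConsistent.sum_testList {P : List (O × A) → ℝ} (hP : IsConsistent H P) (w : ℕ)
    (c : List (O × A)) (hc : c.length + w < H) :
    ∑ t : Test O A w, P (c ++ testList t) = (Fintype.card A : ℝ) ^ w * P c := by
  rw [LowRankPSR.sum_testList w fun l => P (c ++ l), ← hP.listSum_eq w c (by omega)]
  refine listSum_congr fun l hl => ?_
  simp only [← List.append_assoc]
  exact hP.sum_obs _ (by simp; omega) _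

/-- A weight that does not depend on the last action can be evaluated on tests. -/
lemma exists_testList_eq {w : ℕ} (l : List (O × A)) (hl : l.length = w + 1) :
    ∃ t : Test O A w, ∀ {H : ℕ} {P : List (O × A) → ℝ}, IsConsistent H P → ∀ c : List (O × A),
      c.length + w < H → P (c ++ l) = P (c ++ testList t) := by
  have hne : l ≠ [] := by rintro rfl; simp at hl
  have hlen : l.dropLast.length = w := by simp [hl]
  refine ⟨(fun i => l.dropLast.get (i.cast hlen.symm), (l.getLast hne).1), fun hP c hc => ?_⟩
  have h1 : List.ofFn (fun i : Fin w => l.dropLast.get (i.cast hlen.symm)) = l.dropLast := by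
    subst hlen
    exact List.ofFn_get _
  rw [testList, h1]
  conv_lhs => rw [← List.dropLast_append_getLast hne]
  rw [← List.append_assoc, ← List.append_assoc]
  exact hP.last_action _ (by simp [hl]; omega) _ _ _

end ObsProcess

/-! ### The observation process of a POMDP -/

section POMDP

variable {S O A : Type*} [Fintype S] [Fintype O] [Fintype A] {H : ℕ}

/-- The probability of the observations of `l` when its actions are executed. -/
def POMDP.listProb (M : POMDP S O A H) (l : List (O × A)) : ℝ := ∑ s, M.filter 0 M.init l s

lemma POMDP.histProb_eq (M : POMDP S O A H) {n : ℕ} (τ : Fin n → O × A) :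
    M.histProb τ = M.listProb (List.ofFn τ) := rfl

lemma POMDP.trajProb_eq (M : POMDP S O A H) (π : Policy O A) (τ : Traj O A H) :
    M.trajProb π τ = M.listProb (List.ofFn τ) * actWeight π [] (List.ofFn τ) := by
  rw [trajProb, policyProb_eq, histProb_eq]

lemma POMDP.filter_append (M : POMDP S O A H) (h : ℕ) (b : S → ℝ) (l l' : List (O × A)) :
    M.filter h b (l ++ l') = M.filter (h + l.length) (M.filter h b l) l' := by
  induction l generalizing h b with
  | nil => rfl
  | cons x l ih =>
    simp only [List.cons_append, POMDP.filter, ih, List.length_cons]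
    congr 1
    omega

lemma POMDP.listProb_concat {M : POMDP S O A H} (hM : M.IsValid) (l : List (O × A))
    (hl : l.length < H) (o : O) (a : A) :
    M.listProb (l ++ [(o, a)]) = ∑ s, M.filter 0 M.init l s * M.emitAt l.length s o := by
  rw [listProb, filter_append]
  simp only [POMDP.filter, step, zero_add]
  rw [Finset.sum_comm]
  refine Finset.sum_congr rfl fun s _ => ?_
  have : ∑ s', M.transAt l.length s a s' = 1 := by
    simp only [transAt, hl, dif_pos]
    exact hM.trans_sum _ _ _
  rw [← Finset.mul_sum, this, mul_one]

lemma POMDP.IsValid.emitAt_nonneg {M : POMDP S O A H} (hM : M.IsValid) (h : ℕ) (s : S) (o : O) :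
    0 ≤ M.emitAt h s o := by
  unfold emitAt
  split_ifs
  exacts [hM.emit_nonneg _ _ _, le_rfl]

lemma POMDP.IsValid.transAt_nonneg {M : POMDP S O A H} (hM : M.IsValid) (h : ℕ) (s : S) (a : A)
    (s' : S) : 0 ≤ M.transAt h s a s' := by
  unfold transAt
  split_ifs
  exacts [hM.trans_nonneg _ _ _ _, le_rfl]

lemma POMDP.IsValid.filter_nonneg {M : POMDP S O A H} (hM : M.IsValid) (h : ℕ) (b : S → ℝ)
    (hb : ∀ s, 0 ≤ b s) (l : List (O × A)) (s : S) : 0 ≤ M.filter h b l s := by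
  induction l generalizing h b with
  | nil => exact hb s
  | cons x l ih =>
    exact ih _ _ fun s' => Finset.sum_nonneg fun s _ =>
      mul_nonneg (mul_nonneg (hb s) (hM.emitAt_nonneg _ _ _)) (hM.transAt_nonneg _ _ _ _)

lemma POMDP.IsValid.isObsProcess {M : POMDP S O A H} (hM : M.IsValid) :
    IsObsProcess H M.listProb where
  nonneg l := Finset.sum_nonneg fun s _ => hM.filter_nonneg 0 _ hM.init_nonneg l s
  nil := hM.init_sum
  last_action l hl o a a' := by rw [listProb_concat hM l hl, listProb_concat hM l hl]
  sum_obs l hl a := by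
    simp only [listProb_concat hM l hl]
    rw [Finset.sum_comm]
    refine Finset.sum_congr rfl fun s _ => ?_
    have : ∑ o, M.emitAt l.length s o = 1 := by
      simp only [emitAt, hl, dif_pos]
      exact hM.emit_sum _ _
    rw [← Finset.mul_sum, this, mul_one]

variable [Nonempty A]

lemma POMDP.testProb_eq {M : POMDP S O A H} (hM : M.IsValid) {n w : ℕ} (t : Test O A w)
    (τ : Fin n → O × A) (h : n + w < H) :
    M.testProb t τ = M.listProb (List.ofFn τ ++ testList t) / M.listProb (List.ofFn τ) := by
  rw [testProb, histProb_eq, testList, ← List.append_assoc,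
    listProb_concat hM _ (by simp; omega)]
  congr 1
  simp [testWeight, filter_append]

end POMDP

/-! ### The rank of the system dynamics matrix of a low-rank POMDP -/

section Rank

variable {S O A : Type*} [Fintype S] [Fintype O] [Fintype A] {H : ℕ}

lemma POMDP.filter_sum_smul (M : POMDP S O A H) {ι : Type*} [Fintype ι] (h : ℕ) (c : ι → ℝ)
    (b : ι → S → ℝ) (l : List (O × A)) :
    M.filter h (fun s => ∑ i, c i * b i s) l = fun s => ∑ i, c i * M.filter h (b i) l s := by
  induction l generalizing h b with
  | nil => rfl
  | cons x l ih =>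
    have h1 : M.step h (fun s => ∑ i, c i * b i s) x = fun s => ∑ i, c i * M.step h (b i) x s := by
      funext s'
      simp only [step, Finset.mul_sum, Finset.sum_mul]
      rw [Finset.sum_comm]
      exact Finset.sum_congr rfl fun i _ => Finset.sum_congr rfl fun s _ => by ring
    simp only [POMDP.filter]
    rw [h1, ih]

lemma POMDP.testWeight_sum_smul (M : POMDP S O A H) {ι : Type*} [Fintype ι] (h : ℕ) (c : ι → ℝ)
    (b : ι → S → ℝ) {w : ℕ} (t : Test O A w) :
    M.testWeight h (fun s => ∑ i, c i * b i s) t = ∑ i, c i * M.testWeight h (b i) t := by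
  simp only [testWeight, filter_sum_smul, Finset.mul_sum, Finset.sum_mul]
  rw [Finset.sum_comm]
  exact Finset.sum_congr rfl fun i _ => Finset.sum_congr rfl fun s _ => by ring

lemma POMDP.IsLowRank.pos [Nonempty A] {M : POMDP S O A H} (hM : M.IsValid) {d : ℕ}
    (hd : M.IsLowRank d) (hH : 0 < H) : 0 < d := by
  obtain ⟨φ, ψ, hφ⟩ := hd
  rcases Nat.eq_zero_or_pos d with rfl | h
  · have hS : Nonempty S := by
      by_contra hne
      rw [not_nonempty_iff] at hne
      have := hM.init_sum
      simp at this
    obtain ⟨s⟩ := hS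
    obtain ⟨a⟩ := ‹Nonempty A›
    have := hM.trans_sum ⟨0, hH⟩ s a
    simp [hφ] at this
  · exact h

/-- The predictive states after a history of length `h + 1` factor through the features of the
last transition. -/
theorem POMDP.rank_dynMatrix_le [Nonempty A] {M : POMDP S O A H} (hM : M.IsValid) {d : ℕ}
    (hd : M.IsLowRank d) {h : ℕ} (hh : h < H) : (M.dynMatrix h).rank ≤ d := by
  have hd0 : 0 < d := hd.pos hM (by omega)
  obtain ⟨φ, ψ, hφ⟩ := hd
  -- the empty history is the only column of `D_0`
  rcases h with _ | g
  · refine (Matrix.rank_le_card_width _).trans ?_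
    simpa using Nat.succ_le_of_lt hd0
  · let b : (Fin (g + 1) → O × A) → S → ℝ := fun τ =>
      M.filter 0 M.init (List.ofFn fun i : Fin g => τ i.castSucc)
    let z : (Fin (g + 1) → O × A) → Fin d → ℝ := fun τ i =>
      ∑ s, b τ s * M.emitAt g s (τ (Fin.last g)).1 * φ ⟨g, by omega⟩ s (τ (Fin.last g)).2 i
    have hfil : ∀ τ : Fin (g + 1) → O × A, M.filter 0 M.init (List.ofFn τ) =
        fun s => ∑ i, z τ i * ψ ⟨g, by omega⟩ s i := by
      intro τ
      funext s'
      rw [List.ofFn_succ', List.concat_eq_append, filter_append]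
      simp only [POMDP.filter, step, List.length_ofFn, zero_add, z, Finset.sum_mul]
      rw [Finset.sum_comm]
      refine Finset.sum_congr rfl fun s _ => ?_
      have : M.transAt g s (τ (Fin.last g)).2 s' =
          ψ ⟨g, by omega⟩ s' ⬝ᵥ φ ⟨g, by omega⟩ s (τ (Fin.last g)).2 := by
        simp only [transAt, show g < H by omega, dif_pos]
        exact hφ _ _ _ _
      rw [this, dotProduct, Finset.mul_sum]
      exact Finset.sum_congr rfl fun i _ => by ring
    have hfac : M.dynMatrix (g + 1) =
        (Matrix.of fun (t : Σ w : Fin (H - (g + 1)), Test O A w) (i : Fin d) =>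
          M.testWeight (g + 1) (fun s => ψ ⟨g, by omega⟩ s i) t.2) *
        (Matrix.of fun (i : Fin d) (τ : Fin (g + 1) → O × A) => z τ i / M.histProb τ) := by
      ext t τ
      rw [Matrix.mul_apply]
      simp only [dynMatrix, Matrix.of_apply, testProb]
      rw [hfil, testWeight_sum_smul, Finset.sum_div]
      exact Finset.sum_congr rfl fun i _ => by ring
    rw [hfac]
    refine (Matrix.rank_mul_le_left _ _).trans ((Matrix.rank_le_card_width _).trans ?_)
    simp

theorem POMDP.psrRank_le [Nonempty A] {M : POMDP S O A H} (hM : M.IsValid) {d : ℕ}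
    (hd : M.IsLowRank d) : M.psrRank ≤ d :=
  Finset.sup_le fun h _ => M.rank_dynMatrix_le hM hd h.2

end Rank

/-! ### Prediction from core histories -/

section Core

/-- If `r = rank D` columns of `D` stay linearly independent when restricted to the rows `e`, then
every column of `D` is the combination of them whose coefficients are obtained by applying the
pseudo-inverse to the restricted column. -/
lemma eq_sum_pinv_mul_of_rank_eq {R C U : Type*} [Fintype R] [Fintype C] [Fintype U]
    (D : Matrix R C ℝ) (e : U → R) {r : ℕ} (core : Fin r → C) (X : Matrix (Fin r) U ℝ)
    (hr : D.rank = r) (hK : (D.submatrix e core).rank = r) (hX : IsPinv (D.submatrix e core) X)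
    (τ : C) (t : R) :
    D t τ = ∑ i, (X.mulVec fun u => D (e u) τ) i * D t (core i) := by
  set K := D.submatrix e core with hKdef
  have hind : LinearIndependent ℝ K.col := by
    rw [linearIndependent_iff_card_eq_finrank_span, Set.finrank,
      ← Matrix.rank_eq_finrank_span_cols, hK, Fintype.card_fin]
  have hinj : Function.Injective K.mulVec := Matrix.mulVec_injective_iff.2 hind
  have hXK : ∀ v, X.mulVec (K.mulVec v) = v := by
    intro v
    apply hinj
    rw [Matrix.mulVec_mulVec, Matrix.mulVec_mulVec, hX.mul₁]
  let E : (R → ℝ) →ₗ[ℝ] (U → ℝ) := LinearMap.funLeft ℝ ℝ e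
  have hindD : LinearIndependent ℝ fun i => D.col (core i) := by
    apply LinearIndependent.of_comp E
    exact hind
  -- the core columns are independent in `D` too, and by their number they span the column space
  have hle : Submodule.span ℝ (Set.range fun i => D.col (core i)) ≤
      Submodule.span ℝ (Set.range D.col) := by
    apply Submodule.span_mono
    rintro _ ⟨i, rfl⟩
    exact ⟨core i, rfl⟩
  have heq := Submodule.eq_of_le_of_finrank_eq hle (by
    rw [finrank_span_eq_card hindD, ← Matrix.rank_eq_finrank_span_cols, hr, Fintype.card_fin])
  have hmem : D.col τ ∈ Submodule.span ℝ (Set.range fun i => D.col (core i)) := by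
    rw [heq]
    exact Submodule.subset_span ⟨τ, rfl⟩
  obtain ⟨c, hc⟩ := (Submodule.mem_span_range_iff_exists_fun ℝ).1 hmem
  have hc' : ∀ t, D t τ = ∑ i, c i * D t (core i) := by
    intro t
    have := congrFun hc t
    simp only [Finset.sum_apply, Pi.smul_apply, smul_eq_mul] at this
    exact this.symm
  have hcX : (X.mulVec fun u => D (e u) τ) = c := by
    rw [← hXK c]
    congr 1
    funext u
    rw [hc' (e u)]
    simp only [Matrix.mulVec, dotProduct, hKdef, Matrix.submatrix_apply]
    exact Finset.sum_congr rfl fun i _ => mul_comm _ _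
  rw [hcX, hc' t]

variable {S O A : Type*} [Fintype S] [Fintype O] [Fintype A] [Nonempty A] {H : ℕ}

/-- The unnormalized predictive state after `c`: the weights of the tests with `n + 1`
observations. -/
noncomputable def predState (P : List (O × A) → ℝ) (n : ℕ) (c : List (O × A)) :
    Test O A n → ℝ := fun u => P (c ++ testList u)

/-- The weight `∑ (X v)_i P(l | core_i)` of the continuation `l` that is predicted from the
vector `v` of weights of tests. -/
noncomputable def predict (P : List (O × A) → ℝ) {n r : ℕ} (core : Fin r → List (O × A))
    (X : Matrix (Fin r) (Test O A n) ℝ) (v : Test O A n → ℝ) (l : List (O × A)) : ℝ :=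
  ∑ i, X.mulVec v i * (P (core i ++ l) / P (core i))

/-- The core histories `core` of length `h` and the matrix `X` of `ℓ¹`-norm at most `C` predict
the continuations of all histories of length `h` from their predictive states. -/
structure IsPredictor (H : ℕ) (P : List (O × A) → ℝ) (n h : ℕ) (C : ℝ) {r : ℕ}
    (core : Fin r → List (O × A)) (X : Matrix (Fin r) (Test O A n) ℝ) : Prop where
  length_core : ∀ i, (core i).length = h
  predict_eq : ∀ c, c.length = h → ∀ l, l ≠ [] → h + l.length ≤ H →
    predict P core X (predState P n c) l = P (c ++ l)
  norm_le : OneNormLE X C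

/-- Lists of weight zero are not continued. -/
lemma IsObsProcess.eq_zero_of_prefix {P : List (O × A) → ℝ} (hP : IsObsProcess H P)
    {c l : List (O × A)} (hc : P c = 0) (h : c.length + l.length ≤ H) : P (c ++ l) = 0 := by
  have h1 := hP.listSum_eq l.length c h
  rw [hc, mul_zero, ← sum_ofFn_eq_listSum,
    Finset.sum_eq_zero_iff_of_nonneg fun _ _ => hP.nonneg _] at h1
  have := h1 l.get (Finset.mem_univ _)
  rwa [List.ofFn_get] at this

lemma POMDP.isPredictor_of_testProb_eq {M : POMDP S O A H} (hM : M.IsValid) {n h r : ℕ}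
    (hh : h + (n + 1) ≤ H) {C : ℝ} (core : Fin r → Fin h → O × A)
    (X : Matrix (Fin r) (Test O A n) ℝ) (hnorm : OneNormLE X C)
    (hkey : ∀ (τ : Fin h → O × A) (w : ℕ), h + w < H → ∀ t : Test O A w,
      M.testProb t τ = ∑ i, X.mulVec (fun u => M.testProb u τ) i * M.testProb t (core i)) :
    IsPredictor H M.listProb n h C (fun i => List.ofFn (core i)) X := by
  have hP := hM.isObsProcess
  refine ⟨fun i => List.length_ofFn, ?_, hnorm⟩
  intro c hc l hl hlen
  obtain ⟨τ, rfl⟩ : ∃ τ : Fin h → O × A, c = List.ofFn τ := by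
    subst hc
    exact ⟨c.get, (List.ofFn_get c).symm⟩
  obtain ⟨w, hw⟩ : ∃ w, l.length = w + 1 :=
    ⟨l.length - 1, (Nat.succ_pred_eq_of_pos (List.length_pos_iff.2 hl)).symm⟩
  obtain ⟨t, ht⟩ := exists_testList_eq l hw
  have key := hkey τ w (by omega) t
  simp only [predict]
  simp only [fun τ' : Fin h → O × A => M.testProb_eq hM t τ' (by omega),
    fun u : Test O A n => M.testProb_eq hM u τ (by omega)] at key
  simp only [fun τ' : Fin h → O × A =>
    ht hP.toIsConsistent (List.ofFn τ') (by simp; omega)]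
  by_cases h0 : M.listProb (List.ofFn τ) = 0
  · have h1 : ∀ u : Test O A n, predState M.listProb n (List.ofFn τ) u = 0 := fun u =>
      hP.eq_zero_of_prefix h0 (by simp; omega)
    rw [hP.eq_zero_of_prefix h0 (by simp; omega), show predState M.listProb n (List.ofFn τ) = 0
      from funext h1]
    simp
  · rw [div_eq_iff h0] at key
    rw [key, Finset.sum_mul]
    refine Finset.sum_congr rfl fun i _ => ?_
    have : predState M.listProb n (List.ofFn τ) = M.listProb (List.ofFn τ) •
        fun u => M.listProb (List.ofFn τ ++ testList u) / M.listProb (List.ofFn τ) := by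
      funext u
      simp only [predState, Pi.smul_apply, smul_eq_mul]
      field_simp
    rw [this, Matrix.mulVec_smul, Pi.smul_apply, smul_eq_mul]
    ring

/-- Regularity provides at most `d` core histories that predict everything. -/
theorem POMDP.exists_isPredictor {M : POMDP S O A H} (hM : M.IsValid) {d : ℕ}
    (hd : M.IsLowRank d) {n h : ℕ} (hh : h + (n + 1) ≤ H) {α : ℝ}
    (hreg : M.IsRegularAt (n + 1) h α) :
    ∃ (r : ℕ) (core : Fin r → List (O × A)) (X : Matrix (Fin r) (Test O A n) ℝ),
      r ≤ d ∧ IsPredictor H M.listProb n h (1 / α) core X := by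
  obtain ⟨core, hK, X, hX, hnorm⟩ := hreg
  let e : Test O A n → Σ w : Fin (H - h), Test O A w := fun u => ⟨⟨n, by omega⟩, u⟩
  exact ⟨(M.dynMatrix h).rank, fun i => List.ofFn (core i), X,
    M.rank_dynMatrix_le hM hd (by omega), M.isPredictor_of_testProb_eq hM hh core X hnorm
      fun τ w hw t => eq_sum_pinv_mul_of_rank_eq (M.dynMatrix h) e core X rfl hK hX τ
        ⟨⟨w, by omega⟩, t⟩⟩

end Core

/-! ### Comparison of two observation processes through predictive states -/

section Compare

variable {O A : Type*} [Fintype O] [Fintype A] [Nonempty A] {H n h r : ℕ}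

lemma predict_eq_dotProduct (P : List (O × A) → ℝ) (core : Fin r → List (O × A))
    (X : Matrix (Fin r) (Test O A n) ℝ) (v : Test O A n → ℝ) (l : List (O × A)) :
    predict P core X v l = X.mulVec v ⬝ᵥ fun i => P (core i ++ l) / P (core i) := rfl

lemma predict_sub (P : List (O × A) → ℝ) (core : Fin r → List (O × A))
    (X : Matrix (Fin r) (Test O A n) ℝ) (v v' : Test O A n → ℝ) (l : List (O × A)) :
    predict P core X (fun u => v u - v' u) l = predict P core X v l - predict P core X v' l := by
  have : (fun u => v u - v' u) = v - v' := rfl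
  rw [this, predict_eq_dotProduct, Matrix.mulVec_sub, sub_dotProduct]
  rfl

lemma predict_sum_smul {ι : Type*} [Fintype ι] (P : List (O × A) → ℝ)
    (core : Fin r → List (O × A)) (X : Matrix (Fin r) (Test O A n) ℝ) (c : ι → ℝ)
    (v : ι → Test O A n → ℝ) (l : List (O × A)) :
    predict P core X (fun u => ∑ i, c i * v i u) l = ∑ i, c i * predict P core X (v i) l := by
  have : (fun u => ∑ i, c i * v i u) = ∑ i, c i • v i := by
    funext u
    simp
  rw [this, predict_eq_dotProduct, Matrix.mulVec_sum, sum_dotProduct]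
  refine Finset.sum_congr rfl fun i _ => ?_
  rw [Matrix.mulVec_smul, smul_dotProduct, smul_eq_mul]
  rfl

lemma abs_predict_le {P : List (O × A) → ℝ} (hP : IsObsProcess H P) (core : Fin r → List (O × A))
    (X : Matrix (Fin r) (Test O A n) ℝ) (v : Test O A n → ℝ) (l : List (O × A)) :
    |predict P core X v l| ≤ ∑ i, |X.mulVec v i| * (P (core i ++ l) / P (core i)) := by
  refine (Finset.abs_sum_le_sum_abs _ _).trans (le_of_eq (Finset.sum_congr rfl fun i _ => ?_))
  rw [abs_mul, abs_of_nonneg (div_nonneg (hP.nonneg _) (hP.nonneg _))]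

/-- Predictions are stable, in expectation over any policy: they are combinations of conditional
probabilities whose coefficients `X v` are bounded in `ℓ¹`. -/
lemma IsPredictor.listSum_abs_predict_le {P : List (O × A) → ℝ} (hP : IsObsProcess H P) {C : ℝ}
    {core : Fin r → List (O × A)} {X : Matrix (Fin r) (Test O A n) ℝ}
    (hX : IsPredictor H P n h C core X) (π : Policy O A) (pre : List (O × A)) (k : ℕ)
    (hk : h + k ≤ H) (v : Test O A n → ℝ) :
    (listSum k fun l => actWeight π pre l * |predict P core X v l|) ≤ C * ∑ u, |v u| := by
  refine le_trans ?_ (hX.norm_le v)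
  calc (listSum k fun l => actWeight π pre l * |predict P core X v l|)
      ≤ listSum k fun l => ∑ i, |X.mulVec v i| / P (core i) *
          (actWeight π pre l * P (core i ++ l)) := by
        refine listSum_mono fun l _ => ?_
        refine (mul_le_mul_of_nonneg_left (abs_predict_le hP core X v l)
          (actWeight_nonneg _ _ _)).trans (le_of_eq ?_)
        rw [Finset.mul_sum]
        exact Finset.sum_congr rfl fun i _ => by ring
    _ = ∑ i, |X.mulVec v i| / P (core i) * P (core i) := by
        rw [listSum_sum]
        refine Finset.sum_congr rfl fun i _ => ?_
        rw [listSum_mul_left, hP.listSum_actWeight π k pre (core i)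
          (by rw [hX.length_core]; exact hk)]
    _ ≤ ∑ i, |X.mulVec v i| := by
        refine Finset.sum_le_sum fun i _ => ?_
        rcases (hP.nonneg (core i)).eq_or_lt with h0 | h0
        · rw [← h0, mul_zero]; exact abs_nonneg _
        · rw [div_mul_cancel₀ _ h0.ne']

/-- Stability in the form of a sum over all tests, whose actions are not weighted by a policy. -/
lemma IsPredictor.sum_abs_predict_testList_le {P : List (O × A) → ℝ} (hP : IsObsProcess H P)
    {C : ℝ} {core : Fin r → List (O × A)} {X : Matrix (Fin r) (Test O A n) ℝ}
    (hX : IsPredictor H P n h C core X) (w : ℕ) (hw : h + w < H) (v : Test O A n → ℝ) :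
    ∑ t : Test O A w, |predict P core X v (testList t)| ≤
      (Fintype.card A : ℝ) ^ w * (C * ∑ u, |v u|) := by
  refine le_trans ?_ (mul_le_mul_of_nonneg_left (hX.norm_le v) (by positivity))
  calc ∑ t : Test O A w, |predict P core X v (testList t)|
      ≤ ∑ t : Test O A w, ∑ i, |X.mulVec v i| / P (core i) * P (core i ++ testList t) := by
        refine Finset.sum_le_sum fun t _ => (abs_predict_le hP core X v _).trans (le_of_eq ?_)
        exact Finset.sum_congr rfl fun i _ => by ring
    _ = ∑ i, |X.mulVec v i| / P (core i) * ((Fintype.card A : ℝ) ^ w * P (core i)) := by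
        rw [Finset.sum_comm]
        refine Finset.sum_congr rfl fun i _ => ?_
        rw [← Finset.mul_sum, hP.sum_testList w (core i) (by rw [hX.length_core]; exact hw)]
    _ ≤ _ := by
        rw [Finset.mul_sum]
        refine Finset.sum_le_sum fun i _ => ?_
        rcases (hP.nonneg (core i)).eq_or_lt with h0 | h0
        · rw [← h0, mul_zero, mul_zero]; positivity
        · apply le_of_eq; field_simp

lemma predict_last_action {P : List (O × A) → ℝ} (hP : IsObsProcess H P) {C : ℝ}
    {core : Fin r → List (O × A)} {X : Matrix (Fin r) (Test O A n) ℝ}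
    (hX : IsPredictor H P n h C core X) (v : Test O A n → ℝ) (l : List (O × A))
    (hl : h + l.length < H) (o : O) (a a' : A) :
    predict P core X v (l ++ [(o, a)]) = predict P core X v (l ++ [(o, a')]) := by
  refine Finset.sum_congr rfl fun i _ => ?_
  rw [← List.append_assoc, ← List.append_assoc,
    hP.last_action (core i ++ l) (by simp [hX.length_core, hl]) o a a']

/-- Predicting in two stages: first the predictive state after one more step, then the rest. -/
lemma IsPredictor.predict_cons {P : List (O × A) → ℝ} {C : ℝ}
    {core : Fin r → List (O × A)} {X : Matrix (Fin r) (Test O A n) ℝ}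
    (hX : IsPredictor H P n h C core X) {r' : ℕ} {core' : Fin r' → List (O × A)}
    {X' : Matrix (Fin r') (Test O A n) ℝ} (hX' : IsPredictor H P n (h + 1) C core' X')
    (v : Test O A n → ℝ) (x : O × A) (l : List (O × A)) (hl : l ≠ [])
    (hlen : h + 1 + l.length ≤ H) :
    predict P core X v (x :: l) =
      predict P core' X' (fun u => predict P core X v (x :: testList u)) l := by
  have h1 : (fun u : Test O A n => predict P core X v (x :: testList u)) = fun u =>
      ∑ i, (X.mulVec v i / P (core i)) * predState P n (core i ++ [x]) u := by
    funext u
    refine Finset.sum_congr rfl fun i _ => ?_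
    simp only [predState, List.append_assoc, List.singleton_append]
    ring
  rw [h1, predict_sum_smul]
  refine Finset.sum_congr rfl fun i _ => ?_
  rw [hX'.predict_eq (core i ++ [x]) (by simp [hX.length_core]) l hl hlen]
  simp only [List.append_assoc, List.singleton_append]
  ring

/-- The error, summed over the tests with `w + 1` observations, when their weights after the
history `c` are predicted by the process `Q` from the predictive state of the process `P`. -/
noncomputable def predErr (P Q : List (O × A) → ℝ) {n r : ℕ} (core : Fin r → List (O × A))
    (X : Matrix (Fin r) (Test O A n) ℝ) (w : ℕ) (c : List (O × A)) : ℝ :=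
  ∑ t : Test O A w, |predict Q core X (predState P n c) (testList t) - P (c ++ testList t)|

lemma predErr_nonneg (P Q : List (O × A) → ℝ) (core : Fin r → List (O × A))
    (X : Matrix (Fin r) (Test O A n) ℝ) (w : ℕ) (c : List (O × A)) :
    0 ≤ predErr P Q core X w c := Finset.sum_nonneg fun _ _ => abs_nonneg _

lemma listSum_actWeight_mul_succ (π : Policy O A) (pre : List (O × A)) (k : ℕ)
    (F : List (O × A) → ℝ)
    (hF : ∀ l, l.length = k → ∀ o a a', F (l ++ [(o, a)]) = F (l ++ [(o, a')])) :
    (listSum (k + 1) fun l => actWeight π pre l * F l) =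
      listSum k fun l => actWeight π pre l * ∑ o, F (l ++ [(o, Classical.arbitrary A)]) := by
  rw [listSum_succ_last]
  refine listSum_congr fun l hl => ?_
  rw [Fintype.sum_prod_type, Finset.mul_sum]
  refine Finset.sum_congr rfl fun o _ => ?_
  simp only [actWeight_append, actWeight, mul_one, fun a => hF l hl o a (Classical.arbitrary A)]
  rw [← Finset.sum_mul, ← Finset.mul_sum, sum_toReal_pmf, mul_one]

lemma actWeight_le_one (π : Policy O A) (pre l : List (O × A)) : actWeight π pre l ≤ 1 := by
  induction l generalizing pre with
  | nil => exact le_rfl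
  | cons x l ih =>
    refine mul_le_one₀ ?_ (actWeight_nonneg _ _ _) (ih _)
    exact ENNReal.toReal_le_of_le_ofReal zero_le_one (by simpa using PMF.coe_le_one _ _)

/-- The weight predicted for the trajectory `l` when the first `h` steps follow `P` and the
remaining ones are predicted by `Q`. -/
noncomputable def hybrid (P Q : List (O × A) → ℝ) {n : ℕ} {r : ℕ → ℕ}
    (core : ∀ h, Fin (r h) → List (O × A)) (X : ∀ h, Matrix (Fin (r h)) (Test O A n) ℝ) (h : ℕ)
    (l : List (O × A)) : ℝ :=
  predict Q (core h) (X h) (predState P n (l.take h)) (l.drop h)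

variable {P Q : List (O × A) → ℝ} {C : ℝ} {r : ℕ → ℕ} {core : ∀ h, Fin (r h) → List (O × A)}
  {X : ∀ h, Matrix (Fin (r h)) (Test O A n) ℝ}

lemma listSum_hybrid_zero_le (hQ : IsObsProcess H Q)
    (hX : ∀ h, h + (n + 1) ≤ H → IsPredictor H Q n h C (core h) (X h)) (hn : n + 1 ≤ H)
    (π : Policy O A) :
    (listSum H fun l => actWeight π [] l * |Q l - hybrid P Q core X 0 l|) ≤
      C * ∑ u : Test O A n, |Q (testList u) - P (testList u)| := by
  refine le_trans (le_of_eq (listSum_congr fun l hl => ?_))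
    ((hX 0 (by omega)).listSum_abs_predict_le hQ π [] H (by omega) _)
  rw [predict_sub _ _ _ (fun u => Q (testList u)) (fun u => P (testList u))]
  congr 3
  exact ((hX 0 (by omega)).predict_eq [] rfl l
    (by rintro rfl; simp at hl; omega) (by omega)).symm

/-- Consecutive hybrids differ by the prediction, from step `h + 1` on, of the error that is made
when the next predictive state is predicted. -/
lemma listSum_hybrid_succ_le (hQ : IsObsProcess H Q)
    (hX : ∀ h, h + (n + 1) ≤ H → IsPredictor H Q n h C (core h) (X h)) (h : ℕ)
    (hh : h + 1 + (n + 1) ≤ H) (π : Policy O A) :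
    (listSum H fun l => actWeight π [] l * |hybrid P Q core X h l - hybrid P Q core X (h + 1) l|) ≤
      C * listSum h fun c => actWeight π [] c * predErr P Q (core h) (X h) (n + 1) c := by
  obtain ⟨k, hk⟩ : ∃ k, H = h + (k + 1) := ⟨H - h - 1, by omega⟩
  have h0 : (listSum H fun l => actWeight π [] l *
      |hybrid P Q core X h l - hybrid P Q core X (h + 1) l|) =
      listSum (h + (k + 1)) fun l => actWeight π [] l *
      |hybrid P Q core X h l - hybrid P Q core X (h + 1) l| := by rw [← hk]
  rw [h0, listSum_append, ← listSum_mul_left]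
  refine listSum_mono fun c hc => ?_
  rw [listSum]
  have hstep : ∀ x : O × A, (listSum k fun l => actWeight π [] (c ++ x :: l) *
      |hybrid P Q core X h (c ++ x :: l) - hybrid P Q core X (h + 1) (c ++ x :: l)|) ≤
      actWeight π [] c * (C * ∑ u : Test O A n,
        |predict Q (core h) (X h) (predState P n c) (x :: testList u) -
          P (c ++ x :: testList u)|) := by
    intro x
    refine le_trans ?_ (mul_le_mul_of_nonneg_left
      ((hX (h + 1) hh).listSum_abs_predict_le hQ π (c ++ [x]) k (by omega) _)
      (actWeight_nonneg _ _ _))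
    rw [← listSum_mul_left]
    refine listSum_mono fun l hl => ?_
    have h1 : hybrid P Q core X h (c ++ x :: l) - hybrid P Q core X (h + 1) (c ++ x :: l) =
        predict Q (core (h + 1)) (X (h + 1)) (fun u =>
          predict Q (core h) (X h) (predState P n c) (x :: testList u) -
          P (c ++ x :: testList u)) l := by
      rw [predict_sub, ← (hX h (by omega)).predict_cons (hX (h + 1) hh) _ x l
        (by rintro rfl; simp at hl; omega) (by omega)]
      have e1 : (c ++ x :: l).take h = c := by rw [← hc]; simp
      have e2 : (c ++ x :: l).drop h = x :: l := by rw [← hc]; simp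
      have e3 : (c ++ x :: l).take (h + 1) = c ++ [x] := by
        rw [← hc, List.take_length_add_append]; simp
      have e4 : (c ++ x :: l).drop (h + 1) = l := by
        rw [← hc, List.drop_length_add_append]; simp
      rw [hybrid, hybrid, e1, e2, e3, e4]
      congr 2
      funext u
      simp [predState]
    rw [h1, actWeight_append, List.nil_append, actWeight]
    have h2 : (π c x.1 x.2).toReal ≤ 1 :=
      ENNReal.toReal_le_of_le_ofReal zero_le_one (by simpa using PMF.coe_le_one _ _)
    rw [mul_assoc]
    refine mul_le_mul_of_nonneg_left ?_ (actWeight_nonneg _ _ _)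
    refine mul_le_mul_of_nonneg_right ?_ (abs_nonneg _)
    exact mul_le_of_le_one_left (actWeight_nonneg _ _ _) h2
  refine (Finset.sum_le_sum fun x _ => hstep x).trans (le_of_eq ?_)
  rw [predErr, sum_testList_succ n fun l =>
    |predict Q (core h) (X h) (predState P n c) l - P (c ++ l)|, ← Finset.mul_sum,
    ← Finset.mul_sum]
  ring

lemma listSum_hybrid_last_le (hP : IsObsProcess H P) (hQ : IsObsProcess H Q)
    (hX : ∀ h, h + (n + 1) ≤ H → IsPredictor H Q n h C (core h) (X h)) (g : ℕ)
    (hg : H = g + (n + 1)) (π : Policy O A) :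
    (listSum H fun l => actWeight π [] l * |hybrid P Q core X g l - P l|) ≤
      listSum g fun c => actWeight π [] c * predErr P Q (core g) (X g) n c := by
  have h0 : (listSum H fun l => actWeight π [] l * |hybrid P Q core X g l - P l|) =
      listSum (g + (n + 1)) fun l => actWeight π [] l * |hybrid P Q core X g l - P l| := by
    rw [← hg]
  rw [h0, listSum_append]
  refine listSum_mono fun c hc => ?_
  let F : List (O × A) → ℝ := fun l =>
    |predict Q (core g) (X g) (predState P n c) l - P (c ++ l)|
  have h1 : (listSum (n + 1) fun l => actWeight π [] (c ++ l) *
      |hybrid P Q core X g (c ++ l) - P (c ++ l)|) =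
      actWeight π [] c * listSum (n + 1) fun l => actWeight π c l * F l := by
    rw [← listSum_mul_left]
    refine listSum_congr fun l hl => ?_
    have e1 : (c ++ l).take g = c := by rw [← hc]; simp
    have e2 : (c ++ l).drop g = l := by rw [← hc]; simp
    rw [hybrid, e1, e2, actWeight_append, List.nil_append, mul_assoc]
  rw [h1, listSum_actWeight_mul_succ π c n F fun l hl o a a' => by
    simp only [F]
    rw [predict_last_action hQ (hX g (by omega)) _ l (by omega) o a a', ← List.append_assoc,
      ← List.append_assoc, hP.last_action (c ++ l) (by simp; omega) o a a']]
  refine mul_le_mul_of_nonneg_left ?_ (actWeight_nonneg _ _ _)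
  rw [predErr, sum_testList n F]
  refine listSum_mono fun l _ => mul_le_of_le_one_left ?_ (actWeight_le_one _ _ _)
  exact Finset.sum_nonneg fun _ _ => abs_nonneg _

/-- The distance of the laws of the trajectory under `π` is at most a sum of prediction errors
along the histories generated by `P` and `π`. -/
theorem listSum_abs_sub_le_predErr (hP : IsObsProcess H P) (hQ : IsObsProcess H Q)
    (hX : ∀ h, h + (n + 1) ≤ H → IsPredictor H Q n h C (core h) (X h)) (g : ℕ)
    (hg : H = g + (n + 1)) (π : Policy O A) :
    (listSum H fun l => actWeight π [] l * |Q l - P l|) ≤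
      C * ∑ u : Test O A n, |Q (testList u) - P (testList u)| +
      ∑ h ∈ Finset.range g, C * (listSum h fun c => actWeight π [] c *
        predErr P Q (core h) (X h) (n + 1) c) +
      listSum g fun c => actWeight π [] c * predErr P Q (core g) (X g) n c := by
  -- telescoping sum over the hybrids, from `Q` at `h = 0` to `P` at `h = g`
  have h1 : (listSum H fun l => actWeight π [] l * |Q l - P l|) ≤
      listSum H fun l => actWeight π [] l * |Q l - hybrid P Q core X 0 l| +
        ∑ h ∈ Finset.range g, actWeight π [] l *
          |hybrid P Q core X h l - hybrid P Q core X (h + 1) l| +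
        actWeight π [] l * |hybrid P Q core X g l - P l| := by
    refine listSum_mono fun l _ => ?_
    rw [← Finset.mul_sum, ← mul_add, ← mul_add]
    refine mul_le_mul_of_nonneg_left ?_ (actWeight_nonneg _ _ _)
    have h2 := Finset.sum_range_sub (fun h => hybrid P Q core X h l) g
    have h3 : |hybrid P Q core X 0 l - hybrid P Q core X g l| ≤ ∑ h ∈ Finset.range g,
        |hybrid P Q core X h l - hybrid P Q core X (h + 1) l| := by
      rw [abs_sub_comm, ← h2]
      refine (Finset.abs_sum_le_sum_abs _ _).trans (le_of_eq ?_)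
      exact Finset.sum_congr rfl fun _ _ => abs_sub_comm _ _
    have h4 := abs_sub_le (Q l) (hybrid P Q core X 0 l) (P l)
    have h5 := abs_sub_le (hybrid P Q core X 0 l) (hybrid P Q core X g l) (P l)
    linarith
  refine h1.trans ?_
  rw [listSum_add, listSum_add, listSum_sum]
  refine add_le_add (add_le_add (listSum_hybrid_zero_le hQ hX (by omega) π) ?_)
    (listSum_hybrid_last_le hP hQ hX g hg π)
  refine Finset.sum_le_sum fun h hh => listSum_hybrid_succ_le hQ hX h ?_ π
  have := Finset.mem_range.1 hh
  omega

end Compare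

/-! ### Prediction errors and the exploration policies -/

section Explore

variable {O A : Type*} [Fintype O] [Fintype A] [Nonempty A] {H n h r : ℕ}

/-- Twice the total variation distance of the laws of the trajectory under `π`. -/
noncomputable def tvDist (H : ℕ) (P Q : List (O × A) → ℝ) (π : Policy O A) : ℝ :=
  listSum H fun l => actWeight π [] l * |Q l - P l|

lemma tvDist_nonneg (P Q : List (O × A) → ℝ) (π : Policy O A) : 0 ≤ tvDist H P Q π :=
  listSum_nonneg fun _ _ => mul_nonneg (actWeight_nonneg _ _ _) (abs_nonneg _)

lemma actWeight_explore_eq (π : Policy O A) (h : ℕ) (u : Fin n → A) (pre l : List (O × A))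
    (hl : pre.length + l.length < h) :
    actWeight (explore π h u) pre l = actWeight π pre l := by
  induction l generalizing pre with
  | nil => rfl
  | cons x l ih =>
    rw [actWeight, actWeight, ih _ (by simp at hl ⊢; omega), explore,
      if_pos (by simp at hl; omega)]

/-- After `h` steps the exploration policy executes `u`. -/
lemma actWeight_explore_eq_one (π : Policy O A) (h : ℕ) (τ : Fin n → O × A) (pre : List (O × A))
    (hpre : pre.length = h) :
    actWeight (explore π h fun i => (τ i).2) pre (List.ofFn τ) = 1 := by
  rw [actWeight_ofFn]
  refine Finset.prod_eq_one fun i _ => ?_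
  have hlen : (pre ++ (List.ofFn τ).take i).length = h + i := by
    simp [hpre]
  rw [explore, if_neg (by omega), dif_pos (by omega)]
  have : (⟨(pre ++ (List.ofFn τ).take i).length - h, by omega⟩ : Fin n) = i := by
    ext; simp [hlen]
  rw [this, PMF.pure_apply, if_pos rfl, ENNReal.toReal_one]

lemma toReal_uniformOfFintype (a : A) :
    (PMF.uniformOfFintype A a).toReal = (Fintype.card A : ℝ)⁻¹ := by
  simp [PMF.uniformOfFintype_apply]

/-- In its first `h` steps the exploration policy follows `π`, up to the last, uniform action. -/
lemma actWeight_dropLast_le (π : Policy O A) (u : Fin n → A) (c : List (O × A))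
    (hc : c.length = h) :
    actWeight π [] c.dropLast ≤ Fintype.card A * actWeight (explore π h u) [] c := by
  have hA : (0 : ℝ) < Fintype.card A := by exact_mod_cast Fintype.card_pos
  rcases List.eq_nil_or_concat' c with rfl | ⟨c', x, rfl⟩
  · simp only [List.dropLast_nil, actWeight, mul_one]
    exact_mod_cast Fintype.card_pos (α := A)
  · simp only [List.length_append, List.length_singleton] at hc
    rw [List.dropLast_concat, actWeight_append, actWeight_explore_eq π h u [] c' (by simp; omega)]
    simp only [actWeight, List.nil_append, mul_one]
    rw [explore, if_neg (by omega), dif_neg (by omega), toReal_uniformOfFintype]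
    apply le_of_eq
    field_simp

/-- The distance of the predictive states of `P` and `Q` after `h` steps, when the first `h - 1`
actions are chosen by `π` and the sum is over all actions in the step `h`. -/
noncomputable def stateErr (P Q : List (O × A) → ℝ) (n : ℕ) (π : Policy O A) (h : ℕ) : ℝ :=
  listSum h fun c => actWeight π [] c.dropLast *
    ∑ u : Test O A n, |Q (c ++ testList u) - P (c ++ testList u)|

/-- The exploration policies for `h` observe all predictive states after `h` steps: a test with
actions `u` is executed by the policy for `u`, and the uniform action at step `h` costs `|A|`. -/
lemma stateErr_le {P Q : List (O × A) → ℝ} (hP : IsConsistent H P) (hQ : IsConsistent H Q)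
    (π : Policy O A) (h : ℕ) (hh : h + (n + 1) ≤ H) :
    stateErr P Q n π h ≤
      Fintype.card A * ∑ u : Fin n → A, tvDist H P Q (explore π h u) := by
  classical
  let D : List (O × A) → ℝ := fun l => Q l - P l
  have hD : IsConsistent H D := hQ.sub hP
  let e : Test O A n → Fin n → A := fun t i => (t.1 i).2
  -- the tests with actions `u` are observed by the policy that executes `u`
  have h1 : ∀ u : Fin n → A, (listSum h fun c => actWeight (explore π h u) [] c *
      ∑ t : Test O A n with e t = u, |D (c ++ testList t)|) ≤
      tvDist H P Q (explore π h u) := by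
    intro u
    obtain ⟨k, hk⟩ : ∃ k, H = h + (n + 1) + k := ⟨H - (h + (n + 1)), by omega⟩
    have h2 := hD.listSum_abs_prefix_le (explore π h u) (h + (n + 1)) k (by omega)
    rw [← hk] at h2
    refine le_trans ?_ h2
    rw [listSum_append]
    refine listSum_mono fun c hc => ?_
    have h3 : (listSum (n + 1) fun l => actWeight (explore π h u) [] (c ++ l) * |D (c ++ l)|) =
        actWeight (explore π h u) [] c *
          listSum (n + 1) fun l => actWeight (explore π h u) c l * |D (c ++ l)| := by
      rw [← listSum_mul_left]
      exact listSum_congr fun l _ => by rw [actWeight_append, List.nil_append, mul_assoc]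
    rw [h3, listSum_actWeight_mul_succ _ _ _ _ fun l hl o a a' => by
      rw [← List.append_assoc, ← List.append_assoc,
        hD.last_action (c ++ l) (by simp; omega) o a a']]
    refine mul_le_mul_of_nonneg_left ?_ (actWeight_nonneg _ _ _)
    rw [Finset.sum_filter, Fintype.sum_prod_type, ← sum_ofFn_eq_listSum]
    refine Finset.sum_le_sum fun τ _ => ?_
    rw [Finset.mul_sum]
    refine Finset.sum_le_sum fun o _ => ?_
    split_ifs with hu
    · have := actWeight_explore_eq_one π h τ c hc
      subst hu
      simp only [e]
      rw [this, one_mul]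
      rfl
    · exact mul_nonneg (actWeight_nonneg _ _ _) (abs_nonneg _)
  refine le_trans ?_ (mul_le_mul_of_nonneg_left (Finset.sum_le_sum fun u _ => h1 u)
    (Nat.cast_nonneg _))
  rw [← listSum_sum, ← listSum_mul_left]
  refine listSum_mono fun c hc => ?_
  rw [← Finset.sum_fiberwise Finset.univ e, Finset.mul_sum, Finset.mul_sum]
  refine Finset.sum_le_sum fun u _ => ?_
  rw [← mul_assoc]
  exact mul_le_mul_of_nonneg_right (actWeight_dropLast_le π u c hc)
    (Finset.sum_nonneg fun _ _ => abs_nonneg _)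

lemma actWeight_le_dropLast (π : Policy O A) (c : List (O × A)) :
    actWeight π [] c ≤ actWeight π [] c.dropLast := by
  rcases List.eq_nil_or_concat' c with rfl | ⟨c', x, rfl⟩
  · rfl
  · rw [List.dropLast_concat, actWeight_append]
    exact mul_le_of_le_one_right (actWeight_nonneg _ _ _) (actWeight_le_one _ _ _)

/-- As `Q` predicts its own tests exactly, its prediction errors from the predictive state of `P`
are at most the distances of the weights of the tests and of the predictive states. -/
lemma predErr_le {P Q : List (O × A) → ℝ} (hQ : IsObsProcess H Q) {C : ℝ}
    {core : Fin r → List (O × A)} {X : Matrix (Fin r) (Test O A n) ℝ}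
    (hX : IsPredictor H Q n h C core X) {w : ℕ} (hw : h + w < H) (c : List (O × A))
    (hc : c.length = h) :
    predErr P Q core X w c ≤
      (Fintype.card A : ℝ) ^ w * (C * ∑ u : Test O A n, |Q (c ++ testList u) - P (c ++ testList u)|)
        + ∑ t : Test O A w, |Q (c ++ testList t) - P (c ++ testList t)| := by
  refine le_trans ?_ (add_le_add_left (hX.sum_abs_predict_testList_le hQ w hw
    fun u => Q (c ++ testList u) - P (c ++ testList u)) _)
  rw [← Finset.sum_add_distrib]
  refine Finset.sum_le_sum fun t _ => ?_
  have h1 := predict_sub Q core X (predState Q n c) (predState P n c) (testList t)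
  rw [hX.predict_eq c hc (testList t) (by simp [testList]) (by simp; omega)] at h1
  have h2 : predict Q core X (predState P n c) (testList t) - P (c ++ testList t) =
      (Q (c ++ testList t) - P (c ++ testList t)) -
      predict Q core X (fun u => predState Q n c u - predState P n c u) (testList t) := by
    rw [h1]; ring
  rw [h2]
  refine (abs_sub _ _).trans ?_
  rw [add_comm]
  rfl

lemma listSum_predErr_le {P Q : List (O × A) → ℝ} (hQ : IsObsProcess H Q) {C : ℝ}
    {core : Fin r → List (O × A)} {X : Matrix (Fin r) (Test O A n) ℝ}
    (hX : IsPredictor H Q n h C core X) (hh : h + (n + 1) ≤ H) (π : Policy O A) :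
    (listSum h fun c => actWeight π [] c * predErr P Q core X n c) ≤
      ((Fintype.card A : ℝ) ^ n * C + 1) * stateErr P Q n π h := by
  rw [stateErr, ← listSum_mul_left]
  refine listSum_mono fun c hc => ?_
  calc _ ≤ actWeight π [] c.dropLast * predErr P Q core X n c :=
        mul_le_mul_of_nonneg_right (actWeight_le_dropLast _ _) (predErr_nonneg _ _ _ _ _ _)
    _ ≤ actWeight π [] c.dropLast * _ :=
        mul_le_mul_of_nonneg_left (predErr_le hQ hX (by omega) c hc) (actWeight_nonneg _ _ _)
    _ = _ := by ring

/-- The tests with one more step are predictive states of the histories with one more step. -/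
lemma listSum_predErr_succ_le {P Q : List (O × A) → ℝ} (hQ : IsObsProcess H Q) {C : ℝ}
    (hC : 0 ≤ C) {core : Fin r → List (O × A)} {X : Matrix (Fin r) (Test O A n) ℝ}
    (hX : IsPredictor H Q n h C core X) (hh : h + 1 + (n + 1) ≤ H) (π : Policy O A) :
    (listSum h fun c => actWeight π [] c * predErr P Q core X (n + 1) c) ≤
      (Fintype.card A : ℝ) ^ (n + 1) * C * stateErr P Q n π h + stateErr P Q n π (h + 1) := by
  have h1 : stateErr P Q n π (h + 1) = listSum h fun c => actWeight π [] c *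
      ∑ t : Test O A (n + 1), |Q (c ++ testList t) - P (c ++ testList t)| := by
    rw [stateErr, listSum_succ_last]
    refine listSum_congr fun c hc => ?_
    rw [sum_testList_succ n fun l => |Q (c ++ l) - P (c ++ l)|, Finset.mul_sum]
    refine Finset.sum_congr rfl fun x _ => ?_
    simp
  rw [h1, stateErr, ← listSum_mul_left, ← listSum_add]
  refine listSum_mono fun c hc => ?_
  have h2 := actWeight_le_dropLast π c
  have h3 := actWeight_nonneg π [] c
  have h4 : 0 ≤ ∑ u : Test O A n, |Q (c ++ testList u) - P (c ++ testList u)| :=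
    Finset.sum_nonneg fun _ _ => abs_nonneg _
  have h5 := mul_le_mul_of_nonneg_left
    (predErr_le (P := P) hQ hX (w := n + 1) (by omega) c hc) h3
  have h6 : 0 ≤ (Fintype.card A : ℝ) ^ (n + 1) * (C *
    ∑ u : Test O A n, |Q (c ++ testList u) - P (c ++ testList u)|) := by positivity
  have h7 := mul_le_mul_of_nonneg_right h2 h6
  linarith

/-- The sum of the distances over all the exploration policies of one round. -/
noncomputable def tvSum (H n g : ℕ) (P Q : List (O × A) → ℝ) (π : Policy O A) : ℝ :=
  ∑ x : Fin (g + 1) × (Fin n → A), tvDist H P Q (explore π x.1 x.2)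

lemma stateErr_le_tvSum {P Q : List (O × A) → ℝ} (hP : IsConsistent H P) (hQ : IsConsistent H Q)
    (π : Policy O A) {g : ℕ} (hg : H = g + (n + 1)) (h : ℕ) (hh : h ≤ g) :
    stateErr P Q n π h ≤ Fintype.card A * tvSum H n g P Q π := by
  refine (stateErr_le hP hQ π h (by omega)).trans
    (mul_le_mul_of_nonneg_left ?_ (Nat.cast_nonneg _))
  rw [tvSum, Fintype.sum_prod_type]
  exact Finset.single_le_sum (f := fun i : Fin (g + 1) =>
    ∑ u : Fin n → A, tvDist H P Q (explore π i u))
    (fun _ _ => Finset.sum_nonneg fun _ _ => tvDist_nonneg _ _ _)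
    (Finset.mem_univ (⟨h, by omega⟩ : Fin (g + 1)))

/-- All prediction errors are controlled by the exploration policies. -/
lemma listSum_predErr_le_tvSum {P Q : List (O × A) → ℝ} (hP : IsObsProcess H P)
    (hQ : IsObsProcess H Q) {C : ℝ} (hC : 0 ≤ C) {core : Fin r → List (O × A)}
    {X : Matrix (Fin r) (Test O A n) ℝ} (hX : IsPredictor H Q n h C core X) {g : ℕ}
    (hg : H = g + (n + 1)) {w : ℕ} (hw : w = n ∧ h ≤ g ∨ w = n + 1 ∧ h < g) (π : Policy O A) :
    (listSum h fun c => actWeight π [] c * predErr P Q core X w c) ≤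
      (C * (Fintype.card A : ℝ) ^ (n + 1) + 1) * (Fintype.card A : ℝ) ^ (n + 1) *
        tvSum H n g P Q π := by
  have hA : (1 : ℝ) ≤ Fintype.card A := by exact_mod_cast Fintype.card_pos (α := A)
  have hT : 0 ≤ tvSum H n g P Q π := Finset.sum_nonneg fun _ _ => tvDist_nonneg _ _ _
  have hpow : (Fintype.card A : ℝ) ^ n ≤ (Fintype.card A : ℝ) ^ (n + 1) :=
    pow_le_pow_right₀ hA (by omega)
  have hpow1 : (Fintype.card A : ℝ) ≤ (Fintype.card A : ℝ) ^ (n + 1) := by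
    simpa using pow_le_pow_right₀ hA (show 1 ≤ n + 1 by omega)
  set a := (Fintype.card A : ℝ) ^ (n + 1) with ha
  have hs := fun h (hh : h ≤ g) =>
    (stateErr_le_tvSum hP.toIsConsistent hQ.toIsConsistent π hg h hh).trans
      (mul_le_mul_of_nonneg_right hpow1 hT)
  rcases hw with ⟨rfl, hh⟩ | ⟨rfl, hh⟩
  · refine (listSum_predErr_le hQ hX (by omega) π).trans ?_
    rw [mul_assoc]
    refine mul_le_mul ?_ (hs h hh) ?_ (by positivity)
    · nlinarith
    · exact listSum_nonneg fun _ _ => mul_nonneg (actWeight_nonneg _ _ _)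
        (Finset.sum_nonneg fun _ _ => abs_nonneg _)
  · refine (listSum_predErr_succ_le hQ hC hX (by omega) π).trans ?_
    have h1 := mul_le_mul_of_nonneg_left (hs h hh.le) (show 0 ≤ a * C by positivity)
    have h2 := hs (h + 1) hh
    linarith

end Explore

/-! ### The sum of the prediction errors -/

section Potential

variable {O A : Type*} [Fintype O] [Fintype A] [Nonempty A] {H n h r : ℕ}

/-- The functional that maps the coordinates of a predictive state of `P` to the error of the
prediction of the test `t` by `Q`. The coordinates are those with respect to the core histories
of `P`, so their bounds involve the core matrix but not the size of the features. -/
noncomputable def errFunctional (P Q : List (O × A) → ℝ) {r r' : ℕ}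
    (core : Fin r → List (O × A)) (core' : Fin r' → List (O × A))
    (X' : Matrix (Fin r') (Test O A n) ℝ) {w : ℕ} (t : Test O A w) : Fin r → ℝ := fun i =>
  predict Q core' X' (fun u => P (core i ++ testList u) / P (core i)) (testList t) -
    P (core i ++ testList t) / P (core i)

variable {P : List (O × A) → ℝ} {C : ℝ} {core : Fin r → List (O × A)}
  {X : Matrix (Fin r) (Test O A n) ℝ}

lemma errFunctional_dotProduct (hX : IsPredictor H P n h C core X) (hh : h + (n + 1) ≤ H)
    (Q : List (O × A) → ℝ) {r' : ℕ} (core' : Fin r' → List (O × A))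
    (X' : Matrix (Fin r') (Test O A n) ℝ) {w : ℕ} (hw : h + w < H) (t : Test O A w)
    (c : List (O × A)) (hc : c.length = h) :
    errFunctional P Q core core' X' t ⬝ᵥ X.mulVec (predState P n c) =
      predict Q core' X' (predState P n c) (testList t) - P (c ++ testList t) := by
  have h1 : predState P n c = fun u => ∑ i, X.mulVec (predState P n c) i *
      (P (core i ++ testList u) / P (core i)) := by
    funext u
    rw [predState, ← hX.predict_eq c hc (testList u) (by simp [testList]) (by simp; omega)]
    rfl
  conv_rhs => rw [h1, predict_sum_smul, ← hX.predict_eq c hc (testList t) (by simp [testList])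
    (by simp; omega)]
  rw [predict, ← Finset.sum_sub_distrib]
  simp only [dotProduct, errFunctional]
  exact Finset.sum_congr rfl fun i _ => by ring

lemma sum_abs_predState (hP : IsObsProcess H P) (c : List (O × A)) (hc : c.length + n < H) :
    ∑ u, |predState P n c u| = (Fintype.card A : ℝ) ^ n * P c := by
  rw [← hP.sum_testList n c hc]
  exact Finset.sum_congr rfl fun u _ => abs_of_nonneg (hP.nonneg _)

lemma sum_abs_errFunctional_le (hP : IsObsProcess H P) (hX : IsPredictor H P n h C core X)
    (hC : 0 ≤ C) {Q : List (O × A) → ℝ} (hQ : IsObsProcess H Q) {r' : ℕ}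
    {core' : Fin r' → List (O × A)} {X' : Matrix (Fin r') (Test O A n) ℝ}
    (hX' : IsPredictor H Q n h C core' X') (hh : h + (n + 1) ≤ H) {w : ℕ} (hw : h + w < H)
    (hwn : w ≤ n + 1) (i : Fin r) :
    ∑ t : Test O A w, |errFunctional P Q core core' X' t i| ≤
      (C * (Fintype.card A : ℝ) ^ (n + 1) + 1) * (Fintype.card A : ℝ) ^ (n + 1) := by
  have hA : (1 : ℝ) ≤ Fintype.card A := by exact_mod_cast Fintype.card_pos (α := A)
  have hpow : (Fintype.card A : ℝ) ^ n ≤ (Fintype.card A : ℝ) ^ (n + 1) :=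
    pow_le_pow_right₀ hA (by omega)
  have hpoww : (Fintype.card A : ℝ) ^ w ≤ (Fintype.card A : ℝ) ^ (n + 1) :=
    pow_le_pow_right₀ hA hwn
  have hratio : ∀ k, h + k < H → ∑ u : Test O A k, |P (core i ++ testList u) / P (core i)| ≤
      (Fintype.card A : ℝ) ^ k := by
    intro k hk
    have : ∑ u : Test O A k, |P (core i ++ testList u) / P (core i)| =
        (∑ u : Test O A k, P (core i ++ testList u)) / P (core i) := by
      rw [Finset.sum_div]
      exact Finset.sum_congr rfl fun u _ =>
        abs_of_nonneg (div_nonneg (hP.nonneg _) (hP.nonneg _))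
    rw [this, hP.sum_testList k (core i) (by rw [hX.length_core]; exact hk), mul_div_assoc]
    exact mul_le_of_le_one_right (by positivity) (div_self_le_one _)
  have h1 := hX'.sum_abs_predict_testList_le hQ w hw
    fun u => P (core i ++ testList u) / P (core i)
  have h2 : ∑ t : Test O A w, |errFunctional P Q core core' X' t i| ≤
      ∑ t : Test O A w, |predict Q core' X' (fun u => P (core i ++ testList u) / P (core i))
        (testList t)| + ∑ t : Test O A w, |P (core i ++ testList t) / P (core i)| := by
    rw [← Finset.sum_add_distrib]
    exact Finset.sum_le_sum fun t _ => abs_sub _ _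
  refine h2.trans ((add_le_add h1 (hratio w hw)).trans ?_)
  have h3 := mul_le_mul_of_nonneg_left (hratio n (by omega)) hC
  set a := (Fintype.card A : ℝ) ^ (n + 1)
  have h4 : (Fintype.card A : ℝ) ^ w * (C * ∑ u : Test O A n,
      |P (core i ++ testList u) / P (core i)|) ≤ a * (C * a) :=
    mul_le_mul hpoww (h3.trans (mul_le_mul_of_nonneg_left hpow hC))
      (mul_nonneg hC (Finset.sum_nonneg fun _ _ => abs_nonneg _)) (by positivity)
  linarith

/-- Prediction errors that are small on the histories generated by the earlier policies are
small on those of the current policy, in most rounds. -/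
theorem sum_predErr_le (hP : IsObsProcess H P) (hX : IsPredictor H P n h C core X)
    (hC : 0 ≤ C) {K d : ℕ} (hK : 0 < K) (hr : r ≤ d) (hd : 0 < d) (π : ℕ → Policy O A)
    (Q : ℕ → List (O × A) → ℝ) (hQ : ∀ k < K, IsObsProcess H (Q k)) {r' : ℕ → ℕ}
    (core' : ∀ k, Fin (r' k) → List (O × A)) (X' : ∀ k, Matrix (Fin (r' k)) (Test O A n) ℝ)
    (hX' : ∀ k < K, IsPredictor H (Q k) n h C (core' k) (X' k)) (hh : h + (n + 1) ≤ H) {w : ℕ}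
    (hw : h + w < H) (hwn : w ≤ n + 1) {G : ℝ} (hG0 : 0 ≤ G)
    (hG : ∀ k < K, ∑ j ∈ Finset.range k, (listSum h fun c => actWeight (π j) [] c *
      predErr P (Q k) (core' k) (X' k) w c) ≤
        (C * (Fintype.card A : ℝ) ^ (n + 1) + 1) * (Fintype.card A : ℝ) ^ (n + 1) * G) :
    ∑ k ∈ Finset.range K, (listSum h fun c => actWeight (π k) [] c *
      predErr P (Q k) (core' k) (X' k) w c) ≤
      2 * ((C * (Fintype.card A : ℝ) ^ (n + 1) + 1) * (Fintype.card A : ℝ) ^ (n + 1) *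
        (G + d + C * (Fintype.card A : ℝ) ^ (n + 1))) *
        (d * Real.log (d + K * (C * (Fintype.card A : ℝ) ^ (n + 1)))) := by
  have hA : (1 : ℝ) ≤ Fintype.card A := by exact_mod_cast Fintype.card_pos (α := A)
  have hpow : (Fintype.card A : ℝ) ^ n ≤ (Fintype.card A : ℝ) ^ (n + 1) :=
    pow_le_pow_right₀ hA (by omega)
  set a := (Fintype.card A : ℝ) ^ (n + 1) with ha
  have ha0 : 0 < a := by positivity
  set b := (C * a + 1) * a with hb
  have hb0 : 0 ≤ b := by positivity
  -- coordinates of the predictive states of `P`, weighted by the policies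
  let x : ℕ → (Fin h → O × A) → Fin r → ℝ := fun j τ =>
    actWeight (π j) [] (List.ofFn τ) • X.mulVec (predState P n (List.ofFn τ))
  let v : ℕ → Test O A w → Fin r → ℝ := fun k t => errFunctional P (Q k) core (core' k) (X' k) t
  have hE : ∀ j k, (listSum h fun c => actWeight (π j) [] c *
      predErr P (Q k) (core' k) (X' k) w c) = ∑ t, ∑ τ, |v k t ⬝ᵥ x j τ| := by
    intro j k
    rw [← sum_ofFn_eq_listSum, Finset.sum_comm]
    refine Finset.sum_congr rfl fun τ _ => ?_
    rw [predErr, Finset.mul_sum]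
    refine Finset.sum_congr rfl fun t _ => ?_
    simp only [v, x]
    rw [dotProduct_smul, errFunctional_dotProduct hX hh (Q k) (core' k) (X' k) hw t _
      List.length_ofFn, smul_eq_mul, abs_mul, abs_of_nonneg (actWeight_nonneg _ _ _)]
  have hx : ∀ k < K, ∑ τ, ∑ i, |x k τ i| ≤ C * a := by
    intro k _
    have h1 : ∀ τ : Fin h → O × A, ∑ i, |x k τ i| ≤ C * a *
        (actWeight (π k) [] (List.ofFn τ) * P (List.ofFn τ)) := by
      intro τ
      have h2 := hX.norm_le (predState P n (List.ofFn τ))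
      rw [sum_abs_predState hP _ (by simp; omega)] at h2
      have h3 : ∑ i, |x k τ i| = actWeight (π k) [] (List.ofFn τ) *
          ∑ i, |X.mulVec (predState P n (List.ofFn τ)) i| := by
        rw [Finset.mul_sum]
        refine Finset.sum_congr rfl fun i _ => ?_
        simp only [x, Pi.smul_apply, smul_eq_mul, abs_mul, abs_of_nonneg (actWeight_nonneg _ _ _)]
      rw [h3]
      refine (mul_le_mul_of_nonneg_left h2 (actWeight_nonneg _ _ _)).trans ?_
      have h4 := mul_le_mul_of_nonneg_right hpow (mul_nonneg hC (mul_nonneg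
        (actWeight_nonneg (π k) [] (List.ofFn τ)) (hP.nonneg (List.ofFn τ))))
      linarith
    refine (Finset.sum_le_sum fun τ _ => h1 τ).trans ?_
    rw [← Finset.mul_sum, sum_ofFn_eq_listSum h fun l => actWeight (π k) [] l * P l]
    have := hP.listSum_actWeight (π k) h [] [] (by simp; omega)
    simp only [List.nil_append, hP.nil] at this
    rw [this, mul_one]
  have hv : ∀ k < K, ∀ i, ∑ t, |v k t i| ≤ b := fun k hk i =>
    sum_abs_errFunctional_le hP hX hC (hQ k hk) (hX' k hk) hh hw hwn i
  have hvd : ∀ k < K, ∑ t, ∑ i, |v k t i| ≤ b * d := by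
    intro k hk
    rw [Finset.sum_comm]
    refine (Finset.sum_le_sum fun i _ => hv k hk i).trans ?_
    rw [Finset.sum_const, Finset.card_univ, Fintype.card_fin, nsmul_eq_mul, mul_comm]
    exact mul_le_mul_of_nonneg_left (by exact_mod_cast hr) hb0
  have key := sum_dotProduct_le_log hK x v (G := b * (G + d + C * a)) (R := C * a)
    (fun k hk => by
      have h1 := hvd k hk
      have h2 := hG k hk
      simp only [hE] at h2
      have h3 : 0 ≤ b * (C * a) := by positivity
      linarith)
    (fun k hk => by
      have h1 : ∀ t τ, |v k t ⬝ᵥ x k τ| ≤ ∑ i, |v k t i| * |x k τ i| := fun t τ =>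
        (Finset.abs_sum_le_sum_abs _ _).trans (le_of_eq (Finset.sum_congr rfl fun i _ =>
          abs_mul _ _))
      have h2 : ∑ t, ∑ τ, |v k t ⬝ᵥ x k τ| ≤ ∑ τ, ∑ i, b * |x k τ i| := by
        refine (Finset.sum_le_sum fun t _ => Finset.sum_le_sum fun τ _ => h1 t τ).trans ?_
        rw [Finset.sum_comm]
        refine Finset.sum_le_sum fun τ _ => ?_
        rw [Finset.sum_comm]
        refine Finset.sum_le_sum fun i _ => ?_
        rw [← Finset.sum_mul]
        exact mul_le_mul_of_nonneg_right (hv k hk i) (abs_nonneg _)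
      simp only [← Finset.mul_sum] at h2
      have h3 := mul_le_mul_of_nonneg_left (hx k hk) hb0
      have h4 : 0 ≤ b * (G + d) := by positivity
      linarith) hx
  simp only [hE]
  refine key.trans (mul_le_mul_of_nonneg_left ?_ (by positivity))
  have hd1 : (1 : ℝ) ≤ d := by exact_mod_cast hd
  have hKa : 0 ≤ K * (C * a) := by positivity
  rcases Nat.eq_zero_or_pos r with h0 | h0
  · rw [h0, Nat.cast_zero, zero_mul]
    exact mul_nonneg (by positivity) (Real.log_nonneg (by linarith))
  · have hr1 : (1 : ℝ) ≤ r := by exact_mod_cast h0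
    have hrd : (r : ℝ) ≤ d := by exact_mod_cast hr
    exact mul_le_mul hrd (Real.log_le_log (by linarith) (by linarith))
      (Real.log_nonneg (by linarith)) (by positivity)

/-- If each model `Q k` is close to `P` under the earlier exploration policies, then the models
are close to `P` under the current policies, on average. -/
theorem sum_tvDist_le {d : ℕ} (hP : IsObsProcess H P) (hC : 0 ≤ C) {g : ℕ} (hg : H = g + (n + 1))
    (hPX : ∀ h ≤ g, ∃ (r : ℕ) (core : Fin r → List (O × A)) (X : Matrix (Fin r) (Test O A n) ℝ),
      r ≤ d ∧ IsPredictor H P n h C core X)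
    {K : ℕ} (hK : 0 < K) (hd : 0 < d) (π : ℕ → Policy O A) (Q : ℕ → List (O × A) → ℝ)
    (hQ : ∀ k < K, IsObsProcess H (Q k))
    (hQX : ∀ k < K, ∀ h ≤ g, ∃ (r : ℕ) (core : Fin r → List (O × A))
      (X : Matrix (Fin r) (Test O A n) ℝ), r ≤ d ∧ IsPredictor H (Q k) n h C core X)
    {G : ℝ} (hG0 : 0 ≤ G)
    (hG : ∀ k < K, ∑ j ∈ Finset.range k, tvSum H n g P (Q k) (π j) ≤ G) :
    ∑ k ∈ Finset.range K, tvDist H P (Q k) (π k) ≤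
      2 * (C * (H + 1) + 1) * ((C * (Fintype.card A : ℝ) ^ (n + 1) + 1) *
        (Fintype.card A : ℝ) ^ (n + 1) * (G + d + C * (Fintype.card A : ℝ) ^ (n + 1) + 2)) *
        (d * Real.log (d + K * (C * (Fintype.card A : ℝ) ^ (n + 1) + 1))) := by
  have hA : (1 : ℝ) ≤ Fintype.card A := by exact_mod_cast Fintype.card_pos (α := A)
  have hpow : (Fintype.card A : ℝ) ^ n ≤ (Fintype.card A : ℝ) ^ (n + 1) :=
    pow_le_pow_right₀ hA (by omega)
  have hpow1 : (Fintype.card A : ℝ) ≤ (Fintype.card A : ℝ) ^ (n + 1) := by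
    simpa using pow_le_pow_right₀ hA (show 1 ≤ n + 1 by omega)
  have hchoice : ∀ k h, ∃ (r : ℕ) (core : Fin r → List (O × A))
      (X : Matrix (Fin r) (Test O A n) ℝ),
      k < K → h ≤ g → r ≤ d ∧ IsPredictor H (Q k) n h C core X := by
    intro k h
    by_cases hkh : k < K ∧ h ≤ g
    · obtain ⟨r, core, X, hX⟩ := hQX k hkh.1 h hkh.2
      exact ⟨r, core, X, fun _ _ => hX⟩
    · exact ⟨0, Fin.elim0, 0, fun h1 h2 => (hkh ⟨h1, h2⟩).elim⟩
  choose r' core' X' hX' using hchoice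
  set a := (Fintype.card A : ℝ) ^ (n + 1) with ha
  have ha1 : 1 ≤ a := hA.trans hpow1
  set b := (C * a + 1) * a with hb
  have hd1 : (1 : ℝ) ≤ d := by exact_mod_cast hd
  have hK1 : (1 : ℝ) ≤ K := by exact_mod_cast hK
  have hCa : 0 ≤ C * a := by positivity
  have hb0 : 0 ≤ b := by positivity
  have hab : a ≤ b := by nlinarith
  set L := Real.log (d + K * (C * a + 1)) with hL
  set B := b * (G + d + C * a + 2) with hB
  have hKCa : 0 ≤ K * (C * a) := by positivity
  have hL0 : 0 ≤ L := Real.log_nonneg (by nlinarith)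
  -- the prediction errors at step `h`
  have hpred : ∀ (h w : ℕ), (w = n ∧ h ≤ g ∨ w = n + 1 ∧ h < g) →
      ∑ k ∈ Finset.range K, (listSum h fun c => actWeight (π k) [] c *
        predErr P (Q k) (core' k h) (X' k h) w c) ≤ 2 * B * (d * L) := by
    intro h w hw
    have hhg : h ≤ g := by omega
    obtain ⟨r, core, X, hr, hX⟩ := hPX h hhg
    refine (sum_predErr_le hP hX hC hK hr hd π Q hQ (fun k => core' k h) (fun k => X' k h)
      (fun k hk => (hX' k h hk hhg).2) (by omega) (w := w) (by omega) (by omega) hG0 ?_).trans ?_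
    · intro k hk
      refine (Finset.sum_le_sum fun j _ => listSum_predErr_le_tvSum hP (hQ k hk) hC
        (hX' k h hk hhg).2 hg hw (π j)).trans ?_
      rw [← Finset.mul_sum]
      exact mul_le_mul_of_nonneg_left (hG k hk) hb0
    · refine mul_le_mul ?_ ?_ ?_ ?_
      · rw [hB]
        have : 0 ≤ b * 2 := by positivity
        nlinarith
      · refine mul_le_mul_of_nonneg_left (Real.log_le_log (by positivity) ?_) (by positivity)
        nlinarith
      · exact mul_nonneg (by positivity) (Real.log_nonneg (by linarith))
      · positivity
  -- the error of the initial predictive state does not depend on the policy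
  have hinit : ∑ k ∈ Finset.range K, ∑ u : Test O A n, |Q k (testList u) - P (testList u)| ≤
      2 * B * (d * L) := by
    -- the potential argument in dimension one gives the sum over the rounds
    let e : ℕ → ℝ := fun k => ∑ u : Test O A n, |Q k (testList u) - P (testList u)|
    have he0 : ∀ k, 0 ≤ e k := fun k => Finset.sum_nonneg fun _ _ => abs_nonneg _
    have he1 : ∀ k < K, ∀ j, e k ≤ a * tvSum H n g P (Q k) (π j) := by
      intro k hk j
      have h1 := stateErr_le_tvSum hP.toIsConsistent (hQ k hk).toIsConsistent (π j) hg 0 (by omega)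
      have h2 : stateErr P (Q k) n (π j) 0 = e k := by
        simp [stateErr, listSum, actWeight, e]
      rw [h2] at h1
      exact h1.trans (mul_le_mul_of_nonneg_right hpow1
        (Finset.sum_nonneg fun _ _ => tvDist_nonneg _ _ _))
    have he2 : ∀ k < K, e k ≤ 2 * a := by
      intro k hk
      have h1 := (hQ k hk).sum_testList n [] (by simp; omega)
      have h2 := hP.sum_testList n [] (by simp; omega)
      simp only [List.nil_append, (hQ k hk).nil, hP.nil, mul_one] at h1 h2
      have h3 : e k ≤ ∑ u : Test O A n, (Q k (testList u) + P (testList u)) := by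
        refine Finset.sum_le_sum fun u _ => (abs_sub _ _).trans (le_of_eq ?_)
        rw [abs_of_nonneg ((hQ k hk).nonneg _), abs_of_nonneg (hP.nonneg _)]
      rw [Finset.sum_add_distrib, h1, h2] at h3
      linarith
    have he3 : ∀ k < K, ∑ _j ∈ Finset.range k, e k ≤ a * G := by
      intro k hk
      refine (Finset.sum_le_sum fun j _ => he1 k hk j).trans ?_
      rw [← Finset.mul_sum]
      exact mul_le_mul_of_nonneg_left (hG k hk) (by positivity)
    have key := sum_dotProduct_le_log (T := Unit) (Λ := Unit) (r := 1) hK (fun _ _ _ => 1)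
      (fun k _ _ => e k) (G := a * (G + 2)) (R := 1)
      (fun k hk => by
        simp only [Finset.univ_unique, Finset.sum_singleton, dotProduct, mul_one,
          abs_of_nonneg (he0 k)]
        linarith [he2 k hk, he3 k hk])
      (fun k hk => by
        simp only [Finset.univ_unique, Finset.sum_singleton, dotProduct, mul_one,
          abs_of_nonneg (he0 k)]
        have : 0 ≤ a * G := by positivity
        linarith [he2 k hk])
      (fun k hk => by simp)
    simp only [Finset.univ_unique, Finset.sum_singleton, dotProduct, mul_one, Nat.cast_one,
      one_mul, abs_of_nonneg (he0 _)] at key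
    refine key.trans (mul_le_mul ?_ ?_ (Real.log_nonneg (by linarith)) (by positivity))
    · have h1 : a * (G + 2) ≤ b * (G + 2) := mul_le_mul_of_nonneg_right hab (by linarith)
      have h2 : 0 ≤ b * (d + C * a) := by positivity
      rw [hB]
      linarith
    · have h1 : Real.log (1 + K) ≤ L := Real.log_le_log (by positivity) (by nlinarith)
      have h2 : L ≤ d * L := le_mul_of_one_le_left hL0 hd1
      linarith
  have hsum : ∑ k ∈ Finset.range K, tvDist H P (Q k) (π k) ≤
      C * (2 * B * (d * L)) + ∑ _h ∈ Finset.range g, C * (2 * B * (d * L)) +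
        2 * B * (d * L) := by
    refine (Finset.sum_le_sum fun k hk => listSum_abs_sub_le_predErr (C := C) (core := core' k)
      (X := X' k) hP (hQ k (Finset.mem_range.1 hk))
      (fun h hh => (hX' k h (Finset.mem_range.1 hk) (by omega)).2) g hg (π k)).trans ?_
    rw [Finset.sum_add_distrib, Finset.sum_add_distrib, ← Finset.mul_sum,
      Finset.sum_comm (s := Finset.range K) (t := Finset.range g)]
    refine add_le_add (add_le_add (mul_le_mul_of_nonneg_left hinit hC) ?_)
      (hpred g n (Or.inl ⟨rfl, le_rfl⟩))
    refine Finset.sum_le_sum fun h hh => ?_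
    rw [← Finset.mul_sum]
    exact mul_le_mul_of_nonneg_left (hpred h (n + 1) (Or.inr ⟨rfl, Finset.mem_range.1 hh⟩)) hC
  refine hsum.trans ?_
  rw [Finset.sum_const, Finset.card_range, nsmul_eq_mul]
  have hgH : (g : ℝ) ≤ H := by exact_mod_cast (by omega : g ≤ H)
  have hX0 : 0 ≤ C * (2 * B * (d * L)) := by positivity
  have := mul_le_mul_of_nonneg_right hgH hX0
  nlinarith

end Potential

/-! ### Supermartingales along the rounds -/

section Rounds

variable {X : Type*} [Fintype X]

/-- The product of the factors `φ D ρ` along a list, `D` being the elements before `ρ`. -/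
def chainProd (φ : List X → X → ℝ) : List X → List X → ℝ
  | _, [] => 1
  | D, ρ :: l => φ D ρ * chainProd φ (D ++ [ρ]) l

lemma chainProd_ofFn (φ : List X → X → ℝ) {n : ℕ} (D : List X) (ω : Fin n → X) :
    chainProd φ D (List.ofFn ω) = ∏ j : Fin n, φ (D ++ (List.ofFn ω).take j) (ω j) := by
  induction n generalizing D with
  | zero => simp [chainProd]
  | succ n ih =>
    rw [List.ofFn_succ, chainProd, ih, Fin.prod_univ_succ]
    simp

lemma listSum_chainProd_le_one {φ : List X → X → ℝ} (h0 : ∀ D ρ, 0 ≤ φ D ρ)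
    (h1 : ∀ D, ∑ ρ, φ D ρ ≤ 1) (n : ℕ) (D : List X) : listSum n (chainProd φ D) ≤ 1 := by
  induction n generalizing D with
  | zero => exact le_rfl
  | succ n ih =>
    refine le_trans ?_ (h1 D)
    refine Finset.sum_le_sum fun ρ _ => ?_
    simp only [chainProd]
    rw [listSum_mul_left]
    exact mul_le_of_le_one_right (h0 _ _) (ih _)

lemma listSum_chainProd_eq_one {φ : List X → X → ℝ} (h1 : ∀ D, ∑ ρ, φ D ρ = 1) (n : ℕ)
    (D : List X) : listSum n (chainProd φ D) = 1 := by
  induction n generalizing D with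
  | zero => rfl
  | succ n ih =>
    rw [← h1 D]
    refine Finset.sum_congr rfl fun ρ _ => ?_
    simp only [chainProd]
    rw [listSum_mul_left, ih, mul_one]

end Rounds

section Concentration

open scoped Classical

variable {S O A : Type*} [Fintype S] [Fintype O] [Fintype A] [Nonempty A] {H m d K : ℕ}

/-- The rounds before round `k`. -/
def before (K k : ℕ) : Finset (Fin K) := Finset.univ.filter fun j => (j : ℕ) < k

lemma sum_before {k : ℕ} (hk : k ≤ K) (F : ℕ → ℝ) :
    ∑ j ∈ before K k, F j = ∑ j ∈ Finset.range k, F j := by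
  refine Finset.sum_bij (fun j _ => (j : ℕ)) ?_ ?_ ?_ ?_
  · intro j hj
    simpa [before] using hj
  · intro a _ b _ h
    exact Fin.ext h
  · intro b hb
    have := Finset.mem_range.1 hb
    exact ⟨⟨b, by omega⟩, by simpa [before] using this, rfl⟩
  · intros; rfl

lemma POMDP.IsValid.trajProb_nonneg {M : POMDP S O A H} (hM : M.IsValid) (π : Policy O A)
    (τ : Traj O A H) : 0 ≤ M.trajProb π τ := by
  rw [M.trajProb_eq]
  exact mul_nonneg (hM.isObsProcess.nonneg _) (actWeight_nonneg _ _ _)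

lemma POMDP.IsValid.sum_trajProb {M : POMDP S O A H} (hM : M.IsValid) (π : Policy O A) :
    ∑ τ : Traj O A H, M.trajProb π τ = 1 := by
  have h1 := hM.isObsProcess.listSum_actWeight π H [] [] (by simp)
  simp only [List.nil_append, hM.isObsProcess.nil] at h1
  rw [← h1, ← sum_ofFn_eq_listSum]
  exact Finset.sum_congr rfl fun τ _ => by rw [M.trajProb_eq, mul_comm]

lemma sum_prod_rounds (F : Fin (H - m + 1) × (Fin (m - 1) → A) → Traj O A H → ℝ) :
    ∑ ρ : RoundData O A H m, ∏ x, F x (ρ x) = ∏ x, ∑ τ, F x τ := by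
  rw [Finset.prod_univ_sum, Fintype.piFinset_univ]

lemma sum_runProb {M : POMDP S O A H} (hM : M.IsValid) (plan : Planner S O A H m d) (K : ℕ) :
    ∑ ω : Fin K → RoundData O A H m, runProb M plan ω = 1 := by
  rw [← listSum_chainProd_eq_one (X := RoundData O A H m)
    (φ := fun D ρ => ∏ x, M.trajProb (roundPolicy plan D x) (ρ x)) (fun D => by
      rw [sum_prod_rounds fun x τ => M.trajProb (roundPolicy plan D x) τ]
      exact Finset.prod_eq_one fun x _ => hM.sum_trajProb _) K [], ← sum_ofFn_eq_listSum]
  refine Finset.sum_congr rfl fun ω _ => ?_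
  rw [chainProd_ofFn]
  rfl

lemma runProb_nonneg {M : POMDP S O A H} (hM : M.IsValid) (plan : Planner S O A H m d)
    (ω : Fin K → RoundData O A H m) : 0 ≤ runProb M plan ω :=
  Finset.prod_nonneg fun _ _ => Finset.prod_nonneg fun _ _ => hM.trajProb_nonneg _ _

/-- The product over the episodes before round `k` of weights `W` of the executed policy and the
observed trajectory. -/
noncomputable def dataProd (plan : Planner S O A H m d) (W : Policy O A → Traj O A H → ℝ)
    (ω : Fin K → RoundData O A H m) (k : ℕ) : ℝ :=
  ∏ j ∈ before K k, ∏ x, W (roundPolicy plan (prefixRounds ω j) x) (ω j x)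

lemma dataProd_nonneg (plan : Planner S O A H m d) {W : Policy O A → Traj O A H → ℝ}
    (hW : ∀ π τ, 0 ≤ W π τ) (ω : Fin K → RoundData O A H m) (k : ℕ) :
    0 ≤ dataProd plan W ω k :=
  Finset.prod_nonneg fun _ _ => Finset.prod_nonneg fun _ _ => hW _ _

/-- Weights of expectation at most one under every policy have products of expectation at most
one, although the policies depend on the earlier rounds. -/
theorem sum_runProb_mul_dataProd_le {M : POMDP S O A H} (hM : M.IsValid)
    (plan : Planner S O A H m d) {W : Policy O A → Traj O A H → ℝ} (hW0 : ∀ π τ, 0 ≤ W π τ)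
    (hW : ∀ π, ∑ τ, M.trajProb π τ * W π τ ≤ 1) (k : ℕ) :
    ∑ ω : Fin K → RoundData O A H m, runProb M plan ω * dataProd plan W ω k ≤ 1 := by
  -- law of the next round, weighted by `W` as long as it is one of the first `k` rounds
  let φ : List (RoundData O A H m) → RoundData O A H m → ℝ := fun D ρ =>
    ∏ x, M.trajProb (roundPolicy plan D x) (ρ x) *
      if D.length < k then W (roundPolicy plan D x) (ρ x) else 1
  have hW0' : ∀ D : List (RoundData O A H m), ∀ x τ,
      0 ≤ if D.length < k then W (roundPolicy plan D x) τ else 1 := by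
    intro D x τ
    split_ifs
    exacts [hW0 _ _, zero_le_one]
  have h0 : ∀ D ρ, 0 ≤ φ D ρ := fun D ρ => Finset.prod_nonneg fun x _ =>
    mul_nonneg (hM.trajProb_nonneg _ _) (hW0' _ _ _)
  have h1 : ∀ D, ∑ ρ, φ D ρ ≤ 1 := by
    intro D
    rw [sum_prod_rounds fun x τ => M.trajProb (roundPolicy plan D x) τ *
      if D.length < k then W (roundPolicy plan D x) τ else 1]
    refine Finset.prod_le_one (fun x _ => Finset.sum_nonneg fun τ _ =>
      mul_nonneg (hM.trajProb_nonneg _ _) (hW0' _ _ _)) fun x _ => ?_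
    split_ifs
    · exact hW _
    · simp [hM.sum_trajProb]
  refine le_trans (le_of_eq ?_) (listSum_chainProd_le_one h0 h1 K [])
  rw [← sum_ofFn_eq_listSum]
  refine Finset.sum_congr rfl fun ω _ => ?_
  rw [chainProd_ofFn, runProb, dataProd, before, Finset.prod_filter, ← Finset.prod_mul_distrib]
  refine Finset.prod_congr rfl fun j _ => ?_
  have hlen : ((List.ofFn ω).take j).length = j := by simp
  simp only [φ, List.nil_append, hlen, Finset.prod_mul_distrib]
  split_ifs
  · rfl
  · simp only [Finset.prod_const_one, mul_one]
    rfl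

/-- Markov's inequality and a union bound. -/
lemma one_sub_le_sum_of_expectation_le {Ω ι : Type*} [Fintype Ω] [Fintype ι] {p : Ω → ℝ}
    (hp0 : ∀ ω, 0 ≤ p ω) (hp : ∑ ω, p ω = 1) {Z : ι → Ω → ℝ} (hZ0 : ∀ i ω, 0 ≤ Z i ω)
    (hZ : ∀ i, ∑ ω, p ω * Z i ω ≤ 1) {T : ℝ} (hT : 0 < T) (G : Ω → Prop)
    (hG : ∀ ω, 0 < p ω → (∀ i, Z i ω ≤ T) → G ω) :
    1 - Fintype.card ι / T ≤ ∑ ω, if G ω then p ω else 0 := by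
  have h1 : ∀ ω, p ω - (∑ i, p ω * Z i ω) / T ≤ if G ω then p ω else 0 := by
    intro ω
    have hnn : ∀ i, 0 ≤ p ω * Z i ω := fun i => mul_nonneg (hp0 ω) (hZ0 i ω)
    have hs : 0 ≤ (∑ i, p ω * Z i ω) / T := div_nonneg (Finset.sum_nonneg fun i _ => hnn i) hT.le
    split_ifs with hg
    · linarith
    · rcases (hp0 ω).eq_or_lt with h0 | h0
      · linarith
      · have : ∃ i, T < Z i ω := by
          by_contra hne
          push Not at hne
          exact hg (hG ω h0 hne)
        obtain ⟨i, hi⟩ := this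
        have h2 : p ω * Z i ω ≤ ∑ i, p ω * Z i ω :=
          Finset.single_le_sum (fun i _ => hnn i) (Finset.mem_univ i)
        have h3 : p ω ≤ (∑ i, p ω * Z i ω) / T := by
          rw [le_div_iff₀ hT]
          exact (mul_le_mul_of_nonneg_left hi.le h0.le).trans h2
        linarith
  refine le_trans ?_ (Finset.sum_le_sum fun ω _ => h1 ω)
  rw [Finset.sum_sub_distrib, hp, ← Finset.sum_div, Finset.sum_comm]
  have h4 : ∑ i, ∑ ω, p ω * Z i ω ≤ Fintype.card ι := by
    refine (Finset.sum_le_sum fun i _ => hZ i).trans (le_of_eq ?_)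
    simp
  have := div_le_div_of_nonneg_right h4 hT.le
  linarith

/-! ### Likelihoods and confidence sets -/

lemma log_ofReal_prod {ι : Type*} (s : Finset ι) (v : ι → ℝ) (hv : ∀ i, 0 ≤ v i) :
    ENNReal.log (ENNReal.ofReal (∏ i ∈ s, v i)) = ∑ i ∈ s, ENNReal.log (ENNReal.ofReal (v i)) := by
  induction s using Finset.induction_on with
  | empty => simp
  | insert i s hi ih =>
    rw [Finset.prod_insert hi, Finset.sum_insert hi, ENNReal.ofReal_mul (hv i),
      ENNReal.log_mul_add, ih]

/-- The likelihood of the data set is the product over the episodes. -/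
lemma logLik_prefixRounds (plan : Planner S O A H m d) (f : LowRankModel S O A H d)
    (hf : f.toPOMDP.IsValid) (ω : Fin K → RoundData O A H m) (k : ℕ) (hk : k ≤ K) :
    logLik plan f (prefixRounds ω k) =
      ENNReal.log (ENNReal.ofReal (dataProd plan f.toPOMDP.trajProb ω k)) := by
  have hnn := fun π τ => hf.trajProb_nonneg π τ
  rw [dataProd, log_ofReal_prod _ _ fun j => Finset.prod_nonneg fun x _ => hnn _ _]
  rw [logLik]
  have hlen : (prefixRounds ω k).length = k := by simp [prefixRounds, hk]
  refine Finset.sum_bij (fun i _ => (⟨i, by omega⟩ : Fin K)) ?_ ?_ ?_ ?_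
  · intro i _
    simp only [before, Finset.mem_filter, Finset.mem_univ, true_and]
    omega
  · intro a _ b _ h
    exact Fin.ext (Fin.mk.inj_iff.1 h)
  · intro b hb
    simp only [before, Finset.mem_filter, Finset.mem_univ, true_and] at hb
    exact ⟨⟨b, by omega⟩, Finset.mem_univ _, rfl⟩
  · intro i _
    have h1 : (prefixRounds ω k).take i = prefixRounds ω i := by
      have := i.2
      simp only [prefixRounds, List.take_take]
      congr 1
      omega
    have h2 : (prefixRounds ω k).get i = ω ⟨i, by omega⟩ := by
      rw [List.get_eq_getElem]
      simp [prefixRounds]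
    rw [h1, h2, log_ofReal_prod _ _ fun x => hnn _ _]

/-- There are `n` functions of mass at most `1 + ε` such that the laws of the trajectory of every
model are bounded above by one of them. Lower brackets are not needed. -/
def HasUpperBracket (F : Set (LowRankModel S O A H d)) (ε : ℝ) (n : ℕ) : Prop :=
  ∃ g : Fin n → Policy O A → Traj O A H → ℝ,
    (∀ i π τ, 0 ≤ g i π τ) ∧ (∀ i π, ∑ τ, g i π τ ≤ 1 + ε) ∧
    ∀ f ∈ F, ∃ i, ∀ π τ, f.toPOMDP.trajProb π τ ≤ g i π τ

lemma HasBracket.hasUpperBracket {F : Set (LowRankModel S O A H d)} {ε : ℝ} (hε : 0 ≤ ε) {n : ℕ}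
    (hF : ∀ f ∈ F, f.toPOMDP.IsValid) (h : HasBracket F ε n) : HasUpperBracket F ε n := by
  obtain ⟨g₁, g₂, hg, hcov⟩ := h
  -- brackets that contain no model are replaced by zero
  let good : Fin n → Prop := fun i => ∃ f ∈ F, ∀ π τ,
    g₁ i π τ ≤ f.toPOMDP.trajProb π τ ∧ f.toPOMDP.trajProb π τ ≤ g₂ i π τ
  refine ⟨fun i π τ => if good i then g₂ i π τ else 0, ?_, ?_, ?_⟩
  · intro i π τ
    dsimp only
    split_ifs with hi
    · obtain ⟨f, hf, hb⟩ := hi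
      exact ((hF f hf).trajProb_nonneg π τ).trans (hb π τ).2
    · exact le_rfl
  · intro i π
    dsimp only
    split_ifs with hi
    · obtain ⟨f, hf, hb⟩ := hi
      rw [← (hF f hf).sum_trajProb π]
      refine le_trans ?_ (add_le_add_right (hg i π) _)
      rw [← Finset.sum_add_distrib]
      refine Finset.sum_le_sum fun τ _ => ?_
      have := neg_abs_le (g₁ i π τ - g₂ i π τ)
      linarith [(hb π τ).1]
    · simp; linarith
  · intro f hf
    obtain ⟨i, hi⟩ := hcov f hf
    refine ⟨i, fun π τ => ?_⟩
    dsimp only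
    rw [if_pos ⟨f, hf, hi⟩]
    exact (hi π τ).2

/-- The squared Hellinger distance of two nonnegative weights on trajectories. -/
noncomputable def hellingerSq (p q : Traj O A H → ℝ) : ℝ := ∑ τ, (√(p τ) - √(q τ)) ^ 2

lemma sum_sqrt_mul_sqrt {p q : Traj O A H → ℝ} (hp : ∀ τ, 0 ≤ p τ) (hq : ∀ τ, 0 ≤ q τ) :
    2 * ∑ τ, √(p τ) * √(q τ) = ∑ τ, p τ + ∑ τ, q τ - hellingerSq p q := by
  rw [hellingerSq, Finset.mul_sum, ← Finset.sum_add_distrib, ← Finset.sum_sub_distrib]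
  refine Finset.sum_congr rfl fun τ _ => ?_
  nlinarith [Real.sq_sqrt (hp τ), Real.sq_sqrt (hq τ)]

/-- The Cauchy-Schwarz bound of the `ℓ¹` distance by the Hellinger distance. -/
lemma sum_abs_sub_sq_le {p q : Traj O A H → ℝ} (hp : ∀ τ, 0 ≤ p τ) (hq : ∀ τ, 0 ≤ q τ) :
    (∑ τ, |p τ - q τ|) ^ 2 ≤ 2 * (∑ τ, p τ + ∑ τ, q τ) * hellingerSq p q := by
  have h1 : ∑ τ, |p τ - q τ| = ∑ τ, (√(p τ) + √(q τ)) * |√(p τ) - √(q τ)| := by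
    refine Finset.sum_congr rfl fun τ _ => ?_
    rw [← abs_of_nonneg (add_nonneg (Real.sqrt_nonneg (p τ)) (Real.sqrt_nonneg (q τ))),
      ← abs_mul]
    congr 1
    nlinarith [Real.sq_sqrt (hp τ), Real.sq_sqrt (hq τ)]
  rw [h1]
  refine (Finset.sum_mul_sq_le_sq_mul_sq _ _ _).trans ?_
  simp only [sq_abs]
  refine mul_le_mul_of_nonneg_right ?_ (Finset.sum_nonneg fun _ _ => sq_nonneg _)
  rw [← Finset.sum_add_distrib, Finset.mul_sum]
  refine Finset.sum_le_sum fun τ _ => ?_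
  nlinarith [Real.sq_sqrt (hp τ), Real.sq_sqrt (hq τ), sq_nonneg (√(p τ) - √(q τ))]

/-- The weight whose products control the likelihood ratios. Where `P` vanishes it is zero, which
is harmless as such trajectories do not occur. -/
noncomputable def ratioWeight (P g : Policy O A → Traj O A H → ℝ) (ε : ℝ) (π : Policy O A)
    (τ : Traj O A H) : ℝ := g π τ / P π τ / (1 + ε)

/-- The weight whose products control the Hellinger distances by the likelihood ratios. -/
noncomputable def hellWeight (P g : Policy O A → Traj O A H → ℝ) (ε : ℝ) (π : Policy O A)
    (τ : Traj O A H) : ℝ :=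
  √(g π τ / P π τ) * Real.exp ((hellingerSq (g π) (P π) - ε) / 2)

lemma sum_mul_ratioWeight_le {P g : Policy O A → Traj O A H → ℝ} {ε : ℝ} (hε : 0 ≤ ε)
    (hP : ∀ π τ, 0 ≤ P π τ) (hg : ∀ π τ, 0 ≤ g π τ) (π : Policy O A)
    (hgs : ∑ τ, g π τ ≤ 1 + ε) : ∑ τ, P π τ * ratioWeight P g ε π τ ≤ 1 := by
  have h1 : ∀ τ, P π τ * ratioWeight P g ε π τ ≤ g π τ / (1 + ε) := by
    intro τ
    rw [ratioWeight]
    rcases (hP π τ).eq_or_lt with h0 | h0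
    · rw [← h0, zero_mul]
      exact div_nonneg (hg _ _) (by linarith)
    · apply le_of_eq
      field_simp
  refine (Finset.sum_le_sum fun τ _ => h1 τ).trans ?_
  rw [← Finset.sum_div, div_le_one (by linarith)]
  exact hgs

lemma sum_mul_hellWeight_le {P g : Policy O A → Traj O A H → ℝ} {ε : ℝ}
    (hP : ∀ π τ, 0 ≤ P π τ) (hg : ∀ π τ, 0 ≤ g π τ) (π : Policy O A) (hPs : ∑ τ, P π τ = 1)
    (hgs : ∑ τ, g π τ ≤ 1 + ε) : ∑ τ, P π τ * hellWeight P g ε π τ ≤ 1 := by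
  have h1 : ∀ τ, P π τ * hellWeight P g ε π τ =
      √(g π τ) * √(P π τ) * Real.exp ((hellingerSq (g π) (P π) - ε) / 2) := by
    intro τ
    rw [hellWeight, ← mul_assoc]
    congr 1
    rcases (hP π τ).eq_or_lt with h0 | h0
    · rw [← h0]; simp
    · rw [Real.sqrt_div (hg π τ)]
      have h2 := Real.sq_sqrt (hP π τ)
      have h3 : √(P π τ) ≠ 0 := (Real.sqrt_pos.2 h0).ne'
      field_simp
      rw [h2]; ring
  simp only [h1]
  rw [← Finset.sum_mul]
  have h2 := sum_sqrt_mul_sqrt (hg π) (hP π)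
  rw [hPs] at h2
  have h3 : ∑ τ, √(g π τ) * √(P π τ) ≤ Real.exp (-((hellingerSq (g π) (P π) - ε) / 2)) := by
    have := Real.add_one_le_exp (-((hellingerSq (g π) (P π) - ε) / 2))
    linarith
  refine (mul_le_mul_of_nonneg_right h3 (Real.exp_pos _).le).trans (le_of_eq ?_)
  rw [← Real.exp_add]
  simp

/-- The confidence set in terms of likelihoods. The positivity excludes the value `-∞` of the
log-likelihood of `f₀`. -/
lemma mem_confSet_of_forall_le {plan : Planner S O A H m d} {F : Set (LowRankModel S O A H d)}
    (hF : ∀ f ∈ F, f.toPOMDP.IsValid) {f₀ : LowRankModel S O A H d} (hf₀ : f₀ ∈ F) {β : ℝ}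
    {ω : Fin K → RoundData O A H m} {k : ℕ} (hk : k ≤ K)
    (hpos : 0 < dataProd plan f₀.toPOMDP.trajProb ω k)
    (h : ∀ f ∈ F, dataProd plan f.toPOMDP.trajProb ω k ≤
      Real.exp β * dataProd plan f₀.toPOMDP.trajProb ω k) :
    f₀ ∈ confSet plan F β (prefixRounds ω k) := by
  refine ⟨hf₀, EReal.sub_le_of_le_add ?_⟩
  refine iSup₂_le fun f hf => ?_
  rw [logLik_prefixRounds plan f (hF f hf) ω k hk, logLik_prefixRounds plan f₀ (hF f₀ hf₀) ω k hk,
    ENNReal.log_ofReal_of_pos hpos, ← EReal.coe_add]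
  have h1 : (Real.log (dataProd plan f₀.toPOMDP.trajProb ω k) + β) =
      Real.log (Real.exp β * dataProd plan f₀.toPOMDP.trajProb ω k) := by
    rw [Real.log_mul (Real.exp_pos _).ne' hpos.ne', Real.log_exp, add_comm]
  rw [h1, ← ENNReal.log_ofReal_of_pos (by positivity)]
  exact ENNReal.log_le_log (ENNReal.ofReal_le_ofReal (h f hf))

lemma dataProd_le_of_mem_confSet {plan : Planner S O A H m d}
    {F : Set (LowRankModel S O A H d)} (hF : ∀ f ∈ F, f.toPOMDP.IsValid)
    {f f₀ : LowRankModel S O A H d} (hf₀ : f₀ ∈ F) {β : ℝ}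
    {ω : Fin K → RoundData O A H m} {k : ℕ} (hk : k ≤ K)
    (hpos : 0 < dataProd plan f₀.toPOMDP.trajProb ω k)
    (h : f ∈ confSet plan F β (prefixRounds ω k)) :
    dataProd plan f₀.toPOMDP.trajProb ω k ≤
      Real.exp β * dataProd plan f.toPOMDP.trajProb ω k := by
  have h1 : logLik plan f₀ (prefixRounds ω k) - (β : EReal) ≤ logLik plan f (prefixRounds ω k) :=
    (EReal.sub_le_sub (le_iSup₂_of_le f₀ hf₀ le_rfl) le_rfl).trans h.2
  rw [logLik_prefixRounds plan f (hF f h.1) ω k hk, logLik_prefixRounds plan f₀ (hF f₀ hf₀) ω k hk,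
    ENNReal.log_ofReal_of_pos hpos, ← EReal.coe_sub, ENNReal.log_ofReal] at h1
  split_ifs at h1 with h0
  · exact absurd h1 (not_le.2 (EReal.bot_lt_coe _))
  · push Not at h0
    rw [EReal.coe_le_coe_iff] at h1
    rw [← Real.log_le_log_iff hpos (by positivity), Real.log_mul (Real.exp_pos _).ne' h0.ne',
      Real.log_exp]
    linarith

end Concentration

/-! ### Maximum likelihood estimation -/

section MaximumLikelihood

open scoped Classical

variable {S O A : Type*} [Fintype S] [Fintype O] [Fintype A] [Nonempty A] {H m d K : ℕ}

lemma tvDist_listProb (M N : POMDP S O A H) (π : Policy O A) :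
    tvDist H M.listProb N.listProb π = ∑ τ : Traj O A H, |N.trajProb π τ - M.trajProb π τ| := by
  rw [tvDist, ← sum_ofFn_eq_listSum]
  refine Finset.sum_congr rfl fun τ _ => ?_
  rw [N.trajProb_eq, M.trajProb_eq, ← sub_mul, abs_mul, abs_of_nonneg (actWeight_nonneg _ _ _),
    mul_comm]

/-- The distance to a model is controlled by the Hellinger distance to its upper bracket. -/
lemma tvDist_sq_le {M N : POMDP S O A H} (hM : M.IsValid) (hN : N.IsValid) (π : Policy O A)
    {g : Traj O A H → ℝ} {ε : ℝ} (hε : 0 ≤ ε) (hε1 : ε ≤ 1)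
    (hNg : ∀ τ, N.trajProb π τ ≤ g τ) (hgs : ∑ τ, g τ ≤ 1 + ε) :
    tvDist H M.listProb N.listProb π ^ 2 ≤ 2 * ε + 12 * hellingerSq g (M.trajProb π) := by
  have hg : ∀ τ, 0 ≤ g τ := fun τ => (hN.trajProb_nonneg π τ).trans (hNg τ)
  have h1 := sum_abs_sub_sq_le hg (hM.trajProb_nonneg π)
  rw [hM.sum_trajProb] at h1
  set e := ∑ τ, |g τ - M.trajProb π τ| with he
  have hh : 0 ≤ hellingerSq g (M.trajProb π) := Finset.sum_nonneg fun _ _ => sq_nonneg _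
  have h2 : tvDist H M.listProb N.listProb π ≤ ε + e := by
    rw [tvDist_listProb]
    have h3 : ∑ τ, (g τ - N.trajProb π τ) ≤ ε := by
      rw [Finset.sum_sub_distrib, hN.sum_trajProb]
      linarith
    refine le_trans ?_ (add_le_add_left h3 e)
    rw [he, ← Finset.sum_add_distrib]
    refine Finset.sum_le_sum fun τ _ => ?_
    have h4 := abs_sub_le (N.trajProb π τ) (g τ) (M.trajProb π τ)
    rw [abs_sub_comm (N.trajProb π τ) (g τ), abs_of_nonneg (sub_nonneg.2 (hNg τ))] at h4
    exact h4
  have h5 : e ^ 2 ≤ 6 * hellingerSq g (M.trajProb π) := by nlinarith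
  have h6 := tvDist_nonneg (H := H) M.listProb N.listProb π
  have h7 : tvDist H M.listProb N.listProb π ^ 2 ≤ (ε + e) ^ 2 := by gcongr
  nlinarith [sq_nonneg (ε - e)]

lemma dataProd_pos {M : POMDP S O A H} (hM : M.IsValid) {plan : Planner S O A H m d}
    {ω : Fin K → RoundData O A H m} (h : 0 < runProb M plan ω) (k : ℕ) :
    0 < dataProd plan M.trajProb ω k := by
  refine Finset.prod_pos fun j _ => Finset.prod_pos fun x _ => ?_
  have h1 := Finset.prod_ne_zero_iff.1 h.ne' j (Finset.mem_univ j)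
  have h2 := Finset.prod_ne_zero_iff.1 h1 x (Finset.mem_univ x)
  exact lt_of_le_of_ne (hM.trajProb_nonneg _ _) h2.symm

lemma dataProd_mono (plan : Planner S O A H m d) {W W' : Policy O A → Traj O A H → ℝ}
    (hW : ∀ π τ, 0 ≤ W π τ) (h : ∀ π τ, W π τ ≤ W' π τ) (ω : Fin K → RoundData O A H m) (k : ℕ) :
    dataProd plan W ω k ≤ dataProd plan W' ω k :=
  Finset.prod_le_prod (fun _ _ => Finset.prod_nonneg fun _ _ => hW _ _) fun _ _ =>
    Finset.prod_le_prod (fun _ _ => hW _ _) fun _ _ => h _ _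

/-- The number of episodes of one round. -/
def roundSize (A : Type*) [Fintype A] (H m : ℕ) : ℕ :=
  (H - m + 1) * Fintype.card A ^ (m - 1)

lemma card_round : Fintype.card (Fin (H - m + 1) × (Fin (m - 1) → A)) = roundSize A H m := by
  simp [roundSize]

/-- The sum of `c` over the episodes before round `k` is at most `1` if `c` times the number of
all the episodes is. -/
lemma sum_const_before_le {c : ℝ} (hc : 0 ≤ c) (hcK : K * roundSize A H m * c ≤ 1) (k : ℕ) :
    ∑ _j ∈ before K k, ∑ _x : Fin (H - m + 1) × (Fin (m - 1) → A), c ≤ 1 := by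
  refine le_trans ?_ hcK
  rw [Finset.sum_const, Finset.sum_const, Finset.card_univ, card_round, nsmul_eq_mul,
    nsmul_eq_mul, ← mul_assoc]
  have : ((before K k).card : ℝ) ≤ K := by
    exact_mod_cast (Finset.card_le_univ _).trans (by simp)
  gcongr

lemma dataProd_le_of_ratioWeight_le {M : POMDP S O A H} {plan : Planner S O A H m d}
    {ω : Fin K → RoundData O A H m} {k : ℕ} (hpos : 0 < dataProd plan M.trajProb ω k)
    {g : Policy O A → Traj O A H → ℝ} {ε T : ℝ} (hε : 0 ≤ ε) (hT : 0 ≤ T)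
    (hεK : K * roundSize A H m * ε ≤ 1)
    (h : dataProd plan (ratioWeight M.trajProb g ε) ω k ≤ T) :
    dataProd plan g ω k ≤ Real.exp 1 * T * dataProd plan M.trajProb ω k := by
  set c := ∏ _j ∈ before K k, ∏ _x : Fin (H - m + 1) × (Fin (m - 1) → A), (1 + ε) with hc
  have hc1 : c ≤ Real.exp 1 := by
    refine le_trans ?_ (Real.exp_le_exp.2 (sum_const_before_le (A := A) (H := H) (m := m)
      hε hεK k))
    rw [Real.exp_sum]
    refine Finset.prod_le_prod (fun _ _ => Finset.prod_nonneg fun _ _ => by linarith)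
      fun _ _ => ?_
    rw [Real.exp_sum]
    refine Finset.prod_le_prod (fun _ _ => by linarith) fun _ _ => ?_
    linarith [Real.add_one_le_exp ε]
  have hc0 : 0 < c := Finset.prod_pos fun _ _ => Finset.prod_pos fun _ _ => by linarith
  have h1 : dataProd plan (ratioWeight M.trajProb g ε) ω k =
      dataProd plan g ω k / dataProd plan M.trajProb ω k / c := by
    simp only [dataProd, ratioWeight, Finset.prod_div_distrib, hc]
  rw [h1, div_le_iff₀ hc0, div_le_iff₀ hpos] at h
  refine h.trans ?_
  have : T * c ≤ Real.exp 1 * T := by nlinarith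
  exact mul_le_mul_of_nonneg_right this hpos.le

/-- A bracket of a model in the confidence set is close to the truth on the executed policies: the
likelihood ratio in the square of the product of the weights is at least `exp (-β)`. -/
lemma sum_hellingerSq_le {M : POMDP S O A H} (hM : M.IsValid) {plan : Planner S O A H m d}
    {ω : Fin K → RoundData O A H m} {k : ℕ} (hpos : 0 < dataProd plan M.trajProb ω k)
    {g : Policy O A → Traj O A H → ℝ} (hg : ∀ π τ, 0 ≤ g π τ) {ε T β : ℝ} (hε : 0 ≤ ε)
    (hT : 0 < T) (hεK : K * roundSize A H m * ε ≤ 1)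
    (h : dataProd plan (hellWeight M.trajProb g ε) ω k ≤ T)
    (hβ : dataProd plan M.trajProb ω k ≤ Real.exp β * dataProd plan g ω k) :
    ∑ j ∈ before K k, ∑ x, hellingerSq (g (roundPolicy plan (prefixRounds ω j) x))
      (M.trajProb (roundPolicy plan (prefixRounds ω j) x)) ≤ 2 * Real.log T + β + 1 := by
  set s := ∑ j ∈ before K k, ∑ x, hellingerSq (g (roundPolicy plan (prefixRounds ω j) x))
      (M.trajProb (roundPolicy plan (prefixRounds ω j) x)) with hs
  set c := ∑ _j ∈ before K k, ∑ _x : Fin (H - m + 1) × (Fin (m - 1) → A), ε with hc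
  have hc1 : c ≤ 1 := sum_const_before_le hε hεK k
  have h1 : dataProd plan (hellWeight M.trajProb g ε) ω k ^ 2 =
      dataProd plan g ω k / dataProd plan M.trajProb ω k * Real.exp (s - c) := by
    have h2 : ∀ π τ, hellWeight M.trajProb g ε π τ ^ 2 =
        g π τ / M.trajProb π τ * Real.exp (hellingerSq (g π) (M.trajProb π) - ε) := by
      intro π τ
      rw [hellWeight, mul_pow, Real.sq_sqrt (div_nonneg (hg _ _) (hM.trajProb_nonneg _ _)),
        ← Real.exp_nat_mul]
      congr 2
      push_cast
      ring
    rw [hs, hc, ← Finset.sum_sub_distrib, Real.exp_sum]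
    simp only [dataProd, ← Finset.prod_pow, h2, ← Finset.sum_sub_distrib, Real.exp_sum,
      Finset.prod_mul_distrib, Finset.prod_div_distrib]
  have h3 : dataProd plan g ω k / dataProd plan M.trajProb ω k * Real.exp (s - c) ≤ T ^ 2 := by
    rw [← h1]
    refine pow_le_pow_left₀ (dataProd_nonneg plan (fun π τ => ?_) ω k) h 2
    exact mul_nonneg (Real.sqrt_nonneg _) (Real.exp_pos _).le
  have h4 : Real.exp (-β) ≤ dataProd plan g ω k / dataProd plan M.trajProb ω k := by
    rw [le_div_iff₀ hpos, Real.exp_neg, inv_mul_le_iff₀ (Real.exp_pos _)]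
    exact hβ
  have h5 : Real.exp (-β + (s - c)) ≤ T ^ 2 := by
    rw [Real.exp_add]
    exact (mul_le_mul_of_nonneg_right h4 (Real.exp_pos _).le).trans h3
  have h6 := (Real.le_log_iff_exp_le (by positivity)).2 h5
  rw [Real.log_pow] at h6
  push_cast at h6
  linarith

/-- The data of the rounds are typical: before each round the true model belongs to the
confidence set, and all the models of the confidence set are close to it on the executed
policies. -/
def IsTypical (F : Set (LowRankModel S O A H d)) (fstar : LowRankModel S O A H d)
    (plan : Planner S O A H m d) (β b : ℝ) (ω : Fin K → RoundData O A H m) : Prop :=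
  ∀ k < K, fstar ∈ confSet plan F β (prefixRounds ω k) ∧
    ∀ f ∈ confSet plan F β (prefixRounds ω k), ∑ j ∈ before K k, ∑ x,
      tvDist H fstar.toPOMDP.listProb f.toPOMDP.listProb
        (roundPolicy plan (prefixRounds ω j) x) ^ 2 ≤ b

/-- Maximum likelihood estimation: with high probability the data are typical, by Markov's
inequality for the two weights of each of the `N` brackets and each of the `K` rounds. -/
theorem one_sub_le_sum_isTypical {F : Set (LowRankModel S O A H d)}
    {fstar : LowRankModel S O A H d} (hF : ∀ f ∈ F, f.toPOMDP.IsValid) (hstar : fstar ∈ F)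
    (plan : Planner S O A H m d) {N : ℕ} {ε T β δ : ℝ} (hε : 0 ≤ ε) (hε1 : ε ≤ 1)
    (hN : HasUpperBracket F ε N) (hεK : K * roundSize A H m * ε ≤ 1) (hT : 0 < T)
    (hδ : 2 * N * K ≤ δ * T) (hβ : Real.exp 1 * T ≤ Real.exp β) :
    1 - δ ≤ ∑ ω : Fin K → RoundData O A H m,
      if IsTypical F fstar plan β (12 * (2 * Real.log T + β + 1) + 2) ω
        then runProb fstar.toPOMDP plan ω else 0 := by
  obtain ⟨g, hg0, hgs, hgF⟩ := hN
  have hM := hF fstar hstar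
  let M := fstar.toPOMDP
  let W : Bool → Fin N → Policy O A → Traj O A H → ℝ := fun c i =>
    if c then ratioWeight M.trajProb (g i) ε else hellWeight M.trajProb (g i) ε
  have hW0 : ∀ c i π τ, 0 ≤ W c i π τ := by
    intro c i π τ
    cases c
    · exact mul_nonneg (Real.sqrt_nonneg _) (Real.exp_pos _).le
    · exact div_nonneg (div_nonneg (hg0 _ _ _) (hM.trajProb_nonneg _ _)) (by linarith)
  have hW : ∀ c i π, ∑ τ, M.trajProb π τ * W c i π τ ≤ 1 := by
    intro c i π
    cases c
    · exact sum_mul_hellWeight_le hM.trajProb_nonneg (hg0 i) π (hM.sum_trajProb π) (hgs i π)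
    · exact sum_mul_ratioWeight_le hε hM.trajProb_nonneg (hg0 i) π (hgs i π)
  have key := one_sub_le_sum_of_expectation_le (Ω := Fin K → RoundData O A H m)
    (ι := Bool × Fin N × Fin K) (runProb_nonneg hM plan) (sum_runProb hM plan K)
    (Z := fun p ω => dataProd plan (W p.1 p.2.1) ω p.2.2)
    (fun p ω => dataProd_nonneg plan (hW0 _ _) ω _)
    (fun p => sum_runProb_mul_dataProd_le hM plan (hW0 _ _) (hW _ _) _) hT
    (IsTypical F fstar plan β (12 * (2 * Real.log T + β + 1) + 2)) ?_
  · refine le_trans ?_ key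
    have : (Fintype.card (Bool × Fin N × Fin K) : ℝ) / T ≤ δ := by
      rw [div_le_iff₀ hT]
      refine le_trans (le_of_eq ?_) hδ
      simp
      ring
    linarith
  · intro ω hω hZ k hk
    have hpos := dataProd_pos hM hω k
    constructor
    · refine mem_confSet_of_forall_le hF hstar hk.le hpos fun f hf => ?_
      obtain ⟨i, hi⟩ := hgF f hf
      have h1 := dataProd_mono plan (hF f hf).trajProb_nonneg hi ω k
      have h2 := dataProd_le_of_ratioWeight_le hpos hε hT.le hεK (hZ (true, i, ⟨k, hk⟩))
      refine h1.trans (h2.trans ?_)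
      exact mul_le_mul_of_nonneg_right hβ hpos.le
    · intro f hf
      obtain ⟨i, hi⟩ := hgF f hf.1
      have h1 := dataProd_mono plan (hF f hf.1).trajProb_nonneg hi ω k
      have h2 := dataProd_le_of_mem_confSet hF hstar hk.le hpos hf
      have h3 := sum_hellingerSq_le hM hpos (hg0 i) hε hT hεK (hZ (false, i, ⟨k, hk⟩))
        (h2.trans (mul_le_mul_of_nonneg_left h1 (Real.exp_pos β).le))
      have h4 := sum_const_before_le (A := A) (H := H) (m := m) hε hεK k
      refine (Finset.sum_le_sum fun j _ => Finset.sum_le_sum fun x _ =>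
        tvDist_sq_le hM (hF f hf.1) _ hε hε1 (hi _) (hgs i _)).trans ?_
      simp only [Finset.sum_add_distrib, ← Finset.mul_sum]
      linarith

end MaximumLikelihood

/-! ### Upper brackets from covers -/

section Cover

open scoped Classical

/-- In a proper space the covering number of a bounded set is finite and attained. -/
lemma exists_fin_cover {X : Type*} [PseudoMetricSpace X] [ProperSpace X] [Nonempty X] {C : Set X}
    (hC : Bornology.IsBounded C) {ε : ℝ} (hε : 0 < ε) :
    ∃ c : Fin (coverNum C ε) → X, ∀ x ∈ C, ∃ i, dist x (c i) ≤ ε := by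
  have hε' : ε.toNNReal ≠ 0 := (Real.toNNReal_pos.2 hε).ne'
  obtain ⟨D, -, hDfin, hD⟩ := Metric.exists_finite_isCover_of_isCompact_closure hε'
    hC.isCompact_closure
  have hlt : Metric.externalCoveringNumber ε.toNNReal C ≠ ⊤ := by
    refine ne_top_of_le_ne_top ?_ hD.externalCoveringNumber_le_encard
    exact hDfin.encard_lt_top.ne
  have hn : ((coverNum C ε : ℕ) : ℕ∞) = Metric.externalCoveringNumber ε.toNNReal C :=
    ENat.natCast_toNat hlt
  obtain ⟨D', hD', hcard⟩ : ∃ D', Metric.IsCover ε.toNNReal C D' ∧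
      D'.encard ≤ (coverNum C ε : ℕ∞) := by
    by_contra hne
    push Not at hne
    have h1 : ((coverNum C ε : ℕ) : ℕ∞) + 1 ≤ Metric.externalCoveringNumber ε.toNNReal C :=
      le_iInf₂ fun D' hD' => Order.add_one_le_of_lt (hne D' hD')
    rw [← hn] at h1
    exact absurd h1 (not_le.2 (ENat.lt_add_one_iff (ENat.natCast_ne_top _) |>.2 le_rfl))
  have hfin : D'.Finite := Set.finite_of_encard_le_coe hcard
  obtain ⟨n, e, he⟩ : ∃ (n : ℕ) (e : Fin n ≃ D'), n ≤ coverNum C ε := by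
    have : Fintype D' := hfin.fintype
    refine ⟨Fintype.card D', (Fintype.equivFin D').symm, ?_⟩
    rw [Set.encard_eq_coe_toFinset_card, Set.toFinset_card] at hcard
    exact_mod_cast hcard
  refine ⟨fun i => if h : (i : ℕ) < n then e ⟨i, h⟩ else Classical.arbitrary X, fun x hx => ?_⟩
  rw [Metric.isCover_iff_subset_iUnion_closedBall] at hD'
  obtain ⟨y, hy, hxy⟩ := Set.mem_iUnion₂.1 (hD' hx)
  refine ⟨⟨e.symm ⟨y, hy⟩, (e.symm ⟨y, hy⟩).2.trans_le he⟩, ?_⟩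
  dsimp only
  rw [dif_pos (e.symm ⟨y, hy⟩).2]
  simpa [Real.coe_toNNReal _ hε.le] using hxy

variable {S O A : Type*} [Fintype S] [Fintype O] [Fintype A] {H m d : ℕ}

lemma POMDP.filter_mono {M N : POMDP S O A H} (hM : M.IsValid)
    (hT : ∀ h s a s', M.trans h s a s' ≤ N.trans h s a s')
    (hE : ∀ h s o, M.emit h s o ≤ N.emit h s o) (l : List (O × A)) (h : ℕ) {b b' : S → ℝ}
    (hb : ∀ s, 0 ≤ b s) (hbb : ∀ s, b s ≤ b' s) (s : S) :
    M.filter h b l s ≤ N.filter h b' l s := by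
  have hT' : ∀ h s a s', M.transAt h s a s' ≤ N.transAt h s a s' := by
    intro h s a s'
    unfold transAt
    split_ifs
    exacts [hT _ _ _ _, le_rfl]
  have hE' : ∀ h s o, M.emitAt h s o ≤ N.emitAt h s o := by
    intro h s o
    unfold emitAt
    split_ifs
    exacts [hE _ _ _, le_rfl]
  induction l generalizing h b b' with
  | nil => exact hbb s
  | cons x l ih =>
    refine ih _ (fun s' => Finset.sum_nonneg fun s _ => mul_nonneg (mul_nonneg (hb s)
      (hM.emitAt_nonneg _ _ _)) (hM.transAt_nonneg _ _ _ _)) fun s' => ?_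
    refine Finset.sum_le_sum fun s _ => ?_
    have h1 := hM.emitAt_nonneg h s x.1
    have h2 := hM.transAt_nonneg h s x.2 s'
    exact mul_le_mul (mul_le_mul (hbb s) (hE' _ _ _) h1 ((hb s).trans (hbb s))) (hT' _ _ _ _) h2
      (mul_nonneg ((hb s).trans (hbb s)) (h1.trans (hE' _ _ _)))

/-- The total mass of the trajectories for kernels whose rows sum up to slightly more than `1`. -/
lemma POMDP.listSum_filter_le {N : POMDP S O A H} (hT0 : ∀ h s a s', 0 ≤ N.trans h s a s')
    (hE0 : ∀ h s o, 0 ≤ N.emit h s o) {a b : ℝ} (ha : 0 ≤ a) (hb : 0 ≤ b)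
    (hT : ∀ h s x, ∑ s', N.trans h s x s' ≤ a) (hE : ∀ h s, ∑ o, N.emit h s o ≤ b)
    (π : Policy O A) (k : ℕ) (pre : List (O × A)) (h : ℕ) (v : S → ℝ) (hv : ∀ s, 0 ≤ v s) :
    (listSum k fun l => actWeight π pre l * ∑ s, N.filter h v l s) ≤ (a * b) ^ k * ∑ s, v s := by
  have hT0' : ∀ h s x s', 0 ≤ N.transAt h s x s' := by
    intro h s x s'
    unfold transAt
    split_ifs
    exacts [hT0 _ _ _ _, le_rfl]
  have hE0' : ∀ h s o, 0 ≤ N.emitAt h s o := by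
    intro h s o
    unfold emitAt
    split_ifs
    exacts [hE0 _ _ _, le_rfl]
  have hT' : ∀ h s x, ∑ s', N.transAt h s x s' ≤ a := by
    intro h s x
    by_cases hh : h < H
    · simpa only [transAt, hh, dif_pos] using hT ⟨h, hh⟩ s x
    · simpa [transAt, hh] using ha
  have hE' : ∀ h s, ∑ o, N.emitAt h s o ≤ b := by
    intro h s
    by_cases hh : h < H
    · simpa only [emitAt, hh, dif_pos] using hE ⟨h, hh⟩ s
    · simpa [emitAt, hh] using hb
  induction k generalizing pre h v with
  | zero => simp [listSum, actWeight, POMDP.filter]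
  | succ k ih =>
    have hstep0 : ∀ x s', 0 ≤ N.step h v x s' := fun x s' => Finset.sum_nonneg fun s _ =>
      mul_nonneg (mul_nonneg (hv s) (hE0' _ _ _)) (hT0' _ _ _ _)
    have h1 : ∀ x : O × A, (listSum k fun l => actWeight π pre (x :: l) *
        ∑ s, N.filter h v (x :: l) s) ≤
        (π pre x.1 x.2).toReal * ((a * b) ^ k * ∑ s', N.step h v x s') := by
      intro x
      refine le_trans (le_of_eq ?_) (mul_le_mul_of_nonneg_left
        (ih (pre ++ [x]) (h + 1) (N.step h v x) (hstep0 x)) ENNReal.toReal_nonneg)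
      rw [← listSum_mul_left]
      refine listSum_congr fun l _ => ?_
      simp only [actWeight, POMDP.filter]
      ring
    have h2 : ∀ x : O × A, ∑ s', N.step h v x s' ≤ ∑ s, v s * N.emitAt h s x.1 * a := by
      intro x
      simp only [step]
      rw [Finset.sum_comm]
      refine Finset.sum_le_sum fun s _ => ?_
      rw [← Finset.mul_sum]
      exact mul_le_mul_of_nonneg_left (hT' _ _ _) (mul_nonneg (hv s) (hE0' _ _ _))
    have h3 : ∑ o, ∑ s, v s * N.emitAt h s o * a ≤ a * b * ∑ s, v s := by
      rw [Finset.sum_comm, Finset.mul_sum]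
      refine Finset.sum_le_sum fun s _ => ?_
      rw [← Finset.sum_mul, ← Finset.mul_sum]
      have := mul_le_mul_of_nonneg_left (hE' h s) (mul_nonneg (hv s) ha)
      linarith
    have hab : 0 ≤ (a * b) ^ k := by positivity
    calc listSum (k + 1) (fun l => actWeight π pre l * ∑ s, N.filter h v l s)
        ≤ ∑ x : O × A, (π pre x.1 x.2).toReal *
            ((a * b) ^ k * ∑ s, v s * N.emitAt h s x.1 * a) := by
          refine Finset.sum_le_sum fun x _ => (h1 x).trans ?_
          exact mul_le_mul_of_nonneg_left (mul_le_mul_of_nonneg_left (h2 x) hab)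
            ENNReal.toReal_nonneg
      _ = (a * b) ^ k * ∑ o, ∑ s, v s * N.emitAt h s o * a := by
          rw [Fintype.sum_prod_type, Finset.mul_sum]
          refine Finset.sum_congr rfl fun o _ => ?_
          dsimp only
          rw [← Finset.sum_mul, sum_toReal_pmf, one_mul]
      _ ≤ _ := by
          rw [pow_succ, mul_assoc]
          exact mul_le_mul_of_nonneg_left h3 hab

/-- The kernels of `N` lie above those of `M`, by at most `t`, `e` and `i`. -/
structure POMDP.IsUpper (M N : POMDP S O A H) (t e i : ℝ) : Prop where
  trans_le : ∀ h s a s', M.trans h s a s' ≤ N.trans h s a s'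
  le_trans : ∀ h s a s', N.trans h s a s' ≤ M.trans h s a s' + t
  emit_le : ∀ h s o, M.emit h s o ≤ N.emit h s o
  le_emit : ∀ h s o, N.emit h s o ≤ M.emit h s o + e
  init_le : ∀ s, M.init s ≤ N.init s
  le_init : ∀ s, N.init s ≤ M.init s + i

lemma POMDP.IsUpper.trajProb_le {M N : POMDP S O A H} (hM : M.IsValid) {t e i : ℝ}
    (h : M.IsUpper N t e i) (π : Policy O A) (τ : Traj O A H) :
    M.trajProb π τ ≤ N.trajProb π τ := by
  rw [M.trajProb_eq, N.trajProb_eq]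
  refine mul_le_mul_of_nonneg_right ?_ (actWeight_nonneg _ _ _)
  exact Finset.sum_le_sum fun s _ =>
    filter_mono hM h.trans_le h.emit_le _ 0 hM.init_nonneg h.init_le s

lemma POMDP.IsUpper.sum_trajProb_le {M N : POMDP S O A H} (hM : M.IsValid) {t e i : ℝ}
    (ht : 0 ≤ t) (he : 0 ≤ e) (h : M.IsUpper N t e i) (π : Policy O A) :
    ∑ τ : Traj O A H, N.trajProb π τ ≤ Real.exp (Fintype.card S * i +
      H * (Fintype.card S * t + Fintype.card O * e)) := by
  have h1 := POMDP.listSum_filter_le (N := N)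
    (fun g s a s' => (hM.trans_nonneg g s a s').trans (h.trans_le g s a s'))
    (fun g s o => (hM.emit_nonneg g s o).trans (h.emit_le g s o))
    (a := 1 + Fintype.card S * t) (b := 1 + Fintype.card O * e) (by positivity) (by positivity)
    (fun g s a => by
      refine (Finset.sum_le_sum fun s' _ => h.le_trans g s a s').trans (le_of_eq ?_)
      rw [Finset.sum_add_distrib, hM.trans_sum]
      simp)
    (fun g s => by
      refine (Finset.sum_le_sum fun o _ => h.le_emit g s o).trans (le_of_eq ?_)
      rw [Finset.sum_add_distrib, hM.emit_sum]
      simp) π H [] 0 N.init (fun s => (hM.init_nonneg s).trans (h.init_le s))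
  have h2 : ∑ s, N.init s ≤ 1 + Fintype.card S * i := by
    refine (Finset.sum_le_sum fun s _ => h.le_init s).trans (le_of_eq ?_)
    rw [Finset.sum_add_distrib, hM.init_sum]
    simp
  have h3 : ∑ τ : Traj O A H, N.trajProb π τ =
      listSum H fun l => actWeight π [] l * ∑ s, N.filter 0 N.init l s := by
    rw [← sum_ofFn_eq_listSum]
    refine Finset.sum_congr rfl fun τ _ => ?_
    rw [N.trajProb_eq, mul_comm]
    rfl
  rw [h3]
  refine h1.trans ?_
  rw [Real.exp_add, mul_comm, Real.exp_nat_mul _ H, Real.exp_add]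
  have e1 := Real.add_one_le_exp (Fintype.card S * i)
  have e2 := Real.add_one_le_exp (Fintype.card S * t)
  have e3 := Real.add_one_le_exp (Fintype.card O * e)
  refine mul_le_mul (by linarith) ?_ (by positivity) (Real.exp_pos _).le
  refine pow_le_pow_left₀ (by positivity) ?_ H
  exact mul_le_mul (by linarith) (by linarith) (by positivity) (Real.exp_pos _).le

lemma abs_dotProduct_sub_le {d : ℕ} {u v u' v' : Fin d → ℝ} {B η : ℝ} (hd : 0 < d) (hη : 0 ≤ η)
    (hη1 : η ≤ 1) (hu : ∀ i, |u i| ≤ B) (hv : ∀ i, |v i| ≤ B)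
    (hu' : ∀ i, |u i - u' i| ≤ η / d) (hv' : ∀ i, |v i - v' i| ≤ η / d) :
    |u ⬝ᵥ v - u' ⬝ᵥ v'| ≤ (2 * B + 1) * η := by
  have hd1 : (1 : ℝ) ≤ d := by exact_mod_cast hd
  have hηd : η / d ≤ 1 := (div_le_one (by linarith)).2 (hη1.trans hd1)
  have hηd0 : 0 ≤ η / d := by positivity
  have h1 : ∀ i, |u i * v i - u' i * v' i| ≤ (2 * B + 1) * (η / d) := by
    intro i
    have hB : 0 ≤ B := (abs_nonneg _).trans (hu i)
    have e1 : u i * v i - u' i * v' i =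
        u i * (v i - v' i) + v i * (u i - u' i) - (u i - u' i) * (v i - v' i) := by ring
    rw [e1]
    refine (abs_sub _ _).trans ((add_le_add_left (abs_add_le _ _) _).trans ?_)
    rw [abs_mul, abs_mul, abs_mul]
    have a1 := mul_le_mul (hu i) (hv' i) (abs_nonneg _) hB
    have a2 := mul_le_mul (hv i) (hu' i) (abs_nonneg _) hB
    have a3 := mul_le_mul ((hu' i).trans hηd) (hv' i) (abs_nonneg _) zero_le_one
    linarith
  rw [dotProduct, dotProduct, ← Finset.sum_sub_distrib]
  refine (Finset.abs_sum_le_sum_abs _ _).trans ((Finset.sum_le_sum fun i _ => h1 i).trans ?_)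
  rw [Finset.sum_const, Finset.card_univ, Fintype.card_fin, nsmul_eq_mul]
  apply le_of_eq
  field_simp

lemma HasUpperBracket.of_fintype {F : Set (LowRankModel S O A H d)} {ε : ℝ} {n : ℕ} {ι : Type*}
    [Fintype ι] (hι : Fintype.card ι = n) (g : ι → Policy O A → Traj O A H → ℝ)
    (h0 : ∀ i π τ, 0 ≤ g i π τ) (h1 : ∀ i π, ∑ τ, g i π τ ≤ 1 + ε)
    (h2 : ∀ f ∈ F, ∃ i, ∀ π τ, f.toPOMDP.trajProb π τ ≤ g i π τ) : HasUpperBracket F ε n := by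
  let e := Fintype.equivFinOfCardEq hι
  refine ⟨fun i => g (e.symm i), fun i => h0 _, fun i => h1 _, fun f hf => ?_⟩
  obtain ⟨i, hi⟩ := h2 f hf
  exact ⟨e i, by simpa using hi⟩

/-- Covers of the components of the models provide upper brackets: the kernels of a member of the
product cover, raised by the radius, lie above those of all the models close to it. -/
theorem hasUpperBracket_coverProd {F : Set (LowRankModel S O A H d)} [Nonempty A]
    (hF : ∀ f ∈ F, f.toPOMDP.IsValid) {B : ℝ} (hB : 0 < B) (hFB : ∀ f ∈ F, f.FeaturesBounded B)
    {η : ℝ} (hη : 0 < η) (hη1 : η ≤ 1) (hd : 0 < d) {E : ℝ}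
    (hE : E = Fintype.card S * (2 * η) +
      H * (Fintype.card S * (2 * ((2 * B + 1) * η)) + Fintype.card O * (2 * η))) (hE1 : E ≤ 1) :
    HasUpperBracket F (2 * E) (coverProd F η) := by
  have hd0 : (0 : ℝ) < d := by exact_mod_cast hd
  have hηd : 0 < η / d := by positivity
  have hemit1 : ∀ f ∈ F, ∀ h s o, |f.emit h s o| ≤ 1 := by
    intro f hf h s o
    have h0 : 0 ≤ f.emit h s o := (hF f hf).emit_nonneg h s o
    rw [abs_of_nonneg h0]
    refine le_trans ?_ (le_of_eq ((hF f hf).emit_sum h s))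
    exact Finset.single_le_sum (f := fun o => f.emit h s o)
      (fun o _ => (hF f hf).emit_nonneg h s o) (Finset.mem_univ o)
  have hinit1 : ∀ f ∈ F, ∀ s, |f.init s| ≤ 1 := by
    intro f hf s
    have h0 : 0 ≤ f.init s := (hF f hf).init_nonneg s
    rw [abs_of_nonneg h0]
    refine le_trans ?_ (le_of_eq (hF f hf).init_sum)
    exact Finset.single_le_sum (f := fun s => f.init s)
      (fun s _ => (hF f hf).init_nonneg s) (Finset.mem_univ s)
  obtain ⟨c₁, hc₁⟩ := exists_fin_cover (C := (fun f : LowRankModel S O A H d => f.feat) '' F)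
    ((isBounded_iff_forall_norm_le).2 ⟨B, by
      rintro _ ⟨f, hf, rfl⟩
      simp only [pi_norm_le_iff_of_nonneg hB.le, Real.norm_eq_abs]
      exact (hFB f hf).1⟩) hηd
  obtain ⟨c₂, hc₂⟩ := exists_fin_cover (C := (fun f : LowRankModel S O A H d => f.cofeat) '' F)
    ((isBounded_iff_forall_norm_le).2 ⟨B, by
      rintro _ ⟨f, hf, rfl⟩
      simp only [pi_norm_le_iff_of_nonneg hB.le, Real.norm_eq_abs]
      exact (hFB f hf).2⟩) hηd
  obtain ⟨c₃, hc₃⟩ := exists_fin_cover (C := (fun f : LowRankModel S O A H d => f.emit) '' F)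
    ((isBounded_iff_forall_norm_le).2 ⟨1, by
      rintro _ ⟨f, hf, rfl⟩
      simp only [pi_norm_le_iff_of_nonneg zero_le_one, Real.norm_eq_abs]
      exact hemit1 f hf⟩) hη
  obtain ⟨c₄, hc₄⟩ := exists_fin_cover (C := (fun f : LowRankModel S O A H d => f.init) '' F)
    ((isBounded_iff_forall_norm_le).2 ⟨1, by
      rintro _ ⟨f, hf, rfl⟩
      simp only [pi_norm_le_iff_of_nonneg zero_le_one, Real.norm_eq_abs]
      exact hinit1 f hf⟩) hη
  let ι := Fin (coverFeat F (η / d)) × Fin (coverCofeat F (η / d)) × Fin (coverEmit F η) ×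
    Fin (coverInit F η)
  let N : ι → POMDP S O A H := fun i =>
    { trans := fun h s a s' => c₂ i.2.1 h s' ⬝ᵥ c₁ i.1 h s a + (2 * B + 1) * η
      emit := fun h s o => c₃ i.2.2.1 h s o + η
      init := fun s => c₄ i.2.2.2 s + η }
  -- members of the product cover that are not close to a model are replaced by zero
  let good : ι → Prop := fun i => ∃ f ∈ F,
    f.toPOMDP.IsUpper (N i) (2 * ((2 * B + 1) * η)) (2 * η) (2 * η)
  refine HasUpperBracket.of_fintype (ι := ι) (by simp [ι, coverProd, mul_assoc])
    (fun i π τ => if good i then (N i).trajProb π τ else 0) ?_ ?_ ?_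
  · intro i π τ
    split_ifs with hi
    · obtain ⟨f, hf, hi⟩ := hi
      exact ((hF f hf).trajProb_nonneg π τ).trans (hi.trajProb_le (hF f hf) π τ)
    · exact le_rfl
  · intro i π
    have hE0 : 0 ≤ E := by rw [hE]; positivity
    split_ifs with hi
    · obtain ⟨f, hf, hi⟩ := hi
      refine (hi.sum_trajProb_le (hF f hf) (by positivity) (by positivity) π).trans ?_
      rw [← hE]
      have := Real.abs_exp_sub_one_le (x := E) (by rw [abs_of_nonneg hE0]; exact hE1)
      rw [abs_of_nonneg hE0] at this
      linarith [le_abs_self (Real.exp E - 1)]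
    · simp
      linarith
  · intro f hf
    obtain ⟨i₁, h₁⟩ := hc₁ _ ⟨f, hf, rfl⟩
    obtain ⟨i₂, h₂⟩ := hc₂ _ ⟨f, hf, rfl⟩
    obtain ⟨i₃, h₃⟩ := hc₃ _ ⟨f, hf, rfl⟩
    obtain ⟨i₄, h₄⟩ := hc₄ _ ⟨f, hf, rfl⟩
    simp only [dist_pi_le_iff hηd.le, dist_pi_le_iff hη.le, Real.dist_eq] at h₁ h₂ h₃ h₄
    have hup : f.toPOMDP.IsUpper (N (i₁, i₂, i₃, i₄)) (2 * ((2 * B + 1) * η)) (2 * η)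
        (2 * η) := by
      have htr : ∀ h s a s', |f.cofeat h s' ⬝ᵥ f.feat h s a - c₂ i₂ h s' ⬝ᵥ c₁ i₁ h s a| ≤
          (2 * B + 1) * η := fun h s a s' => abs_dotProduct_sub_le hd hη.le hη1
        ((hFB f hf).2 h s') ((hFB f hf).1 h s a) (h₂ h s') (h₁ h s a)
      constructor
      · intro h s a s'
        have := abs_le.1 (htr h s a s')
        simp only [LowRankModel.toPOMDP, N]
        linarith
      · intro h s a s'
        have := abs_le.1 (htr h s a s')
        simp only [LowRankModel.toPOMDP, N]
        linarith
      · intro h s o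
        have := abs_le.1 (h₃ h s o)
        simp only [LowRankModel.toPOMDP, N]
        linarith
      · intro h s o
        have := abs_le.1 (h₃ h s o)
        simp only [LowRankModel.toPOMDP, N]
        linarith
      · intro s
        have := abs_le.1 (h₄ s)
        simp only [LowRankModel.toPOMDP, N]
        linarith
      · intro s
        have := abs_le.1 (h₄ s)
        simp only [LowRankModel.toPOMDP, N]
        linarith
    refine ⟨(i₁, i₂, i₃, i₄), fun π τ => ?_⟩
    rw [if_pos ⟨f, hf, hup⟩]
    exact hup.trajProb_le (hF f hf) π τ

end Cover

/-! ### Numerical estimates -/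

section Numerics

/-- A number of rounds that is polynomial up to logarithms suffices. The logarithm of `K` is
absorbed through `log K ≤ 8 v + 2 ℓ` with `v = (K ε²)^(1/8)`, and `3888 = 48 * 9 ^ 2`. -/
lemma rounds_suffice {q ℓ ε K : ℝ} (hq : 1 ≤ q) (hε : 0 < ε) (hℓ : ℓ = Real.log (1 + 1 / ε))
    (hK : 1 ≤ K) (h : 3888 ^ 4 * q ^ 40 * (1 + ℓ) ^ 8 ≤ K * ε ^ 2) :
    48 * q ^ 10 * (1 + Real.log K) ^ 2 * √K ≤ K * ε := by
  have hℓ0 : 0 ≤ ℓ := by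
    rw [hℓ]
    exact Real.log_nonneg (by have : 0 < 1 / ε := by positivity
                              linarith)
  set s := √K * ε with hs
  have hK0 : 0 < √K := Real.sqrt_pos.2 (by linarith)
  have hs0 : 0 < s := by positivity
  have hKK : √K ^ 2 = K := Real.sq_sqrt (by linarith)
  have hs2 : s ^ 2 = K * ε ^ 2 := by rw [hs, mul_pow, hKK]
  set u := √s with hu
  have hu2 : u ^ 2 = s := Real.sq_sqrt hs0.le
  have hu0 : 0 < u := Real.sqrt_pos.2 hs0
  set v := √u with hv
  have hv2 : v ^ 2 = u := Real.sq_sqrt hu0.le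
  have hv0 : 0 < v := Real.sqrt_pos.2 hu0
  set U := 3888 * q ^ 10 * (1 + ℓ) ^ 2 with hU
  have hU1 : 1 ≤ U := by
    have h1 : 1 ≤ q ^ 10 := one_le_pow₀ hq
    have h2 : 1 ≤ (1 + ℓ) ^ 2 := one_le_pow₀ (by linarith)
    nlinarith
  have hUu : U ≤ u := by
    have h1 : U ^ 4 ≤ u ^ 4 := by
      have e1 : u ^ 4 = K * ε ^ 2 := by rw [← hs2, ← hu2]; ring
      have e2 : U ^ 4 = 3888 ^ 4 * q ^ 40 * (1 + ℓ) ^ 8 := by rw [hU]; ring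
      rw [e1, e2]
      exact h
    exact le_of_pow_le_pow_left₀ (by norm_num) hu0.le h1
  have hv1 : 1 ≤ v := by
    rw [hv, Real.one_le_sqrt]
    linarith
  have hlogK : Real.log K ≤ 8 * v + 2 * ℓ := by
    have e1 : K = s ^ 2 * (1 / ε) ^ 2 := by
      rw [hs2]
      field_simp
    have e2 : Real.log K = 2 * Real.log s + 2 * Real.log (1 / ε) := by
      rw [e1, Real.log_mul (by positivity) (by positivity), Real.log_pow, Real.log_pow]
      push_cast
      ring
    have e3 : Real.log s = 4 * Real.log v := by
      rw [← hu2, ← hv2, ← pow_mul, Real.log_pow]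
      push_cast
      ring
    have e4 : Real.log (1 / ε) ≤ ℓ := by
      rw [hℓ]
      exact Real.log_le_log (by positivity) (by linarith)
    have e5 : Real.log v ≤ v - 1 := Real.log_le_sub_one_of_pos hv0
    rw [e2, e3]
    linarith
  have hlog0 : 0 ≤ Real.log K := Real.log_nonneg hK
  have hlam : 1 + Real.log K ≤ 9 * v * (1 + ℓ) := by
    have : ℓ ≤ v * ℓ := le_mul_of_one_le_left hℓ0 hv1
    nlinarith
  have hlam2 : (1 + Real.log K) ^ 2 ≤ 81 * u * (1 + ℓ) ^ 2 := by
    have h1 := pow_le_pow_left₀ (by linarith) hlam 2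
    have h2 : (9 * v * (1 + ℓ)) ^ 2 = 81 * u * (1 + ℓ) ^ 2 := by rw [← hv2]; ring
    rwa [h2] at h1
  have hfin : 48 * q ^ 10 * (1 + Real.log K) ^ 2 ≤ s := by
    have hq10 : 0 ≤ 48 * q ^ 10 := by positivity
    have h1 := mul_le_mul_of_nonneg_left hlam2 hq10
    have h2 : 48 * q ^ 10 * (81 * u * (1 + ℓ) ^ 2) = U * u := by rw [hU]; ring
    rw [h2] at h1
    have h3 := mul_le_mul_of_nonneg_right hUu hu0.le
    nlinarith
  have h4 := mul_le_mul_of_nonneg_right hfin hK0.le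
  have h5 : s * √K = K * ε := by rw [hs]; nlinarith
  linarith

/-- The bound for the sum of the errors in terms of the single quantity `q`. -/
lemma regret_bound_le {q d a C H K G b rs : ℝ} (hq : d + a + C + H + 3 ≤ q) (hd : 1 ≤ d)
    (ha : 1 ≤ a) (hC : 0 ≤ C) (hH : 1 ≤ H) (hK : 1 ≤ K) (hb : b ≤ 120 * (q * (1 + Real.log K)))
    (hb0 : 0 ≤ b) (hrs : rs ≤ H * a) (hG : G = √(K * (rs * b))) :
    H * (2 * (C * (H + 1) + 1) * ((C * a + 1) * a * (G + d + C * a + 2)) *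
      (d * Real.log (d + K * (C * a + 1)))) ≤ 48 * q ^ 10 * (1 + Real.log K) ^ 2 * √K := by
  have hq1 : 1 ≤ q := by linarith
  have hlogK := Real.log_nonneg hK
  set lam := 1 + Real.log K with hlam
  have hlam1 : 1 ≤ lam := by linarith
  have hK0 : 0 ≤ √K := Real.sqrt_nonneg _
  have hK1 : 1 ≤ √K := Real.one_le_sqrt.2 hK
  have hCa : C * a + d + 2 ≤ q ^ 2 := by nlinarith
  have hCa0 : 0 ≤ C * a := by positivity
  have hHa : H * a ≤ q ^ 2 := by nlinarith
  have hCH : C * (H + 1) + 1 ≤ q ^ 2 := by nlinarith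
  have hG1 : G ≤ 11 * q ^ 2 * lam * √K := by
    rw [hG]
    refine Real.sqrt_le_iff.2 ⟨by positivity, ?_⟩
    have h1 : (11 * q ^ 2 * lam * √K) ^ 2 = 121 * q ^ 4 * lam ^ 2 * K := by
      have : √K ^ 2 = K := Real.sq_sqrt (by linarith)
      calc _ = 121 * q ^ 4 * lam ^ 2 * √K ^ 2 := by ring
        _ = _ := by rw [this]
    rw [h1]
    have h2 : rs * b ≤ q ^ 2 * (120 * (q * lam)) :=
      mul_le_mul (hrs.trans hHa) hb hb0 (by positivity)
    have h3 : q ^ 2 * (120 * (q * lam)) ≤ 121 * q ^ 4 * lam ^ 2 := by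
      have e1 : q ^ 3 ≤ q ^ 4 := pow_le_pow_right₀ hq1 (by norm_num)
      have e2 : lam ≤ lam ^ 2 := by nlinarith
      have e3 : q ^ 3 * lam ≤ q ^ 4 * lam ^ 2 :=
        mul_le_mul e1 e2 (by linarith) (by positivity)
      nlinarith [mul_nonneg (pow_nonneg (zero_le_one.trans hq1) 4) (sq_nonneg lam)]
    nlinarith [h2.trans h3]
  have hG2 : G + d + C * a + 2 ≤ 12 * q ^ 2 * lam * √K := by
    have e1 : q ^ 2 * 1 ≤ q ^ 2 * (lam * √K) :=
      mul_le_mul_of_nonneg_left (by nlinarith) (by positivity)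
    nlinarith
  have hG0 : 0 ≤ G := by rw [hG]; exact Real.sqrt_nonneg _
  have hlog : Real.log (d + K * (C * a + 1)) ≤ 2 * q * lam := by
    have h1 : d + K * (C * a + 1) ≤ K * q ^ 2 := by nlinarith
    have h2 := Real.log_le_log (by positivity) h1
    rw [Real.log_mul (by positivity) (by positivity), Real.log_pow] at h2
    have h3 := Real.log_le_sub_one_of_pos (show 0 < q by linarith)
    push_cast at h2
    nlinarith
  have hlog0 : 0 ≤ Real.log (d + K * (C * a + 1)) := Real.log_nonneg (by nlinarith)
  have m1 : 2 * (C * (H + 1) + 1) ≤ 2 * q ^ 2 := by linarith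
  have m2 : (C * a + 1) * a ≤ q ^ 2 * q :=
    mul_le_mul (by linarith) (by linarith) (by linarith) (by positivity)
  have m3 : (C * a + 1) * a * (G + d + C * a + 2) ≤ q ^ 2 * q * (12 * q ^ 2 * lam * √K) :=
    mul_le_mul m2 hG2 (by positivity) (by positivity)
  have m4 : d * Real.log (d + K * (C * a + 1)) ≤ q * (2 * q * lam) :=
    mul_le_mul (by linarith) hlog hlog0 (by linarith)
  have m5 := mul_le_mul m1 m3 (by positivity) (by positivity)
  have m6 := mul_le_mul m5 m4 (mul_nonneg (by linarith) hlog0) (by positivity)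
  have m7 := mul_le_mul (show H ≤ q by linarith) m6
    (mul_nonneg (by positivity) (mul_nonneg (by linarith) hlog0)) (by linarith)
  refine m7.trans (le_of_eq ?_)
  ring

end Numerics

/-! ### Values and the regret -/

section Regret

open scoped Classical

variable {S O A : Type*} [Fintype S] [Fintype O] [Fintype A] [Nonempty A] {H m d K : ℕ}

lemma abs_sum_reward_le {r : Fin H → O → A → ℝ} (hr : ∀ h o a, |r h o a| ≤ 1)
    (τ : Traj O A H) : |∑ h, r h (τ h).1 (τ h).2| ≤ H := by
  refine (Finset.abs_sum_le_sum_abs _ _).trans ?_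
  refine (Finset.sum_le_sum fun h _ => hr h _ _).trans ?_
  simp

lemma POMDP.abs_value_le {M : POMDP S O A H} (hM : M.IsValid) {r : Fin H → O → A → ℝ}
    (hr : ∀ h o a, |r h o a| ≤ 1) (π : Policy O A) : |M.value r π| ≤ H := by
  refine (Finset.abs_sum_le_sum_abs _ _).trans ?_
  have h1 : ∀ τ : Traj O A H, |M.trajProb π τ * ∑ h, r h (τ h).1 (τ h).2| ≤
      M.trajProb π τ * H := by
    intro τ
    rw [abs_mul, abs_of_nonneg (hM.trajProb_nonneg _ _)]
    exact mul_le_mul_of_nonneg_left (abs_sum_reward_le hr τ) (hM.trajProb_nonneg _ _)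
  refine (Finset.sum_le_sum fun τ _ => h1 τ).trans ?_
  rw [← Finset.sum_mul, hM.sum_trajProb, one_mul]

lemma POMDP.value_sub_value_le (M N : POMDP S O A H) {r : Fin H → O → A → ℝ}
    (hr : ∀ h o a, |r h o a| ≤ 1) (π : Policy O A) :
    N.value r π - M.value r π ≤ H * tvDist H M.listProb N.listProb π := by
  rw [tvDist_listProb, value, value, ← Finset.sum_sub_distrib, Finset.mul_sum]
  refine Finset.sum_le_sum fun τ _ => ?_
  rw [← sub_mul, mul_comm]
  refine (le_abs_self _).trans ?_
  rw [abs_mul]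
  exact mul_le_mul_of_nonneg_right (abs_sum_reward_le hr τ) (abs_nonneg _)

lemma one_sub_le_successProb_of_forall {M : POMDP S O A H} (hM : M.IsValid)
    {r : Fin H → O → A → ℝ} {plan : Planner S O A H m d} {ε δ : ℝ} (hδ : 0 ≤ δ)
    (h : ∀ ω : Fin K → RoundData O A H m, M.optValue r - ε ≤ outputValue M r plan ω) :
    1 - δ ≤ successProb M r plan K ε := by
  have : successProb M r plan K ε = 1 := by
    rw [← sum_runProb hM plan K]
    exact Finset.sum_congr rfl fun ω _ => if_pos (h ω)
  linarith

/-- The policies chosen by the planner are `ε`-optimal on average, if the sum of their values is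
close to the optimum. -/
lemma optValue_sub_le_outputValue {M : POMDP S O A H} {r : Fin H → O → A → ℝ}
    {plan : Planner S O A H m d} {ε : ℝ} (hK : 0 < K) (ω : Fin K → RoundData O A H m)
    (h : ∑ k ∈ Finset.range K, (M.optValue r - M.value r (plan (prefixRounds ω k)).2) ≤ K * ε) :
    M.optValue r - ε ≤ outputValue M r plan ω := by
  have hK' : (0 : ℝ) < K := by exact_mod_cast hK
  rw [outputValue, le_div_iff₀ hK',
    Fin.sum_univ_eq_sum_range (fun k => M.value r (plan (prefixRounds ω k)).2) K]
  rw [Finset.sum_sub_distrib, Finset.sum_const, Finset.card_range, nsmul_eq_mul] at h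
  linarith

lemma LowRankModel.isLowRank (f : LowRankModel S O A H d) : f.toPOMDP.IsLowRank d :=
  ⟨f.feat, f.cofeat, fun _ _ _ _ => rfl⟩

lemma subsingleton_policy (hA : Fintype.card A = 1) : Subsingleton (Policy O A) := by
  obtain ⟨a, ha⟩ := Fintype.card_eq_one_iff.1 hA
  refine ⟨fun π π' => ?_⟩
  have h1 : ∀ p : PMF A, p a = 1 := by
    intro p
    rw [PMF.apply_eq_one_iff]
    refine Set.eq_singleton_iff_unique_mem.2 ⟨?_, fun b _ => ha b⟩
    obtain ⟨b, hb⟩ := p.support_nonempty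
    rwa [ha b] at hb
  funext l o
  refine PMF.ext fun b => ?_
  rw [ha b, h1, h1]

instance : Nonempty (Policy O A) := ⟨fun _ _ => PMF.uniformOfFintype A⟩

variable {n : ℕ}

/-- Two applications of the Cauchy-Schwarz inequality, over the episodes and over the rounds. -/
lemma sum_tvSum_le_sqrt {P Q : List (O × A) → ℝ} {b : ℝ} {plan : Planner S O A H (n + 1) d}
    {ω : Fin K → RoundData O A H (n + 1)} {k : ℕ} (hk : k ≤ K)
    (h : ∑ j ∈ before K k, ∑ x, tvDist H P Q (roundPolicy plan (prefixRounds ω j) x) ^ 2 ≤ b) :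
    ∑ j ∈ Finset.range k, tvSum H n (H - (n + 1)) P Q (plan (prefixRounds ω j)).2 ≤
      √(K * (roundSize A H (n + 1) * b)) := by
  refine Real.le_sqrt_of_sq_le ?_
  have h1 : ∀ j, tvSum H n (H - (n + 1)) P Q (plan (prefixRounds ω j)).2 ^ 2 ≤
      roundSize A H (n + 1) *
        ∑ x, tvDist H P Q (roundPolicy plan (prefixRounds ω j) x) ^ 2 := by
    intro j
    have := sq_sum_le_card_mul_sum_sq
      (s := (Finset.univ : Finset (Fin (H - (n + 1) + 1) × (Fin (n + 1 - 1) → A))))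
      (f := fun x => tvDist H P Q (roundPolicy plan (prefixRounds ω j) x))
    rw [Finset.card_univ, card_round] at this
    exact this
  have h2 := sq_sum_le_card_mul_sum_sq (s := Finset.range k)
    (f := fun j => tvSum H n (H - (n + 1)) P Q (plan (prefixRounds ω j)).2)
  refine h2.trans ?_
  have hb : ∑ j ∈ Finset.range k, ∑ x, tvDist H P Q (roundPolicy plan (prefixRounds ω j) x) ^ 2
      ≤ b := by
    rw [← sum_before hk fun j => ∑ x, tvDist H P Q (roundPolicy plan (prefixRounds ω j) x) ^ 2]
    exact h
  have h3 : ∑ j ∈ Finset.range k, tvSum H n (H - (n + 1)) P Q (plan (prefixRounds ω j)).2 ^ 2 ≤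
      roundSize A H (n + 1) * b := by
    refine (Finset.sum_le_sum fun j _ => h1 j).trans ?_
    rw [← Finset.mul_sum]
    exact mul_le_mul_of_nonneg_left hb (Nat.cast_nonneg _)
  rw [Finset.card_range]
  exact mul_le_mul (by exact_mod_cast hk) h3 (Finset.sum_nonneg fun _ _ => sq_nonneg _)
    (Nat.cast_nonneg _)

/-- On typical data the optimistic policies have small regret. -/
theorem sum_regret_le {F : Set (LowRankModel S O A H d)} {fstar : LowRankModel S O A H d}
    {r : Fin H → O → A → ℝ} {α β b : ℝ} {plan : Planner S O A H (n + 1) d} (hn : n + 1 ≤ H)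
    (hα : 0 < α) (hK : 0 < K) (hr : ∀ h o a, |r h o a| ≤ 1)
    (hF : IsWellSpecified F fstar (n + 1) α) (hplan : IsCrane plan F r β K)
    {ω : Fin K → RoundData O A H (n + 1)} (hω : IsTypical F fstar plan β b ω) :
    ∑ k ∈ Finset.range K, (fstar.toPOMDP.optValue r -
        fstar.toPOMDP.value r (plan (prefixRounds ω k)).2) ≤
      H * (2 * (1 / α * (H + 1) + 1) * ((1 / α * (Fintype.card A : ℝ) ^ (n + 1) + 1) *
        (Fintype.card A : ℝ) ^ (n + 1) * (√(K * (roundSize A H (n + 1) * b)) + d +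
          1 / α * (Fintype.card A : ℝ) ^ (n + 1) + 2)) *
        (d * Real.log (d + K * (1 / α * (Fintype.card A : ℝ) ^ (n + 1) + 1)))) := by
  have hM := hF.valid fstar hF.realizable
  have hd : 0 < d := fstar.isLowRank.pos hM (by omega)
  have hlen : ∀ k < K, (prefixRounds ω k).length < K := by
    intro k hk
    simp only [prefixRounds, List.length_take, List.length_ofFn]
    omega
  have hpred : ∀ f ∈ F, ∀ h ≤ H - (n + 1), ∃ (r : ℕ) (core : Fin r → List (O × A))
      (X : Matrix (Fin r) (Test O A n) ℝ),
      r ≤ d ∧ IsPredictor H f.toPOMDP.listProb n h (1 / α) core X := fun f hf h hh =>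
    POMDP.exists_isPredictor (hF.valid f hf) f.isLowRank (by omega)
      (hF.regular f hf h (by omega))
  have hmem : ∀ k < K, (plan (prefixRounds ω k)).1 ∈ F := fun k hk =>
    ((hplan _ (hlen k hk)).1).1
  have hstep : ∀ k ∈ Finset.range K, fstar.toPOMDP.optValue r -
      fstar.toPOMDP.value r (plan (prefixRounds ω k)).2 ≤
      H * tvDist H fstar.toPOMDP.listProb (plan (prefixRounds ω k)).1.toPOMDP.listProb
        (plan (prefixRounds ω k)).2 := by
    intro k hk
    have hk := Finset.mem_range.1 hk
    -- optimism: the true model is in the confidence set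
    have h1 : fstar.toPOMDP.optValue r ≤
        (plan (prefixRounds ω k)).1.toPOMDP.value r (plan (prefixRounds ω k)).2 :=
      ciSup_le fun π => (hplan _ (hlen k hk)).2 fstar (hω k hk).1 π
    have h2 := POMDP.value_sub_value_le fstar.toPOMDP (plan (prefixRounds ω k)).1.toPOMDP hr
      (plan (prefixRounds ω k)).2
    linarith
  refine (Finset.sum_le_sum hstep).trans ?_
  rw [← Finset.mul_sum]
  refine mul_le_mul_of_nonneg_left ?_ (Nat.cast_nonneg _)
  exact sum_tvDist_le hM.isObsProcess (by positivity) (by omega)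
    (hpred fstar hF.realizable) hK hd (fun k => (plan (prefixRounds ω k)).2)
    (fun k => (plan (prefixRounds ω k)).1.toPOMDP.listProb)
    (fun k hk => POMDP.IsValid.isObsProcess (hF.valid _ (hmem k hk)))
    (fun k hk => hpred _ (hmem k hk)) (Real.sqrt_nonneg _)
    fun k hk => sum_tvSum_le_sqrt hk.le ((hω k hk).2 _ (hplan _ (hlen k hk)).1)

end Regret

/-! ### The choice of the brackets and the conclusion -/

section Conclusion

variable {S O A : Type*} [Fintype S] [Fintype O] [Fintype A] [Nonempty A] {H m n d K N : ℕ}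

/-- A weakly revealing POMDP has at most as many states as there are tests. -/
lemma POMDP.IsWeaklyRevealing.card_le {M : POMDP S O A H} (h : M.IsWeaklyRevealing (n + 1))
    (hn : n + 1 ≤ H) : Fintype.card S ≤ Fintype.card O ^ (n + 1) * Fintype.card A ^ n := by
  classical
  rw [← h 0 (by omega)]
  refine (Matrix.rank_le_card_height _).trans (le_of_eq ?_)
  simp [mul_pow, pow_succ]
  ring

lemma exists_hasBracket_of_bracketNum_le {F : Set (LowRankModel S O A H d)} {ε : ℝ}
    (h : bracketNum F ε ≤ (N : ℕ∞)) : ∃ k ≤ N, HasBracket F ε k := by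
  by_contra hne
  push Not at hne
  have h1 : ((N : ℕ) : ℕ∞) + 1 ≤ bracketNum F ε := by
    refine le_iInf₂ fun k hk => ?_
    have : N < k := by
      by_contra hle
      exact hne k (by omega) hk
    exact_mod_cast this
  exact absurd (h1.trans h) (not_le.2 (ENat.lt_add_one_iff (ENat.natCast_ne_top _) |>.2 le_rfl))

/-- At the scale `ε_LR` the covers provide upper brackets that are accurate enough for all the
`k (g + 1) a ^ n` episodes together. -/
lemma covering_excess_le {g : ℕ} {B η s o a k : ℝ} (hB : 0 < B) (ho : 1 ≤ o) (ha : 2 ≤ a)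
    (hk : 1 ≤ k) (hH : H = g + (n + 1)) (hs : s ≤ o ^ (n + 1) * a ^ n)
    (hη : η = 1 / (4 * (2 * B + 3)) * (1 / (k * H * a ^ n)) / (o ^ (H + 2) * a ^ H)) :
    k * ((g + 1) * a ^ n) *
      (2 * (s * (2 * η) + H * (s * (2 * ((2 * B + 1) * η)) + o * (2 * η)))) ≤ 1 := by
  have ha0 : 0 < a := by linarith
  have hH1 : (1 : ℝ) ≤ H := by rw [hH]; exact_mod_cast (by omega : 1 ≤ g + (n + 1))
  have hη0 : 0 ≤ η := by rw [hη]; positivity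
  set z := o ^ (n + 1) * a ^ n with hz
  have hz0 : 0 < z := by positivity
  have hoz : o ≤ z := by
    have h1 : o ≤ o ^ (n + 1) := by simpa using pow_le_pow_right₀ ho (show 1 ≤ n + 1 by omega)
    have h2 : 1 ≤ a ^ n := one_le_pow₀ (by linarith)
    have h3 : 0 < o ^ (n + 1) := by positivity
    nlinarith
  have hE : s * (2 * η) + H * (s * (2 * ((2 * B + 1) * η)) + o * (2 * η)) ≤
      2 * (2 * B + 3) * (H * (z * η)) := by
    have h1 : s * η ≤ z * η := mul_le_mul_of_nonneg_right hs hη0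
    have h2 : o * η ≤ z * η := mul_le_mul_of_nonneg_right hoz hη0
    have h3 : s * (2 * ((2 * B + 1) * η)) ≤ 2 * (2 * B + 1) * (z * η) := by nlinarith
    have h4 : s * (2 * ((2 * B + 1) * η)) + o * (2 * η) ≤ (2 * (2 * B + 1) + 2) * (z * η) := by
      linarith
    have h5 := mul_le_mul_of_nonneg_left h4 (zero_le_one.trans hH1)
    have h6 : 0 ≤ z * η := by positivity
    nlinarith
  -- as `a ≥ 2`, the factor `a ^ (g + 1)` of `a ^ H` pays for the `g + 1` values of the step `h`
  have hgpow : ((g : ℝ) + 1) ≤ a ^ (g + 1) := by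
    have h1 : (g + 1 : ℕ) < 2 ^ (g + 1) := Nat.lt_two_pow_self
    have h2 : ((g : ℝ) + 1) ≤ 2 ^ (g + 1) := by exact_mod_cast h1.le
    exact h2.trans (pow_le_pow_left₀ (by norm_num) ha _)
  have hB3 : 0 < 2 * B + 3 := by linarith
  have hpos : 0 ≤ k * ((g + 1) * a ^ n) := by positivity
  refine (mul_le_mul_of_nonneg_left (mul_le_mul_of_nonneg_left hE zero_le_two) hpos).trans ?_
  have hval : k * ((g + 1) * a ^ n) * (2 * (2 * (2 * B + 3) * (H * (z * η)))) =
      (g + 1) / (o ^ (g + 2) * a ^ (g + 1)) := by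
    have hH0 : (H : ℝ) ≠ 0 := by linarith
    have e1 : o ^ (H + 2) = o ^ (n + 1) * o ^ (g + 2) := by rw [← pow_add]; congr 1; omega
    have e2 : a ^ H = a ^ n * a ^ (g + 1) := by rw [← pow_add]; congr 1; omega
    rw [hη, hz, e1, e2]
    have : a ^ n ≠ 0 := by positivity
    have : o ^ (n + 1) ≠ 0 := by positivity
    have : o ^ (g + 2) ≠ 0 := by positivity
    have : a ^ (g + 1) ≠ 0 := by positivity
    field_simp
    ring
  rw [hval, div_le_one (by positivity)]
  have : 1 ≤ o ^ (g + 2) := one_le_pow₀ ho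
  have h0 : 0 < a ^ (g + 1) := by positivity
  nlinarith

lemma nonempty_of_sum_eq_one {ι : Type*} [Fintype ι] {p : ι → ℝ} (h : ∑ i, p i = 1) :
    Nonempty ι := by
  by_contra hne
  rw [not_nonempty_iff] at hne
  simp at h

/-- For both choices of `N` there are at most `N` upper brackets that are accurate enough. -/
lemma exists_hasUpperBracket {F : Set (LowRankModel S O A H d)} {fstar : LowRankModel S O A H d}
    {α B : ℝ} (hn : n + 1 ≤ H) (hK : 1 ≤ K) (hA : 2 ≤ Fintype.card A) (hB : 0 < B)
    (hrev : fstar.toPOMDP.IsWeaklyRevealing (n + 1)) (hF : IsWellSpecified F fstar (n + 1) α)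
    (hFB : ∀ f ∈ F, f.FeaturesBounded B)
    (hN : N = coverProd F (epsLR O A (1 / (4 * (2 * B + 3))) H (n + 1) K) ∨
      bracketNum F (epsB A H (n + 1) K) ≤ (N : ℕ∞)) :
    ∃ N' ≤ N, ∃ ε : ℝ, 0 ≤ ε ∧ ε ≤ 1 ∧ HasUpperBracket F ε N' ∧
      K * roundSize A H (n + 1) * ε ≤ 1 := by
  have hM := hF.valid fstar hF.realizable
  have hd : 0 < d := fstar.isLowRank.pos hM (by omega)
  have hS : Nonempty S := nonempty_of_sum_eq_one hM.init_sum
  have hO : Nonempty O := nonempty_of_sum_eq_one (hM.emit_sum ⟨0, by omega⟩ hS.some)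
  have hA2 : (2 : ℝ) ≤ Fintype.card A := by exact_mod_cast hA
  have hO1 : (1 : ℝ) ≤ Fintype.card O := by exact_mod_cast Fintype.card_pos (α := O)
  have hK1 : (1 : ℝ) ≤ K := by exact_mod_cast hK
  have hH1 : (1 : ℝ) ≤ H := by exact_mod_cast (by omega : 1 ≤ H)
  have hAn : (1 : ℝ) ≤ (Fintype.card A : ℝ) ^ n := one_le_pow₀ (by linarith)
  have hrs : (roundSize A H (n + 1) : ℝ) =
      ((H - (n + 1) : ℕ) + 1) * (Fintype.card A : ℝ) ^ n := by
    simp [roundSize]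
  have hKrs : (1 : ℝ) ≤ K * roundSize A H (n + 1) := by
    rw [hrs]
    have : (0 : ℝ) ≤ (H - (n + 1) : ℕ) := Nat.cast_nonneg _
    nlinarith [mul_nonneg this (zero_le_one.trans hAn)]
  have hle : ∀ {ε : ℝ}, 0 ≤ ε → K * roundSize A H (n + 1) * ε ≤ 1 → ε ≤ 1 := by
    intro ε hε h
    nlinarith
  have heps : epsB A H (n + 1) K = 1 / (K * H * (Fintype.card A : ℝ) ^ n) := rfl
  rcases hN with hN | hN
  · set η := epsLR O A (1 / (4 * (2 * B + 3))) H (n + 1) K with hη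
    have hηval : η = 1 / (4 * (2 * B + 3)) * (1 / (K * H * (Fintype.card A : ℝ) ^ n)) /
        ((Fintype.card O : ℝ) ^ (H + 2) * (Fintype.card A : ℝ) ^ H) := rfl
    have hη0 : 0 < η := by
      rw [hηval]
      have : (0 : ℝ) < Fintype.card O := by linarith
      have : (0 : ℝ) < Fintype.card A := by linarith
      positivity
    have hη1 : η ≤ 1 := by
      rw [hηval]
      have h1 : 1 ≤ K * H * (Fintype.card A : ℝ) ^ n :=
        one_le_mul_of_one_le_of_one_le (one_le_mul_of_one_le_of_one_le hK1 hH1) hAn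
      have h2 : 1 ≤ (Fintype.card O : ℝ) ^ (H + 2) * (Fintype.card A : ℝ) ^ H :=
        one_le_mul_of_one_le_of_one_le (one_le_pow₀ hO1) (one_le_pow₀ (by linarith))
      have h3 : 1 / (K * H * (Fintype.card A : ℝ) ^ n) ≤ 1 := (div_le_one (by linarith)).2 h1
      have h4 : 1 / (4 * (2 * B + 3)) ≤ 1 := (div_le_one (by linarith)).2 (by linarith)
      rw [div_le_one (by linarith)]
      exact (mul_le_one₀ h4 (by positivity) h3).trans h2
    obtain ⟨E, hE⟩ : ∃ E : ℝ, E = Fintype.card S * (2 * η) + H * (Fintype.card S *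
      (2 * ((2 * B + 1) * η)) + Fintype.card O * (2 * η)) := ⟨_, rfl⟩
    have hE0 : 0 ≤ E := by rw [hE]; positivity
    have hmain : K * roundSize A H (n + 1) * (2 * E) ≤ 1 := by
      rw [hrs, hE]
      have hs : (Fintype.card S : ℝ) ≤
          (Fintype.card O : ℝ) ^ (n + 1) * (Fintype.card A : ℝ) ^ n := by
        exact_mod_cast hrev.card_le hn
      exact covering_excess_le (g := H - (n + 1)) hB hO1 hA2 hK1 (by omega) hs hηval
    have hE2 := hle (by positivity) hmain
    refine ⟨N, le_rfl, 2 * E, by positivity, hE2, ?_, hmain⟩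
    rw [hN]
    exact hasUpperBracket_coverProd hF.valid hB hFB hη0 hη1 hd hE (by linarith)
  · obtain ⟨k, hk, hb⟩ := exists_hasBracket_of_bracketNum_le hN
    have hε0 : 0 ≤ epsB A H (n + 1) K := by rw [heps]; positivity
    have hmain : K * roundSize A H (n + 1) * epsB A H (n + 1) K ≤ 1 := by
      rw [heps, hrs, mul_one_div, div_le_one (by positivity)]
      have h1 : ((H - (n + 1) : ℕ) : ℝ) + 1 ≤ H := by
        exact_mod_cast (by omega : H - (n + 1) + 1 ≤ H)
      have h2 := mul_le_mul_of_nonneg_right h1 (zero_le_one.trans hAn)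
      have h3 := mul_le_mul_of_nonneg_left h2 (zero_le_one.trans hK1)
      linarith
    exact ⟨k, hk, _, hε0, hle hε0 hmain, hb.hasUpperBracket hε0 hF.valid, hmain⟩

lemma HasUpperBracket.pos {F : Set (LowRankModel S O A H d)} {ε : ℝ} (h : HasUpperBracket F ε N)
    (hF : F.Nonempty) : 0 < N := by
  obtain ⟨g, -, -, hg⟩ := h
  obtain ⟨f, hf⟩ := hF
  obtain ⟨i, -⟩ := hg f hf
  exact i.pos

lemma log_le_sum_log_cover {F : Set (LowRankModel S O A H d)} {η : ℝ} (hN0 : 0 < N)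
    (hN : N ≤ coverProd F η) : Real.log N ≤
      Real.log (coverFeat F (η / d)) + Real.log (coverCofeat F (η / d)) +
        Real.log (coverEmit F η) + Real.log (coverInit F η) := by
  have h0 : coverProd F η ≠ 0 := by omega
  simp only [coverProd, mul_ne_zero_iff] at h0
  obtain ⟨⟨⟨h1, h2⟩, h3⟩, h4⟩ := h0
  have h5 : Real.log N ≤ Real.log (coverProd F η) :=
    Real.log_le_log (by exact_mod_cast hN0) (by exact_mod_cast hN)
  refine h5.trans (le_of_eq ?_)
  rw [coverProd]
  push_cast
  have h1' : (coverFeat F (η / d) : ℝ) ≠ 0 := by exact_mod_cast h1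
  have h2' : (coverCofeat F (η / d) : ℝ) ≠ 0 := by exact_mod_cast h2
  have h3' : (coverEmit F η : ℝ) ≠ 0 := by exact_mod_cast h3
  have h4' : (coverInit F η : ℝ) ≠ 0 := by exact_mod_cast h4
  rw [Real.log_mul (by positivity) h4', Real.log_mul (by positivity) h3', Real.log_mul h1' h2']

open MvPolynomial in
/-- The polynomial in the number of rounds. It does not use the variable `log |O|`. -/
noncomputable def roundsPoly : MvPolynomial (Fin 11) ℝ :=
  C (3888 ^ 4) * (X 0 + X 1 + X 2 + X 3 + X 4 + X 5 + X 6 + X 7 + X 9 + C 3) ^ 40 *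
    (1 + X 10) ^ 8

lemma eval_roundsPoly (F : Set (LowRankModel S O A H d)) (m : ℕ) (α δ ε η : ℝ) :
    MvPolynomial.eval (complexityParams F m α δ ε η) roundsPoly =
      3888 ^ 4 * (d + (Fintype.card A : ℝ) ^ m + 1 / α + Real.log (coverFeat F (η / d)) +
        Real.log (coverCofeat F (η / d)) + Real.log (coverEmit F η) + Real.log (coverInit F η) +
        H + Real.log (1 / δ) + 3) ^ 40 * (1 + Real.log (1 + 1 / ε)) ^ 8 := by
  simp only [roundsPoly, complexityParams, map_mul, map_add, map_pow, MvPolynomial.eval_C,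
    MvPolynomial.eval_X, map_one]
  rfl

/-- For accuracies below the range of the values, the required number of rounds is at least two. -/
lemma two_le_of_rounds {q ε x l k : ℝ} (hε : 0 < ε) (hεx : ε < 2 * x) (hx : 1 ≤ x) (hxq : x ≤ q)
    (hl : 0 ≤ l) (hk : 3888 ^ 4 * q ^ 40 * (1 + l) ^ 8 ≤ k * ε ^ 2) : 2 ≤ k := by
  have h1 : (1 : ℝ) ≤ (1 + l) ^ 8 := one_le_pow₀ (by linarith)
  have h2 : q ^ 2 ≤ q ^ 40 := pow_le_pow_right₀ (hx.trans hxq) (by norm_num)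
  have h3 : x ^ 2 ≤ q ^ 2 := pow_le_pow_left₀ (by linarith) hxq 2
  have h4 : 8 * x ^ 2 ≤ 3888 ^ 4 * q ^ 40 :=
    mul_le_mul (by norm_num) (h3.trans h2) (sq_nonneg x) (by norm_num)
  have h5 : 8 * x ^ 2 ≤ k * ε ^ 2 :=
    (h4.trans (le_mul_of_one_le_right ((by positivity : 0 ≤ 8 * x ^ 2).trans h4) h1)).trans hk
  have h6 : ε ^ 2 ≤ 4 * x ^ 2 := by
    have := pow_le_pow_left₀ hε.le hεx.le 2
    rwa [mul_pow, show (2 : ℝ) ^ 2 = 4 by norm_num] at this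
  have h7 : 2 * ε ^ 2 ≤ k * ε ^ 2 := by linarith
  exact le_of_mul_le_mul_right h7 (by positivity)

/-- The guarantee for at least two actions and an accuracy below the range of the values. -/
theorem one_sub_le_successProb {F : Set (LowRankModel S O A H d)}
    {fstar : LowRankModel S O A H d} {r : Fin H → O → A → ℝ} {α δ ε B : ℝ}
    {plan : Planner S O A H (n + 1) d} (hn : n + 1 ≤ H) (hα : 0 < α) (hδ : 0 < δ) (hδ1 : δ ≤ 1)
    (hε : 0 < ε) (hε2 : ε < 2 * H) (hK : 1 ≤ K) (hA : 2 ≤ Fintype.card A) (hB : 0 < B)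
    (hr : ∀ h o a, |r h o a| ≤ 1) (hrev : fstar.toPOMDP.IsWeaklyRevealing (n + 1))
    (hF : IsWellSpecified F fstar (n + 1) α) (hFB : ∀ f ∈ F, f.FeaturesBounded B) {η : ℝ}
    (hη : η = epsLR O A (1 / (4 * (2 * B + 3))) H (n + 1) K)
    (hN : N = coverProd F η ∨ (bracketNum F (epsB A H (n + 1) K) ≤ (N : ℕ∞) ∧ N ≤ coverProd F η))
    (hplan : IsCrane plan F r (craneBeta A 4 N H (n + 1) K δ) K)
    (hrounds : 1 / ε ^ 2 * MvPolynomial.eval (complexityParams F (n + 1) α δ ε η) roundsPoly ≤ K) :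
    1 - δ ≤ successProb fstar.toPOMDP r plan K ε := by
  classical
  have hM := hF.valid fstar hF.realizable
  have hd : 0 < d := fstar.isLowRank.pos hM (by omega)
  obtain ⟨N', hN', ε', hε'0, hε'1, hbr, hεK⟩ := exists_hasUpperBracket hn hK hA hB hrev hF hFB
    (hN.imp (fun h => hη ▸ h) And.left)
  have hN'0 : 0 < N' := hbr.pos ⟨fstar, hF.realizable⟩
  have hN0 : 0 < N := by omega
  have hNc : N ≤ coverProd F η := by
    rcases hN with h | h
    exacts [h.le, h.2]
  have hlogN := log_le_sum_log_cover hN0 hNc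
  have hN1 : (1 : ℝ) ≤ N := by exact_mod_cast hN0
  have hK1 : (1 : ℝ) ≤ K := by exact_mod_cast hK
  have hd1 : (1 : ℝ) ≤ d := by exact_mod_cast hd
  have hH1 : (1 : ℝ) ≤ H := by exact_mod_cast (by omega : 1 ≤ H)
  have hA2 : (2 : ℝ) ≤ Fintype.card A := by exact_mod_cast hA
  have hAn : (1 : ℝ) ≤ (Fintype.card A : ℝ) ^ n := one_le_pow₀ (by linarith)
  have hAnn : (Fintype.card A : ℝ) ^ n ≤ (Fintype.card A : ℝ) ^ (n + 1) :=
    pow_le_pow_right₀ (by linarith) (by omega)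
  set a := (Fintype.card A : ℝ) ^ (n + 1) with ha
  have ha1 : 1 ≤ a := hAn.trans hAnn
  have hC : 0 < 1 / α := by positivity
  have hD0 : 0 ≤ Real.log (1 / δ) := Real.log_nonneg ((one_le_div hδ).2 hδ1)
  have hY0 : ∀ k : ℕ, 0 ≤ Real.log k := Real.log_natCast_nonneg
  rw [eval_roundsPoly] at hrounds
  set y := Real.log (coverFeat F (η / d)) + Real.log (coverCofeat F (η / d)) +
        Real.log (coverEmit F η) + Real.log (coverInit F η) with hy
  have hy0 : 0 ≤ y := by
    have := hY0 (coverFeat F (η / d))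
    have := hY0 (coverCofeat F (η / d))
    have := hY0 (coverEmit F η)
    have := hY0 (coverInit F η)
    positivity
  obtain ⟨q, hq⟩ : ∃ q : ℝ, q = d + a + 1 / α + Real.log (coverFeat F (η / d)) +
        Real.log (coverCofeat F (η / d)) + Real.log (coverEmit F η) + Real.log (coverInit F η) +
        H + Real.log (1 / δ) + 3 := ⟨_, rfl⟩
  have hq' : q = d + a + 1 / α + y + H + Real.log (1 / δ) + 3 := by rw [hq, hy]; ring
  rw [← hq, one_div, inv_mul_le_iff₀ (by positivity), mul_comm (ε ^ 2)] at hrounds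
  have hq1 : 1 ≤ q := by linarith
  have hl0 : 0 ≤ Real.log (1 + 1 / ε) :=
    Real.log_nonneg (by linarith [show 0 < 1 / ε by positivity])
  have hK2 : (2 : ℝ) ≤ K := two_le_of_rounds hε hε2 hH1 (by linarith) hl0 hrounds
  obtain ⟨Z, hZ⟩ : ∃ Z : ℝ, Z = N * K * H * (Fintype.card A : ℝ) ^ n / δ := ⟨_, rfl⟩
  have hβ : craneBeta A 4 N H (n + 1) K δ = 4 * Real.log Z := by rw [hZ]; rfl
  have hNK : 1 * 2 ≤ (N : ℝ) * K := mul_le_mul hN1 hK2 (by norm_num) (by linarith)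
  have hHA : 1 ≤ H * (Fintype.card A : ℝ) ^ n := one_le_mul_of_one_le_of_one_le hH1 hAn
  have hNKZ : N * K / δ ≤ Z := by
    rw [hZ]
    refine div_le_div_of_nonneg_right ?_ hδ.le
    rw [mul_assoc ((N : ℝ) * K)]
    exact le_mul_of_one_le_right (by positivity) hHA
  have hZ2 : 2 ≤ Z := by
    refine le_trans ?_ hNKZ
    rw [le_div_iff₀ hδ]
    linarith
  have hlogZ : 0.69 ≤ Real.log Z :=
    (by linarith [Real.log_two_gt_d9] : (0.69 : ℝ) ≤ Real.log 2).trans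
      (Real.log_le_log (by norm_num) hZ2)
  -- threshold in Markov's inequality for `2 N K` expectations
  obtain ⟨T, hT⟩ : ∃ T : ℝ, T = 2 * (N * K / δ) := ⟨_, rfl⟩
  have hT0 : 0 < T := by rw [hT]; positivity
  have hTZ : T ≤ 2 * Z := by rw [hT]; linarith
  have hlogT : Real.log T ≤ 2 * Real.log Z := by
    have h1 := Real.log_le_log hT0 hTZ
    have h2 := Real.log_le_log (by norm_num) hZ2
    rw [Real.log_mul (by norm_num) (by linarith)] at h1
    linarith
  have hδT : 2 * (N' : ℝ) * K ≤ δ * T := by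
    have h1 : δ * T = 2 * N * K := by rw [hT]; field_simp
    have h2 : (N' : ℝ) ≤ N := by exact_mod_cast hN'
    rw [h1]
    gcongr
  have hexp : Real.exp 1 * T ≤ Real.exp (craneBeta A 4 N H (n + 1) K δ) := by
    have h1 : Real.exp (craneBeta A 4 N H (n + 1) K δ) = Z ^ 4 := by
      rw [hβ, show 4 * Real.log Z = ((4 : ℕ) : ℝ) * Real.log Z by norm_num, Real.exp_nat_mul,
        Real.exp_log (by linarith)]
    rw [h1]
    have h2 : Real.exp 1 * T ≤ 3 * (2 * Z) := by
      refine mul_le_mul (by linarith [Real.exp_one_lt_d9]) hTZ hT0.le (by norm_num)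
    have h3 : (2 : ℝ) ^ 3 ≤ Z ^ 3 := pow_le_pow_left₀ (by norm_num) hZ2 3
    have h4 := mul_le_mul_of_nonneg_left h3 (zero_le_two.trans hZ2)
    rw [show Z ^ 4 = Z * Z ^ 3 by ring]
    linarith
  have hconc := one_sub_le_sum_isTypical hF.valid hF.realizable plan hε'0 hε'1 hbr hεK hT0 hδT hexp
  refine hconc.trans (Finset.sum_le_sum fun ω _ => ?_)
  set b := 12 * (2 * Real.log T + craneBeta A 4 N H (n + 1) K δ + 1) + 2 with hb
  by_cases hω : IsTypical F fstar plan (craneBeta A 4 N H (n + 1) K δ) b ω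
  swap
  · rw [if_neg hω]
    split_ifs
    exacts [runProb_nonneg hM plan ω, le_rfl]
  rw [if_pos hω, if_pos]
  refine optValue_sub_le_outputValue (by omega) ω ?_
  refine (sum_regret_le hn hα (by omega) hr hF hplan hω).trans ?_
  refine le_trans (regret_bound_le (q := q) ?_ hd1 ha1 hC.le hH1 hK1 ?_ ?_ ?_ rfl)
    (rounds_suffice hq1 hε rfl hK1 hrounds)
  · linarith
  · have hlogK : 0 ≤ Real.log K := Real.log_nonneg hK1
    have h1 : Real.log Z ≤ q + Real.log K := by
      have e1 : Real.log Z = Real.log N + Real.log K + Real.log H +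
          Real.log ((Fintype.card A : ℝ) ^ n) + Real.log (1 / δ) := by
        rw [hZ, Real.log_div (by positivity) hδ.ne', Real.log_mul (by positivity) (by positivity),
          Real.log_mul (by positivity) (by positivity),
          Real.log_mul (by positivity) (by positivity), one_div, Real.log_inv]
        ring
      have e2 := Real.log_le_self (zero_le_one.trans hH1)
      have e3 := Real.log_le_self (zero_le_one.trans hAn)
      linarith
    have h2 : q + Real.log K ≤ q * (1 + Real.log K) := by
      have := le_mul_of_one_le_left hlogK hq1
      linarith
    rw [hb, hβ]
    linarith
  · have : 0 ≤ Real.log T := Real.log_nonneg (by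
      rw [hT]
      have : 1 ≤ N * K / δ := (one_le_div hδ).2 (by linarith)
      linarith)
    rw [hb, hβ]
    linarith
  · have h1 : (roundSize A H (n + 1) : ℝ) =
        ((H - (n + 1) : ℕ) + 1) * (Fintype.card A : ℝ) ^ n := by simp [roundSize]
    rw [h1]
    have h2 : ((H - (n + 1) : ℕ) : ℝ) + 1 ≤ H := by
      exact_mod_cast (by omega : H - (n + 1) + 1 ≤ H)
    exact mul_le_mul h2 hAnn (by positivity) (by linarith)

end Conclusion

end LowRankPSR

open LowRankPSR in
theorem corollary4 :
    (∀ (S O A : Type*) [Fintype S] [Fintype O] [Fintype A] [Nonempty A] (H d : ℕ)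
      (M : POMDP S O A H), M.IsValid → M.IsLowRank d → M.psrRank ≤ d) ∧
    ∃ (c : ℝ) (P : MvPolynomial (Fin 11) ℝ), 0 < c ∧ ∀ B : ℝ, 0 < B → ∃ c₀ : ℝ, 0 < c₀ ∧
      ∀ (S O A : Type*) [Fintype S] [Fintype O] [Fintype A] [Nonempty A] (H m d : ℕ)
        (F : Set (LowRankModel S O A H d)) (fstar : LowRankModel S O A H d)
        (r : Fin H → O → A → ℝ) (α δ ε : ℝ) (K N : ℕ) (plan : Planner S O A H m d),
        1 ≤ m → m ≤ H → 0 < α → 0 < δ → δ ≤ 1 → 0 < ε → 1 ≤ K →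
        (∀ h o a, |r h o a| ≤ 1) →
        fstar.toPOMDP.IsWeaklyRevealing m →
        IsWellSpecified F fstar m α →
        (∀ f ∈ F, f.FeaturesBounded B) →
        (N = coverProd F (epsLR O A c₀ H m K) ∨
          (bracketNum F (epsB A H m K) ≤ (N : ℕ∞) ∧ N ≤ coverProd F (epsLR O A c₀ H m K))) →
        IsCrane plan F r (craneBeta A c N H m K δ) K →
        1 / ε ^ 2 * MvPolynomial.eval
          (complexityParams F m α δ ε (epsLR O A c₀ H m K)) P ≤ K →
        1 - δ ≤ successProb fstar.toPOMDP r plan K ε := by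
  refine ⟨fun S O A _ _ _ _ H d M hM hd => M.psrRank_le hM hd, 4, roundsPoly, by norm_num,
    fun B hB => ⟨1 / (4 * (2 * B + 3)), by positivity, ?_⟩⟩
  intro S O A _ _ _ _ H m d F fstar r α δ ε K N plan hm hmH hα hδ hδ1 hε hK hr hrev hF hFB hN
    hplan hrounds
  obtain ⟨n, rfl⟩ : ∃ n, m = n + 1 := ⟨m - 1, by omega⟩
  have hM := hF.valid fstar hF.realizable
  have hK' : (0 : ℝ) < K := by exact_mod_cast hK
  rcases Nat.lt_or_ge (Fintype.card A) 2 with hA | hA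
  · -- with a single action there is only one policy
    have hA1 : Fintype.card A = 1 := by
      have := Fintype.card_pos (α := A)
      omega
    have := subsingleton_policy (O := O) hA1
    refine one_sub_le_successProb_of_forall hM hδ.le fun ω => ?_
    refine optValue_sub_le_outputValue (by omega) ω ?_
    refine (Finset.sum_nonpos fun k _ => ?_).trans (by positivity)
    rw [sub_nonpos]
    exact ciSup_le fun π => le_of_eq (congrArg _ (Subsingleton.elim _ _))
  rcases lt_or_ge ε (2 * H) with hε2 | hε2
  · exact one_sub_le_successProb hmH hα hδ hδ1 hε hε2 hK hA hB hr hrev hF hFB rfl hN hplan hrounds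
  · -- all values lie in `[-H, H]`
    refine one_sub_le_successProb_of_forall hM hδ.le fun ω => ?_
    refine optValue_sub_le_outputValue (by omega) ω ?_
    have h1 : ∀ k ∈ Finset.range K, fstar.toPOMDP.optValue r -
        fstar.toPOMDP.value r (plan (prefixRounds ω k)).2 ≤ ε := by
      intro k _
      have h2 : fstar.toPOMDP.optValue r ≤ H :=
        ciSup_le fun π => (abs_le.1 (POMDP.abs_value_le hM hr π)).2
      have h3 := (abs_le.1 (POMDP.abs_value_le hM hr (plan (prefixRounds ω k)).2)).1
      linarith
    refine (Finset.sum_le_sum h1).trans (le_of_eq ?_)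
    simp
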